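/- Let $G$ be a compact Lie group and $K\le G$ a closed subgroup, with Lie algebras $\mathfrak k\subset\mathfrak g$, and let $\mathfrak g=\mathfrak k\oplus\mathfrak p$ with $\mathfrak p$ an $\mathrm{Ad}(K)$-invariant complement, identified with the tangent space of $G/K$ at the base point. Assume that the isotropy representation splits as $\mathfrak p=\mathfrak p_1\oplus\mathfrak p_2$ into two inequivalent irreducible $\mathrm{Ad}(K)$-invariant summands, and that the isotropy is maximal, in the sense that no $\mathrm{Ad}(K)$-invariant Lie subalgebra $\mathfrak h$ satisfies $\mathfrak k\subsetneq\mathfrak h\subsetneq\mathfrak g$. Fix an $\mathrm{Ad}(K)$-invariant scalar product $Q$ on $\mathfrak p$, and for $x_1,x_2>0$ let $g=x_1\,Q|_{\mathfrak p_1}\oplus x_2\,Q|_{\mathfrak p_2}$ be the corresponding $G$-invariant Riemannian metric on $G/K$. A solution of the homogeneous Ricci flow on an interval $J\subseteq\mathbb R$ with more than one point is a pair of functions $x_1,x_2:J\to(0,\infty)$ such that $g(t)=x_1(t)\,Q|_{\mathfrak p_1}\oplus x_2(t)\,Q|_{\mathfrak p_2}$ satisfies $\partial_t g(t)=-2\,\mathrm{Ric}(g(t))$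 on $J$ (with one-sided derivatives at endpoints of $J$). Let $R(t)$ be the scalar curvature of $g(t)$. 1. For every solution of the homogeneous Ricci flow on such an interval $J$ and every $t\in J$ with $\dot x_1(t)<0$ and $\dot x_2(t)<0$ (both functions are decreasing), one has $R(t)>0$. 2. Let $(x_1,x_2)$ be a solution of the homogeneous Ricci flow defined on its maximal time interval $[0,T)$, $0<T\le\infty$ (it is not the restriction of a solution on a longer interval $[0,T')$). If $R(0)<0$, then the scalar curvature turns positive in finite time: there is a real $t_1$ with $0<t_1<T$ such that $R(t)>0$ for all $t\in[t_1,T)$. -/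

import Mathlib

open scoped Manifold ContDiff
open Set

noncomputable section

namespace HomRicci

/-! ### Curvature of invariant metrics on a reductive homogeneous space

`L` is the Lie algebra of `G`, `k` the isotropy algebra and `p` a complement of `k` in `L`, which is
identified with the tangent space of `G/K` at the base point. A `G`-invariant tensor on `G/K` is
identified with its value at the base point, i.e. with an invariant tensor on `p`. -/

section Curvature

variable {L : Type*} [LieRing L] [LieAlgebra ℝ L]
variable {k : LieSubalgebra ℝ L} {p : Submodule ℝ L}

/-- The `p`-component of an element of `L = k ⊕ p`. -/
def prP (hkp : IsCompl k.toSubmodule p) : L →ₗ[ℝ] p :=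
  p.projectionOnto k.toSubmodule hkp.symm

/-- The `k`-component of an element of `L = k ⊕ p`. -/
def prK (hkp : IsCompl k.toSubmodule p) : L →ₗ[ℝ] k.toSubmodule :=
  k.toSubmodule.projectionOnto p hkp

/-- The bilinear map `(X, Y) ↦ [X, Y]_p` on `p`. -/
def bracketP (hkp : IsCompl k.toSubmodule p) : p →ₗ[ℝ] p →ₗ[ℝ] p :=
  LinearMap.mk₂ ℝ (fun X Y => prP hkp ⁅(X : L), (Y : L)⁆)
    (by intros; simp) (by intros; simp) (by intros; simp) (by intros; simp)

/-- The map `(X, Y) ↦ (Z ↦ [[X, Y]_k, Z])`, the isotropy part of the curvature. -/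
def isotropyPart (hkp : IsCompl k.toSubmodule p) (X Y : p) : Module.End ℝ p :=
  prP hkp ∘ₗ (LieAlgebra.ad ℝ L (prK hkp ⁅(X : L), (Y : L)⁆ : L)) ∘ₗ p.subtype

/-- A scalar product: a symmetric, positive definite bilinear form. -/
structure IsScalarProduct {V : Type*} [AddCommGroup V] [Module ℝ V]
    (g : LinearMap.BilinForm ℝ V) : Prop where
  symm : ∀ X Y, g X Y = g Y X
  pos : ∀ X, X ≠ 0 → 0 < g X X

/-- `Λ X Y` stands for the Levi-Civita derivative `Λ(X) Y` at the base point (the Nomizu map of the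
Levi-Civita connection). It is characterised by being torsion free and metric. -/
structure IsLeviCivita (hkp : IsCompl k.toSubmodule p) (g : LinearMap.BilinForm ℝ p)
    (Λ : p →ₗ[ℝ] p →ₗ[ℝ] p) : Prop where
  torsion_free : ∀ X Y, Λ X Y - Λ Y X = bracketP hkp X Y
  metric : ∀ X Y Z, g (Λ X Y) Z + g Y (Λ X Z) = 0

open Classical in
/-- The Levi-Civita connection of the invariant metric `g`; see `existsUnique_isLeviCivita`. -/
def leviCivita (hkp : IsCompl k.toSubmodule p) (g : LinearMap.BilinForm ℝ p) :
    p →ₗ[ℝ] p →ₗ[ℝ] p :=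
  if h : ∃ Λ, IsLeviCivita hkp g Λ then h.choose else 0

/-- The curvature tensor at the base point:
`R(X, Y) = [Λ(X), Λ(Y)] - Λ([X, Y]_p) - ad([X, Y]_k)`. -/
def curvature (hkp : IsCompl k.toSubmodule p) (g : LinearMap.BilinForm ℝ p) (X Y : p) :
    Module.End ℝ p :=
  leviCivita hkp g X ∘ₗ leviCivita hkp g Y - leviCivita hkp g Y ∘ₗ leviCivita hkp g X
    - leviCivita hkp g (bracketP hkp X Y) - isotropyPart hkp X Y

/-- For fixed `Y, Z` the linear map `X ↦ R(X, Y) Z`. -/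
def curvatureMap (hkp : IsCompl k.toSubmodule p) (g : LinearMap.BilinForm ℝ p) (Y Z : p) :
    Module.End ℝ p where
  toFun X := curvature hkp g X Y Z
  map_add' X X' := by
    simp only [curvature, isotropyPart, LinearMap.sub_apply, LinearMap.comp_apply, map_add,
      LinearMap.add_apply, Submodule.coe_add, add_lie, Submodule.subtype_apply]
    abel
  map_smul' c X := by
    simp only [curvature, isotropyPart, LinearMap.sub_apply, LinearMap.comp_apply, map_smul,
      LinearMap.smul_apply, Submodule.coe_smul, smul_lie, Submodule.subtype_apply,
      RingHom.id_apply, smul_sub]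

/-- The Ricci tensor `Ric(Y, Z) = tr (X ↦ R(X, Y) Z)`. -/
def ricci (hkp : IsCompl k.toSubmodule p) (g : LinearMap.BilinForm ℝ p) :
    LinearMap.BilinForm ℝ p :=
  LinearMap.mk₂ ℝ (fun Y Z => LinearMap.trace ℝ p (curvatureMap hkp g Y Z))
    (fun Y Y' Z => by
      rw [← map_add]; congr 1; ext X : 1
      simp only [curvatureMap, curvature, isotropyPart, LinearMap.sub_apply, LinearMap.comp_apply,
        map_add, LinearMap.add_apply, Submodule.coe_add, lie_add, Submodule.subtype_apply,
        LinearMap.coe_mk, AddHom.coe_mk]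
      abel)
    (fun c Y Z => by
      rw [← map_smul]; congr 1; ext X : 1
      simp only [curvatureMap, curvature, isotropyPart, LinearMap.sub_apply, LinearMap.comp_apply,
        map_smul, LinearMap.smul_apply, Submodule.coe_smul, lie_smul, Submodule.subtype_apply,
        LinearMap.coe_mk, AddHom.coe_mk, smul_sub])
    (fun Y Z Z' => by
      rw [← map_add]; congr 1; ext X : 1
      simp only [curvatureMap, LinearMap.add_apply, LinearMap.coe_mk, AddHom.coe_mk, map_add])
    (fun c Y Z => by
      rw [← map_smul]; congr 1; ext X : 1
      simp only [curvatureMap, LinearMap.smul_apply, LinearMap.coe_mk, AddHom.coe_mk, map_smul])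

theorem IsScalarProduct.nondegenerate {V : Type*} [AddCommGroup V] [Module ℝ V]
    {g : LinearMap.BilinForm ℝ V} (hg : IsScalarProduct g) : g.Nondegenerate := by
  constructor
  · intro X hX
    by_contra h
    exact absurd (hX X) (hg.pos X h).ne'
  · intro X hX
    by_contra h
    exact absurd (hX X) (hg.pos X h).ne'

open Classical in
/-- The scalar curvature: the trace of the Ricci endomorphism `r`, where
`Ric(X, Y) = g(r X, Y)`. -/
def scalarCurvature [FiniteDimensional ℝ L] (hkp : IsCompl k.toSubmodule p)
    (g : LinearMap.BilinForm ℝ p) : ℝ :=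
  if hg : g.Nondegenerate then
    LinearMap.trace ℝ p ((g.toDual hg).symm.toLinearMap ∘ₗ ricci hkp g)
  else 0

theorem existsUnique_isLeviCivita [FiniteDimensional ℝ L] (hkp : IsCompl k.toSubmodule p)
    (g : LinearMap.BilinForm ℝ p) (hg : IsScalarProduct g) :
    ∃! Λ, IsLeviCivita hkp g Λ := by
  have hnd := hg.nondegenerate
  let β := bracketP hkp
  have hβ : ∀ X Y, β Y X = - β X Y := by
    intro X Y
    simp only [β, bracketP, LinearMap.mk₂_apply]
    rw [← lie_skew, map_neg]
  let κ : p →ₗ[ℝ] p →ₗ[ℝ] Module.Dual ℝ p :=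
    LinearMap.mk₂ ℝ
      (fun X Y => (1 / 2 : ℝ) • (g (β X Y) - (g.flip X) ∘ₗ β Y + (g.flip Y) ∘ₗ β.flip X))
      (by intros; ext; simp; ring) (by intros; ext; simp; ring)
      (by intros; ext; simp; ring) (by intros; ext; simp; ring)
  let Λ : p →ₗ[ℝ] p →ₗ[ℝ] p := κ.compr₂ (g.toDual hnd).symm.toLinearMap
  have hΛ : ∀ X Y Z, g (Λ X Y) Z
      = (1 / 2 : ℝ) * (g (β X Y) Z - g (β Y Z) X + g (β Z X) Y) := by
    intro X Y Z
    have : g (Λ X Y) Z = κ X Y Z := by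
      simp only [Λ, LinearMap.compr₂_apply, LinearEquiv.coe_coe]
      exact LinearMap.BilinForm.apply_toDual_symm_apply _ _
    rw [this]
    simp [κ]
    ring
  have ext_g : ∀ U V : p, (∀ Z, g U Z = g V Z) → U = V := by
    intro U V h
    have := hg.pos (U - V)
    by_contra hne
    have h1 := this (sub_ne_zero.mpr hne)
    rw [map_sub g, LinearMap.sub_apply, h, sub_self] at h1
    exact lt_irrefl _ h1
  refine ⟨Λ, ⟨?_, ?_⟩, ?_⟩
  · intro X Y
    apply ext_g
    intro Z
    rw [map_sub, LinearMap.sub_apply, hΛ, hΛ, hβ X Y, hβ X Z, hβ Y Z]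
    simp only [map_neg, LinearMap.neg_apply]
    change _ = g (β X Y) Z
    ring
  · intro X Y Z
    rw [hg.symm Y, hΛ, hΛ, hβ X Y, hβ Z X, hβ Z Y]
    simp only [map_neg, LinearMap.neg_apply]
    ring
  · intro M hM
    ext X Y : 2
    apply ext_g
    intro Z
    rw [hΛ]
    have t : ∀ X Y Z, g (M X Y) Z - g (M Y X) Z = g (β X Y) Z := by
      intro X Y Z
      rw [← LinearMap.sub_apply, ← map_sub, hM.torsion_free]
    have m := hM.metric
    have e1 := t X Y Z
    have e2 := t Y Z X
    have e3 := t Z X Y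
    have m1 := m X Y Z
    have m2 := m Y Z X
    have m3 := m Z X Y
    rw [hg.symm Y] at m1
    rw [hg.symm Z] at m2
    rw [hg.symm X] at m3
    linarith

/-- The family of invariant metrics `g(t)`, `t ∈ J`, solves the homogeneous Ricci flow
`g' = -2 Ric(g)` on `J`. -/
structure IsRicciFlowOn (hkp : IsCompl k.toSubmodule p) (g : ℝ → LinearMap.BilinForm ℝ p)
    (J : Set ℝ) : Prop where
  scalarProduct : ∀ t ∈ J, IsScalarProduct (g t)
  flow : ∀ t ∈ J, ∀ X Y : p,
    HasDerivWithinAt (fun s => g s X Y) (-2 * ricci hkp (g t) X Y) J t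

end Curvature

section Group

/-! ### Compact homogeneous spaces `G/K` -/

variable {n : ℕ} {G : Type*} [TopologicalSpace G] [ChartedSpace (EuclideanSpace ℝ (Fin n)) G]
  [Group G]

instance [LieGroup (𝓡 n) ∞ G] : LieGroup (𝓡 n) (minSmoothness ℝ 3) G := by
  rw [minSmoothness_of_isRCLikeNormedField]
  infer_instance

instance : FiniteDimensional ℝ (GroupLieAlgebra (𝓡 n) G) :=
  inferInstanceAs (FiniteDimensional ℝ (EuclideanSpace ℝ (Fin n)))

/-- The adjoint representation: `Ad a` is the derivative at `1` of `h ↦ a h a⁻¹`. -/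
def Ad (a : G) : GroupLieAlgebra (𝓡 n) G →ₗ[ℝ] GroupLieAlgebra (𝓡 n) G :=
  (show EuclideanSpace ℝ (Fin n) →L[ℝ] EuclideanSpace ℝ (Fin n) from
    mfderiv (𝓡 n) (𝓡 n) (fun h : G => a * h * a⁻¹) 1).toLinearMap

variable (n) in
/-- The velocities `γ'(0)` of the smooth curves `γ` of `G` that stay in `K` and have `γ(0) = 1`. -/
def tangentVectors (K : Subgroup G) : Set (GroupLieAlgebra (𝓡 n) G) :=
  {X | ∃ γ : ℝ → G, ContMDiff 𝓘(ℝ, ℝ) (𝓡 n) ∞ γ ∧ γ 0 = 1 ∧ (∀ t, γ t ∈ K) ∧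
    (mfderiv 𝓘(ℝ, ℝ) (𝓡 n) γ 0 (1 : ℝ) : EuclideanSpace ℝ (Fin n)) = X}

variable (n) in
/-- The Lie algebra of a closed subgroup `K` of `G`. For closed `K` the set `tangentVectors n K` is
itself a Lie subalgebra, so that taking the span adds nothing. -/
def isotropyAlgebra [LieGroup (𝓡 n) ∞ G] (K : Subgroup G) :
    LieSubalgebra ℝ (GroupLieAlgebra (𝓡 n) G) :=
  LieSubalgebra.lieSpan ℝ _ (tangentVectors n K)

variable [LieGroup (𝓡 n) ∞ G] {K : Subgroup G} {p : Submodule ℝ (GroupLieAlgebra (𝓡 n) G)}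

variable (n) in
/-- Maximality of the isotropy group: no `Ad(K)`-invariant Lie subalgebra lies strictly between the
Lie algebra of `K` and that of `G`. -/
def IsMaximalIsotropy (K : Subgroup G) : Prop :=
  ∀ h : LieSubalgebra ℝ (GroupLieAlgebra (𝓡 n) G), isotropyAlgebra n K ≤ h →
    (∀ a ∈ K, ∀ X ∈ h, Ad a X ∈ h) → h = isotropyAlgebra n K ∨ h = ⊤

/-- The isotropy representation on `p`: the restriction of `Ad a` to `p` (for `a ∈ K` and an
`Ad(K)`-invariant `p` the projection to `p` does nothing). -/
def isotropyRep (hkp : IsCompl (isotropyAlgebra n K).toSubmodule p) (a : G) : Module.End ℝ p :=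
  prP hkp ∘ₗ Ad a ∘ₗ p.subtype

/-- `W ⊆ p` is invariant under the isotropy representation of `K`. -/
def IsInvariant (hkp : IsCompl (isotropyAlgebra n K).toSubmodule p) (W : Submodule ℝ p) : Prop :=
  ∀ a ∈ K, ∀ X ∈ W, isotropyRep hkp a X ∈ W

/-- `W ⊆ p` is an irreducible summand of the isotropy representation of `K`. -/
structure IsIrreducibleSummand (hkp : IsCompl (isotropyAlgebra n K).toSubmodule p)
    (W : Submodule ℝ p) : Prop where
  ne_bot : W ≠ ⊥
  invariant : IsInvariant hkp W
  irreducible : ∀ U ≤ W, IsInvariant hkp U → U = ⊥ ∨ U = W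

/-- Two invariant summands are equivalent if there is a `K`-equivariant isomorphism. -/
def AreEquivalent (hkp : IsCompl (isotropyAlgebra n K).toSubmodule p)
    (W₁ W₂ : Submodule ℝ p) : Prop :=
  ∃ φ : W₁ ≃ₗ[ℝ] W₂, ∀ a ∈ K, ∀ X Y : W₁, (Y : p) = isotropyRep hkp a X →
    (φ Y : p) = isotropyRep hkp a (φ X)

/-- `p = p₁ ⊕ p₂` is the isotropy representation of `G/K`, an `Ad(K)`-invariant complement of the
Lie algebra of `K`, split into two inequivalent irreducible summands. -/
structure IsTwoSummandSplitting (hkp : IsCompl (isotropyAlgebra n K).toSubmodule p)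
    (p₁ p₂ : Submodule ℝ p) : Prop where
  reductive : ∀ a ∈ K, ∀ X ∈ p, Ad a X ∈ p
  isCompl : IsCompl p₁ p₂
  irreducible₁ : IsIrreducibleSummand hkp p₁
  irreducible₂ : IsIrreducibleSummand hkp p₂
  inequivalent : ¬ AreEquivalent hkp p₁ p₂

/-- An `Ad(K)`-invariant scalar product on `p`. -/
structure IsInvariantScalarProduct (hkp : IsCompl (isotropyAlgebra n K).toSubmodule p)
    (Q : LinearMap.BilinForm ℝ p) : Prop where
  scalarProduct : IsScalarProduct Q
  invariant : ∀ a ∈ K, ∀ X Y, Q (isotropyRep hkp a X) (isotropyRep hkp a Y) = Q X Y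

end Group

section Flow

/-- The bilinear form `x₁ Q|p₁ ⊕ x₂ Q|p₂` on `V = p₁ ⊕ p₂`. -/
def diagForm {V : Type*} [AddCommGroup V] [Module ℝ V] {p₁ p₂ : Submodule ℝ V}
    (h : IsCompl p₁ p₂) (Q : LinearMap.BilinForm ℝ V) (x₁ x₂ : ℝ) : LinearMap.BilinForm ℝ V :=
  x₁ • Q.compl₁₂ (p₁.projection p₂ h) (p₁.projection p₂ h)
    + x₂ • Q.compl₁₂ (p₂.projection p₁ h.symm) (p₂.projection p₁ h.symm)

variable {L : Type*} [LieRing L] [LieAlgebra ℝ L]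
variable {k : LieSubalgebra ℝ L} {p : Submodule ℝ L}

/-- `(x₁, x₂)` is a solution of the homogeneous Ricci flow on `J`: `x₁, x₂ > 0`, and the metrics
`x₁(t) Q|p₁ ⊕ x₂(t) Q|p₂` solve the Ricci flow. -/
structure IsHRF (hkp : IsCompl k.toSubmodule p) {p₁ p₂ : Submodule ℝ p} (h : IsCompl p₁ p₂)
    (Q : LinearMap.BilinForm ℝ p) (x₁ x₂ : ℝ → ℝ) (J : Set ℝ) : Prop where
  pos₁ : ∀ t ∈ J, 0 < x₁ t
  pos₂ : ∀ t ∈ J, 0 < x₂ t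
  flow : IsRicciFlowOn hkp (fun t => diagForm h Q (x₁ t) (x₂ t)) J

/-- The time interval `[0, T)`, where `T ≤ ∞`. -/
def timeInterval (T : EReal) : Set ℝ := {t | 0 ≤ t ∧ (t : EReal) < T}

/-- `(x₁, x₂)` is a solution of the homogeneous Ricci flow with maximal time interval `[0, T)`,
`0 < T ≤ ∞`: it cannot be extended to a solution on a longer interval `[0, T')`. -/
structure IsMaximalHRF (hkp : IsCompl k.toSubmodule p) {p₁ p₂ : Submodule ℝ p} (h : IsCompl p₁ p₂)
    (Q : LinearMap.BilinForm ℝ p) (x₁ x₂ : ℝ → ℝ) (T : EReal) : Prop where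
  pos : 0 < T
  isHRF : IsHRF hkp h Q x₁ x₂ (timeInterval T)
  maximal : ∀ T', T < T' → ∀ z₁ z₂ : ℝ → ℝ, IsHRF hkp h Q z₁ z₂ (timeInterval T') →
    ¬ (EqOn x₁ z₁ (timeInterval T) ∧ EqOn x₂ z₂ (timeInterval T))

end Flow

end HomRicci

end

noncomputable section

namespace HomRicci

set_option linter.unusedSectionVars false

/-! ### The adjoint representation and its derivative at the identity -/

section AdjointRepresentation

variable {n : ℕ} {G : Type*} [TopologicalSpace G] [ChartedSpace (EuclideanSpace ℝ (Fin n)) G]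
  [Group G] [LieGroup (𝓡 n) ∞ G]

/-! Compactness of $G$ gives an $\mathrm{Ad}(G)$-invariant scalar product $B$ on $\mathfrak g$,
hence an invariant scalar product $Q_0$ on $\mathfrak p\cong\mathfrak g/\mathfrak k$. By Schur's
lemma the given $Q$ is a positive multiple of $Q_0$ on each summand, and the Ricci tensor of
$x\,Q_0|_{\mathfrak p_1}\oplus y\,Q_0|_{\mathfrak p_2}$ has the form $r_1Q_0|_{\mathfrak p_1}\oplus
r_2Q_0|_{\mathfrak p_2}$. The flow is therefore the planar system $x'=-2r_1$, $y'=-2r_2$.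

To find $r_1,r_2$, the curvature is computed with lifts of $\mathfrak p$ to $\mathfrak k^{\perp_B}$
(`curvature_eq_liftConnection`), since $\mathfrak p$ itself need not be $B$-orthogonal to $\mathfrak
k$. For these lifts the structure constants are totally skew, and tracing over $\mathfrak p_1$
yields $d_1r_1=E_1-\frac A2\frac yx+\frac C4\frac{x^2}{y^2}$, with the mirror formula for $r_2$.
Here $A$ and $C$ are the squared norms of the $\mathfrak p_2$-part of $[\mathfrak p_1,\mathfrak
p_1]$ and of the $\mathfrak p_1$-part of $[\mathfrak p_2,\mathfrak p_2]$, and $A\le E_1$, $C\le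
E_2$. Maximality of the isotropy enters only through $A,C>0$: otherwise $\mathfrak k\oplus\mathfrak
p_1$ or $\mathfrak k\oplus\mathfrak p_2$ would be an invariant intermediate subalgebra
(`not_liftBracketP_mem`).

The scalar curvature is $R=d_1r_1/x+d_2r_2/y$. If both functions decrease, then $r_1,r_2>0$ and so
$R>0$; this is the first claim.

For the second, $R'=2\bigl(d_1(r_1/x)^2+d_2(r_2/y)^2\bigr)\ge0$, so a single time with $R>0$
suffices. Suppose $R\le0$ throughout. Since $R>0$ on the diagonal $x=y$, the trajectory stays on one
side, say $x<y$. There $R\le0$ forces $r_1<0$ (`r₁_neg_of_scal_nonpos`), so $x$ increases, while $y$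
decreases at least at the rate $E_2/d_2$ (`le_r₂`). Hence $T<\infty$ and $x(0)\le x<y\le y(0)$; both
functions converge to positive limits, and the solution continues beyond $T$
(`IsSol.exists_extension`), against maximality. -/

variable (n) in
theorem contMDiff_conj :
    ContMDiff ((𝓡 n).prod (𝓡 n)) (𝓡 n) ∞ (fun q : G × G => q.1 * q.2 * q.1⁻¹) :=
  (contMDiff_fst.mul contMDiff_snd).mul contMDiff_fst.inv

variable (n) in
theorem contMDiff_conj_right (a : G) : ContMDiff (𝓡 n) (𝓡 n) ∞ (fun h : G => a * h * a⁻¹) :=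
  (contMDiff_const.mul contMDiff_id).mul contMDiff_const

variable (n) in
/-- The adjoint representation as a continuous linear map. -/
def adL (a : G) : EuclideanSpace ℝ (Fin n) →L[ℝ] EuclideanSpace ℝ (Fin n) :=
  mfderiv (𝓡 n) (𝓡 n) (fun h : G => a * h * a⁻¹) 1

theorem Ad_apply (a : G) (X : GroupLieAlgebra (𝓡 n) G) : Ad a X = adL n a X := rfl

theorem hasMFDerivAt_conj (a : G) :
    HasMFDerivAt (𝓡 n) (𝓡 n) (fun h : G => a * h * a⁻¹) 1 (adL n a) :=
  ((contMDiff_conj_right n a).mdifferentiableAt (by simp)).hasMFDerivAt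

theorem adL_one : adL n (1 : G) = ContinuousLinearMap.id ℝ _ := by
  have : (fun h : G => 1 * h * 1⁻¹) = id := by ext; simp
  rw [adL, this]
  exact mfderiv_id

theorem adL_mul (a b : G) : adL n (a * b) = (adL n a).comp (adL n b) := by
  have h1 : HasMFDerivAt (𝓡 n) (𝓡 n) (fun h : G => a * h * a⁻¹) (b * 1 * b⁻¹) (adL n a) := by
    rw [mul_one, mul_inv_cancel]; exact hasMFDerivAt_conj a
  have h2 := h1.comp (1 : G) (hasMFDerivAt_conj b)
  have h3 : (fun h : G => a * h * a⁻¹) ∘ (fun h : G => b * h * b⁻¹)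
      = fun h : G => a * b * h * (a * b)⁻¹ := by ext; simp [mul_assoc]
  rw [h3] at h2
  exact h2.mfderiv

variable (n) in
theorem contMDiff_adL : ContMDiff (𝓡 n) 𝓘(ℝ, EuclideanSpace ℝ (Fin n) →L[ℝ] EuclideanSpace ℝ (Fin n)) ∞
    (fun a : G => adL n a) := by
  intro a₀
  have : IsManifold (𝓡 n) 1 G := IsManifold.of_le (n := ∞) (by simp)
  have h := ContMDiffAt.mfderiv (I := 𝓡 n) (I' := 𝓡 n) (J := 𝓡 n) (x₀ := a₀)
    (n := ∞) (m := ∞) (fun a h : G => a * h * a⁻¹) (fun _ => (1 : G))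
    (contMDiff_conj n _) contMDiffAt_const (by simp)
  refine h.congr_of_eventuallyEq (Filter.Eventually.of_forall fun a => ?_)
  -- Smoothness of the derivative is available in tangent coordinates. Conjugation fixes the
  -- identity, so source and target charts never change and both coordinate changes are trivial.
  have hc : ∀ b : G, b * 1 * b⁻¹ = 1 := by simp
  refine ((inTangentCoordinates_eq (I := 𝓡 n) (I' := 𝓡 n) (fun _ : G => (1 : G))
    (fun a : G => a * 1 * a⁻¹) (fun a : G => adL n a) (mem_chart_source _ _)
    (by simp only [hc]; exact mem_chart_source _ _)).trans ?_).symm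
  ext1 v
  simp only [hc, ContinuousLinearMap.comp_apply]
  rw [(tangentBundleCore (𝓡 n) G).coordChange_self _ _ (mem_chart_source _ (1 : G)),
    (tangentBundleCore (𝓡 n) G).coordChange_self _ _ (mem_chart_source _ (1 : G))]

theorem adL_inv_comp (a : G) : (adL n a⁻¹).comp (adL n a) = ContinuousLinearMap.id ℝ _ := by
  rw [← adL_mul, inv_mul_cancel, adL_one]

/-- `d(L_a) w = d(R_a) (Ad a w)` at the identity. -/
theorem mfderiv_mul_left_eq_mfderiv_mul_right (a : G) (w : EuclideanSpace ℝ (Fin n)) :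
    (mfderiv (𝓡 n) (𝓡 n) (fun h : G => a * h) 1 w : EuclideanSpace ℝ (Fin n))
      = (mfderiv (𝓡 n) (𝓡 n) (fun h : G => h * a) 1 (adL n a w) : EuclideanSpace ℝ (Fin n)) := by
  have hR : MDifferentiableAt (𝓡 n) (𝓡 n) (fun h : G => h * a) 1 :=
    (contMDiff_mul_right (n := ∞)).mdifferentiableAt (by simp)
  have h1 : HasMFDerivAt (𝓡 n) (𝓡 n) (fun h : G => h * a) (a * 1 * a⁻¹)
      (mfderiv (𝓡 n) (𝓡 n) (fun h : G => h * a) 1 : EuclideanSpace ℝ (Fin n) →L[ℝ] EuclideanSpace ℝ (Fin n)) := by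
    rw [mul_one, mul_inv_cancel]; exact hR.hasMFDerivAt
  have h2 := h1.comp (1 : G) (hasMFDerivAt_conj a)
  have h3 : (fun h : G => h * a) ∘ (fun h : G => a * h * a⁻¹) = fun h : G => a * h := by
    ext; simp [mul_assoc]
  rw [h3] at h2
  rw [h2.mfderiv]
  rfl

variable (n G) in
/-- The multiplication of `G` in the chart at `1`. -/
def chartMul (q : EuclideanSpace ℝ (Fin n) × EuclideanSpace ℝ (Fin n)) : EuclideanSpace ℝ (Fin n) :=
  extChartAt (𝓡 n) (1 : G)
    ((extChartAt (𝓡 n) (1 : G)).symm q.1 * (extChartAt (𝓡 n) (1 : G)).symm q.2)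

variable (n G) in
/-- The coordinates of `1` in the chart at `1`. -/
def chartOne : EuclideanSpace ℝ (Fin n) := extChartAt (𝓡 n) (1 : G) 1

theorem contDiffAt_chartMul :
    ContDiffAt ℝ ∞ (chartMul n G) (chartOne n G, chartOne n G) := by
  rw [← contMDiffAt_iff_contDiffAt]
  have hs : ContMDiffAt 𝓘(ℝ, EuclideanSpace ℝ (Fin n)) (𝓡 n) ∞
      (extChartAt (𝓡 n) (1 : G)).symm (chartOne n G) :=
    (contMDiffOn_extChartAt_symm (1 : G)).contMDiffAt (extChartAt_target_mem_nhds (1 : G))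
  have h1 : (extChartAt (𝓡 n) (1 : G)).symm (chartOne n G) = 1 := extChartAt_to_inv (1 : G)
  have h2 := (hs.comp (chartOne n G, chartOne n G) contDiffAt_fst.contMDiffAt).mul
    (hs.comp (chartOne n G, chartOne n G) contDiffAt_snd.contMDiffAt)
  refine ContMDiffAt.comp (chartOne n G, chartOne n G) (g := extChartAt (𝓡 n) (1 : G)) ?_ h2
  simp only [h1, mul_one]
  exact contMDiffAt_extChartAt

theorem eventually_chart :
    ∀ᶠ x in nhds (chartOne n G), x ∈ (extChartAt (𝓡 n) (1 : G)).target :=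
  extChartAt_target_mem_nhds (1 : G)

/-- The tangent space at `1` is identified with the model space through this very chart, so the
chart has identity derivative there. -/
theorem mfderiv_extChartAt_symm_chartOne :
    HasMFDerivAt 𝓘(ℝ, EuclideanSpace ℝ (Fin n)) (𝓡 n) (extChartAt (𝓡 n) (1 : G)).symm
      (chartOne n G) (ContinuousLinearMap.id ℝ (EuclideanSpace ℝ (Fin n))) := by
  have : IsManifold (𝓡 n) 1 G := IsManifold.of_le (n := ∞) (by simp)
  have h := mdifferentiableWithinAt_extChartAt_symm (I := 𝓡 n) (mem_extChartAt_target (I := 𝓡 n) (1 : G))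
  have h2 := mfderivWithin_range_extChartAt_symm (I := 𝓡 n) (x := (1 : G))
  simp only [ModelWithCorners.range_eq_univ, mfderivWithin_univ, mdifferentiableWithinAt_univ] at h h2
  have h3 := h.hasMFDerivAt
  rw [h2] at h3
  exact h3

/-- The partial derivative of the multiplication in its second argument. -/
theorem fderiv_chartMul_right {x : EuclideanSpace ℝ (Fin n)}
    (hx : x ∈ (extChartAt (𝓡 n) (1 : G)).target)
    (hd : DifferentiableAt ℝ (chartMul n G) (x, chartOne n G)) (w : EuclideanSpace ℝ (Fin n)) :
    fderiv ℝ (chartMul n G) (x, chartOne n G) (0, w)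
      = mfderiv (𝓡 n) 𝓘(ℝ, EuclideanSpace ℝ (Fin n)) (extChartAt (𝓡 n) (1 : G))
          ((extChartAt (𝓡 n) (1 : G)).symm x)
          (mfderiv (𝓡 n) (𝓡 n) (fun h : G => (extChartAt (𝓡 n) (1 : G)).symm x * h) 1 w :
            EuclideanSpace ℝ (Fin n)) := by
  have : IsManifold (𝓡 n) 1 G := IsManifold.of_le (n := ∞) (by simp)
  set a := (extChartAt (𝓡 n) (1 : G)).symm x with ha
  have h1 : HasFDerivAt (fun y => chartMul n G (x, y))
      ((fderiv ℝ (chartMul n G) (x, chartOne n G)).comp (ContinuousLinearMap.inr ℝ _ _)) (chartOne n G) :=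
    hd.hasFDerivAt.comp (chartOne n G) (hasFDerivAt_prodMk_right x _)
  have hone : (extChartAt (𝓡 n) (1 : G)).symm (chartOne n G) = 1 := extChartAt_to_inv (1 : G)
  have hsrc : a ∈ (chartAt (EuclideanSpace ℝ (Fin n)) (1 : G)).source := by
    rw [← extChartAt_source (𝓡 n)]; exact (extChartAt (𝓡 n) (1 : G)).map_target hx
  have hφ : HasMFDerivAt (𝓡 n) 𝓘(ℝ, EuclideanSpace ℝ (Fin n)) (extChartAt (𝓡 n) (1 : G))
      (a * (extChartAt (𝓡 n) (1 : G)).symm (chartOne n G))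
      (mfderiv (𝓡 n) 𝓘(ℝ, EuclideanSpace ℝ (Fin n)) (extChartAt (𝓡 n) (1 : G)) a : EuclideanSpace ℝ (Fin n) →L[ℝ] EuclideanSpace ℝ (Fin n)) := by
    rw [hone, mul_one]
    exact (mdifferentiableAt_extChartAt hsrc).hasMFDerivAt
  have hL : HasMFDerivAt (𝓡 n) (𝓡 n) (fun h : G => a * h) ((extChartAt (𝓡 n) (1 : G)).symm (chartOne n G))
      (mfderiv (𝓡 n) (𝓡 n) (fun h : G => a * h) 1 : EuclideanSpace ℝ (Fin n) →L[ℝ] EuclideanSpace ℝ (Fin n)) := by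
    rw [hone]
    exact ((contMDiff_mul_left (n := ∞)).mdifferentiableAt (by simp)).hasMFDerivAt
  have h2 := (hφ.comp ((extChartAt (𝓡 n) (1 : G)).symm (chartOne n G)) hL).comp (chartOne n G)
    (mfderiv_extChartAt_symm_chartOne (n := n) (G := G))
  let A : EuclideanSpace ℝ (Fin n) →L[ℝ] EuclideanSpace ℝ (Fin n) :=
    mfderiv (𝓡 n) 𝓘(ℝ, EuclideanSpace ℝ (Fin n)) (extChartAt (𝓡 n) (1 : G)) a
  let B : EuclideanSpace ℝ (Fin n) →L[ℝ] EuclideanSpace ℝ (Fin n) :=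
    mfderiv (𝓡 n) (𝓡 n) (fun h : G => a * h) 1
  have h3 : HasFDerivAt (fun y => chartMul n G (x, y)) (A.comp B) (chartOne n G) := h2.hasFDerivAt
  exact (DFunLike.congr_fun (h3.unique h1) w).symm

theorem fderiv_chartMul_left {x : EuclideanSpace ℝ (Fin n)}
    (hx : x ∈ (extChartAt (𝓡 n) (1 : G)).target)
    (hd : DifferentiableAt ℝ (chartMul n G) (chartOne n G, x)) (w : EuclideanSpace ℝ (Fin n)) :
    fderiv ℝ (chartMul n G) (chartOne n G, x) (w, 0)
      = mfderiv (𝓡 n) 𝓘(ℝ, EuclideanSpace ℝ (Fin n)) (extChartAt (𝓡 n) (1 : G))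
          ((extChartAt (𝓡 n) (1 : G)).symm x)
          (mfderiv (𝓡 n) (𝓡 n) (fun h : G => h * (extChartAt (𝓡 n) (1 : G)).symm x) 1 w :
            EuclideanSpace ℝ (Fin n)) := by
  have : IsManifold (𝓡 n) 1 G := IsManifold.of_le (n := ∞) (by simp)
  set a := (extChartAt (𝓡 n) (1 : G)).symm x with ha
  have h1 : HasFDerivAt (fun y => chartMul n G (y, x))
      ((fderiv ℝ (chartMul n G) (chartOne n G, x)).comp (ContinuousLinearMap.inl ℝ _ _)) (chartOne n G) :=
    HasFDerivAt.comp (chartOne n G) (f := fun y => (y, x)) hd.hasFDerivAt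
      (hasFDerivAt_prodMk_left _ x)
  have hone : (extChartAt (𝓡 n) (1 : G)).symm (chartOne n G) = 1 := extChartAt_to_inv (1 : G)
  have hsrc : a ∈ (chartAt (EuclideanSpace ℝ (Fin n)) (1 : G)).source := by
    rw [← extChartAt_source (𝓡 n)]; exact (extChartAt (𝓡 n) (1 : G)).map_target hx
  have hφ : HasMFDerivAt (𝓡 n) 𝓘(ℝ, EuclideanSpace ℝ (Fin n)) (extChartAt (𝓡 n) (1 : G))
      ((extChartAt (𝓡 n) (1 : G)).symm (chartOne n G) * a)
      (mfderiv (𝓡 n) 𝓘(ℝ, EuclideanSpace ℝ (Fin n)) (extChartAt (𝓡 n) (1 : G)) a : EuclideanSpace ℝ (Fin n) →L[ℝ] EuclideanSpace ℝ (Fin n)) := by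
    rw [hone, one_mul]
    exact (mdifferentiableAt_extChartAt hsrc).hasMFDerivAt
  have hL : HasMFDerivAt (𝓡 n) (𝓡 n) (fun h : G => h * a) ((extChartAt (𝓡 n) (1 : G)).symm (chartOne n G))
      (mfderiv (𝓡 n) (𝓡 n) (fun h : G => h * a) 1 : EuclideanSpace ℝ (Fin n) →L[ℝ] EuclideanSpace ℝ (Fin n)) := by
    rw [hone]
    exact ((contMDiff_mul_right (n := ∞)).mdifferentiableAt (by simp)).hasMFDerivAt
  have h2 := (hφ.comp ((extChartAt (𝓡 n) (1 : G)).symm (chartOne n G)) hL).comp (chartOne n G)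
    (mfderiv_extChartAt_symm_chartOne (n := n) (G := G))
  let A : EuclideanSpace ℝ (Fin n) →L[ℝ] EuclideanSpace ℝ (Fin n) :=
    mfderiv (𝓡 n) 𝓘(ℝ, EuclideanSpace ℝ (Fin n)) (extChartAt (𝓡 n) (1 : G)) a
  let B : EuclideanSpace ℝ (Fin n) →L[ℝ] EuclideanSpace ℝ (Fin n) :=
    mfderiv (𝓡 n) (𝓡 n) (fun h : G => h * a) 1
  have h3 : HasFDerivAt (fun y => chartMul n G (y, x)) (A.comp B) (chartOne n G) := h2.hasFDerivAt
  exact (DFunLike.congr_fun (h3.unique h1) w).symm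

/-- The relation $dL_a=dR_a\circ\mathrm{Ad}(a)$ in coordinates. Differentiating it in `x` at the
identity expresses the derivative of $\mathrm{Ad}$ by second derivatives of the multiplication. -/
theorem fderiv_chartMul_right_eq_left {x : EuclideanSpace ℝ (Fin n)}
    (hx : x ∈ (extChartAt (𝓡 n) (1 : G)).target)
    (hd : DifferentiableAt ℝ (chartMul n G) (x, chartOne n G))
    (hd' : DifferentiableAt ℝ (chartMul n G) (chartOne n G, x)) (w : EuclideanSpace ℝ (Fin n)) :
    fderiv ℝ (chartMul n G) (x, chartOne n G) (0, w)
      = fderiv ℝ (chartMul n G) (chartOne n G, x)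
          (adL n ((extChartAt (𝓡 n) (1 : G)).symm x) w, 0) := by
  rw [fderiv_chartMul_right hx hd, fderiv_chartMul_left hx hd', mfderiv_mul_left_eq_mfderiv_mul_right]

/-- The left-invariant vector fields in the chart at `1`. -/
theorem mpullbackWithin_mulInvariantVectorField {x : EuclideanSpace ℝ (Fin n)}
    (hx : x ∈ (extChartAt (𝓡 n) (1 : G)).target)
    (hd : DifferentiableAt ℝ (chartMul n G) (x, chartOne n G)) (w : EuclideanSpace ℝ (Fin n)) :
    VectorField.mpullbackWithin 𝓘(ℝ, EuclideanSpace ℝ (Fin n)) (𝓡 n) (extChartAt (𝓡 n) (1 : G)).symm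
      (mulInvariantVectorField (I := 𝓡 n) (G := G) w) (range (𝓡 n)) x
      = fderiv ℝ (chartMul n G) (x, chartOne n G) (0, w) := by
  have : IsManifold (𝓡 n) 1 G := IsManifold.of_le (n := ∞) (by simp)
  rw [fderiv_chartMul_right hx hd, VectorField.mpullbackWithin_apply,
    ContinuousLinearMap.inverse_eq (mfderivWithin_extChartAt_symm_comp_mfderiv_extChartAt hx)
      (mfderiv_extChartAt_comp_mfderivWithin_extChartAt_symm hx)]
  rfl

theorem eventually_chartMul_differentiable :
    ∀ᶠ x in nhds (chartOne n G), x ∈ (extChartAt (𝓡 n) (1 : G)).target ∧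
      DifferentiableAt ℝ (chartMul n G) (x, chartOne n G) ∧
      DifferentiableAt ℝ (chartMul n G) (chartOne n G, x) := by
  have h : ∀ᶠ q in nhds (chartOne n G, chartOne n G), DifferentiableAt ℝ (chartMul n G) q := by
    have h1 : ContDiffAt ℝ 1 (chartMul n G) (chartOne n G, chartOne n G) :=
      contDiffAt_chartMul.of_le (by simp)
    exact (h1.eventually (by simp)).mono fun q hq => hq.differentiableAt (by simp)
  have c1 : Continuous fun x : EuclideanSpace ℝ (Fin n) => (x, chartOne n G) := by fun_prop
  have c2 : Continuous fun x : EuclideanSpace ℝ (Fin n) => (chartOne n G, x) := by fun_prop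
  exact eventually_chart.and ((c1.continuousAt.eventually h).and (c2.continuousAt.eventually h))

theorem fderiv_chartMul_one (u w : EuclideanSpace ℝ (Fin n)) :
    fderiv ℝ (chartMul n G) (chartOne n G, chartOne n G) (u, w) = u + w := by
  have : IsManifold (𝓡 n) 1 G := IsManifold.of_le (n := ∞) (by simp)
  obtain ⟨h1, h2, h3⟩ := (eventually_chartMul_differentiable (n := n) (G := G)).self_of_nhds
  have hone : (extChartAt (𝓡 n) (1 : G)).symm (chartOne n G) = 1 := extChartAt_to_inv (1 : G)
  have e : ((u, w) : EuclideanSpace ℝ (Fin n) × EuclideanSpace ℝ (Fin n)) = (u, 0) + (0, w) := by simp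
  rw [e, map_add, fderiv_chartMul_right h1 h2, fderiv_chartMul_left h1 h2]
  have e1 : (fun h : G => (extChartAt (𝓡 n) (1 : G)).symm (chartOne n G) * h) = id := by
    simp only [hone, one_mul]; rfl
  have e2 : (fun h : G => h * (extChartAt (𝓡 n) (1 : G)).symm (chartOne n G)) = id := by
    simp only [hone, mul_one]; rfl
  rw [e1, e2, hone]
  have e3 : (mfderiv (𝓡 n) 𝓘(ℝ, EuclideanSpace ℝ (Fin n)) (extChartAt (𝓡 n) (1 : G)) 1 :
    EuclideanSpace ℝ (Fin n) →L[ℝ] EuclideanSpace ℝ (Fin n)) = ContinuousLinearMap.id ℝ _ :=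
    mfderiv_extChartAt_self
  have e4 : (mfderiv (𝓡 n) (𝓡 n) (id : G → G) 1 :
    EuclideanSpace ℝ (Fin n) →L[ℝ] EuclideanSpace ℝ (Fin n)) = ContinuousLinearMap.id ℝ _ :=
    mfderiv_id
  erw [e3, e4]
  rfl

theorem hasFDerivAt_fderiv_chartMul :
    HasFDerivAt (fderiv ℝ (chartMul n G))
      (fderiv ℝ (fderiv ℝ (chartMul n G)) (chartOne n G, chartOne n G))
      (chartOne n G, chartOne n G) := by
  have h : ContDiffAt ℝ 1 (fderiv ℝ (chartMul n G)) (chartOne n G, chartOne n G) :=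
    contDiffAt_chartMul.fderiv_right (m := 1) (by norm_cast)
  exact (h.differentiableAt (by simp)).hasFDerivAt

theorem hasFDerivAt_chartMul_right (w : EuclideanSpace ℝ (Fin n)) :
    HasFDerivAt (fun x => fderiv ℝ (chartMul n G) (x, chartOne n G) (0, w))
      (((fderiv ℝ (fderiv ℝ (chartMul n G)) (chartOne n G, chartOne n G)).comp
        (ContinuousLinearMap.inl ℝ _ _)).flip (0, w)) (chartOne n G) := by
  have h : HasFDerivAt (fun x => fderiv ℝ (chartMul n G) (x, chartOne n G))
      ((fderiv ℝ (fderiv ℝ (chartMul n G)) (chartOne n G, chartOne n G)).comp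
        (ContinuousLinearMap.inl ℝ _ _)) (chartOne n G) :=
    HasFDerivAt.comp (chartOne n G) (f := fun y => (y, chartOne n G)) hasFDerivAt_fderiv_chartMul
      (hasFDerivAt_prodMk_left _ _)
  simpa using h.clm_apply (hasFDerivAt_const ((0 : EuclideanSpace ℝ (Fin n)), w) (chartOne n G))

/-- The bracket in the chart at `1`. -/
theorem lie_eq_fderiv_fderiv (v w : EuclideanSpace ℝ (Fin n)) :
    (@Bracket.bracket (GroupLieAlgebra (𝓡 n) G) (GroupLieAlgebra (𝓡 n) G) _ v w :
        EuclideanSpace ℝ (Fin n))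
      = fderiv ℝ (fderiv ℝ (chartMul n G)) (chartOne n G, chartOne n G) (v, 0) (0, w)
        - fderiv ℝ (fderiv ℝ (chartMul n G)) (chartOne n G, chartOne n G) (w, 0) (0, v) := by
  have : IsManifold (𝓡 n) 1 G := IsManifold.of_le (n := ∞) (by simp)
  let A : EuclideanSpace ℝ (Fin n) →L[ℝ] EuclideanSpace ℝ (Fin n) :=
    mfderiv (𝓡 n) 𝓘(ℝ, EuclideanSpace ℝ (Fin n)) (extChartAt (𝓡 n) (1 : G)) 1
  have hA : A = ContinuousLinearMap.id ℝ _ := mfderiv_extChartAt_self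
  let V (u : EuclideanSpace ℝ (Fin n)) : EuclideanSpace ℝ (Fin n) → EuclideanSpace ℝ (Fin n) :=
    VectorField.mpullbackWithin 𝓘(ℝ, EuclideanSpace ℝ (Fin n)) (𝓡 n)
      (extChartAt (𝓡 n) (1 : G)).symm (mulInvariantVectorField (I := 𝓡 n) (G := G) u) (range (𝓡 n))
  have hV : ∀ u : EuclideanSpace ℝ (Fin n), V u =ᶠ[nhds (chartOne n G)]
      fun x => fderiv ℝ (chartMul n G) (x, chartOne n G) (0, u) := by
    intro u
    filter_upwards [eventually_chartMul_differentiable (n := n) (G := G)] with x hx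
    exact mpullbackWithin_mulInvariantVectorField hx.1 hx.2.1 u
  -- The bracket of left-invariant fields is by definition the bracket of their chart
  -- representatives, pulled back by the derivative of the chart, which is the identity at `1`.
  have h1 : (@Bracket.bracket (GroupLieAlgebra (𝓡 n) G) (GroupLieAlgebra (𝓡 n) G) _ v w :
      EuclideanSpace ℝ (Fin n)) = A.inverse (VectorField.lieBracketWithin ℝ (V v) (V w)
        ((extChartAt (𝓡 n) (1 : G)).symm ⁻¹' univ ∩ range (𝓡 n)) (chartOne n G)) := rfl
  have hu : (extChartAt (𝓡 n) (1 : G)).symm ⁻¹' univ ∩ range (𝓡 n) = univ := by simp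
  refine h1.trans ?_
  rw [hu, hA, ContinuousLinearMap.inverse_id, VectorField.lieBracketWithin_univ,
    (hV v).lieBracket_vectorField_eq (hV w), VectorField.lieBracket_eq]
  simp only [(hasFDerivAt_chartMul_right _).fderiv, fderiv_chartMul_one]
  simp
  rfl

/-- The derivative of `a ↦ Ad a w` at the identity is the bracket. -/
theorem hasMFDerivAt_adL (w : EuclideanSpace ℝ (Fin n)) :
    ∃ A' : EuclideanSpace ℝ (Fin n) →L[ℝ] EuclideanSpace ℝ (Fin n),
      HasMFDerivAt (𝓡 n) 𝓘(ℝ, EuclideanSpace ℝ (Fin n)) (fun a : G => adL n a w) 1 A' ∧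
      ∀ v, A' v = @Bracket.bracket (GroupLieAlgebra (𝓡 n) G) (GroupLieAlgebra (𝓡 n) G) _ v w := by
  have hsm : MDifferentiableAt (𝓡 n) 𝓘(ℝ, EuclideanSpace ℝ (Fin n)) (fun a : G => adL n a w) 1 :=
    ((contMDiff_adL n (1 : G)).clm_apply contMDiffAt_const).mdifferentiableAt (by simp)
  refine ⟨_, hsm.hasMFDerivAt, fun v => ?_⟩
  let A' : EuclideanSpace ℝ (Fin n) →L[ℝ] EuclideanSpace ℝ (Fin n) :=
    mfderiv (𝓡 n) 𝓘(ℝ, EuclideanSpace ℝ (Fin n)) (fun a : G => adL n a w) 1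
  change A' v = _
  have hone : (extChartAt (𝓡 n) (1 : G)).symm (chartOne n G) = 1 := extChartAt_to_inv (1 : G)
  have h1 : HasMFDerivAt (𝓡 n) 𝓘(ℝ, EuclideanSpace ℝ (Fin n)) (fun a : G => adL n a w)
      ((extChartAt (𝓡 n) (1 : G)).symm (chartOne n G)) A' := by
    rw [hone]; exact hsm.hasMFDerivAt
  have h2 : HasFDerivAt (fun x => adL n ((extChartAt (𝓡 n) (1 : G)).symm x) w) A'
      (chartOne n G) :=
    (h1.comp (chartOne n G) mfderiv_extChartAt_symm_chartOne).hasFDerivAt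
  have h3 : HasFDerivAt (fun x => fderiv ℝ (chartMul n G) (chartOne n G, x))
      ((fderiv ℝ (fderiv ℝ (chartMul n G)) (chartOne n G, chartOne n G)).comp
        (ContinuousLinearMap.inr ℝ _ _)) (chartOne n G) :=
    HasFDerivAt.comp (chartOne n G) (f := fun y => (chartOne n G, y)) hasFDerivAt_fderiv_chartMul
      (hasFDerivAt_prodMk_right _ _)
  have h4 := h3.clm_apply (h2.prodMk (hasFDerivAt_const (0 : EuclideanSpace ℝ (Fin n)) (chartOne n G)))
  have h5 : (fun x => fderiv ℝ (chartMul n G) (x, chartOne n G) (0, w)) =ᶠ[nhds (chartOne n G)]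
      fun x => fderiv ℝ (chartMul n G) (chartOne n G, x)
          (adL n ((extChartAt (𝓡 n) (1 : G)).symm x) w, 0) := by
    filter_upwards [eventually_chartMul_differentiable (n := n) (G := G)] with x hx
    exact fderiv_chartMul_right_eq_left hx.1 hx.2.1 hx.2.2 w
  -- With $m$ the multiplication in the chart, comparing derivatives gives
  -- $D^2m(v,0)(0,w)=D^2m(0,v)(w,0)+A'v$. Symmetry of $D^2m$ then turns $A'v$ into the coordinate
  -- formula for the bracket.
  have h6 := DFunLike.congr_fun
    ((hasFDerivAt_chartMul_right w).unique (h4.congr_of_eventuallyEq h5)) v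
  have hsymm : fderiv ℝ (fderiv ℝ (chartMul n G)) (chartOne n G, chartOne n G) (0, v) (w, 0)
      = fderiv ℝ (fderiv ℝ (chartMul n G)) (chartOne n G, chartOne n G) (w, 0) (0, v) :=
    (contDiffAt_chartMul.isSymmSndFDerivAt (by simp [ENat.LEInfty.out])) _ _
  rw [lie_eq_fderiv_fderiv, ← hsymm]
  rw [hone, adL_one] at h6
  simp only [add_apply, ContinuousLinearMap.comp_apply,
    ContinuousLinearMap.flip_apply, ContinuousLinearMap.inl_apply, ContinuousLinearMap.inr_apply,
    ContinuousLinearMap.prod_apply, zero_apply, fderiv_chartMul_one,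
    ContinuousLinearMap.id_apply, add_zero] at h6
  rw [h6]
  abel

end AdjointRepresentation

/-! ### Invariance under Ad, its infinitesimal form, and averaging over the group -/

section AdjointRepresentation

variable {n : ℕ} {G : Type*} [TopologicalSpace G] [ChartedSpace (EuclideanSpace ℝ (Fin n)) G]
  [Group G] [LieGroup (𝓡 n) ∞ G]

theorem Ad_one (X : GroupLieAlgebra (𝓡 n) G) : Ad (1 : G) X = X := by
  rw [Ad_apply, adL_one]; rfl

theorem Ad_mul (a b : G) (X : GroupLieAlgebra (𝓡 n) G) : Ad (a * b) X = Ad a (Ad b X) := by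
  rw [Ad_apply, adL_mul]; rfl

theorem Ad_inv_Ad (a : G) (X : GroupLieAlgebra (𝓡 n) G) : Ad a⁻¹ (Ad a X) = X := by
  rw [← Ad_mul, inv_mul_cancel, Ad_one]

/-- `Ad a` is a morphism of Lie algebras: differentiate
`Ad (a b a⁻¹) = Ad a ∘ Ad b ∘ Ad a⁻¹` in `b`. -/
theorem Ad_lie (a : G) (X Y : GroupLieAlgebra (𝓡 n) G) : Ad a ⁅X, Y⁆ = ⁅Ad a X, Ad a Y⁆ := by
  obtain ⟨A₁, hA₁, h₁⟩ := hasMFDerivAt_adL (G := G) (adL n a Y)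
  obtain ⟨A₂, hA₂, h₂⟩ := hasMFDerivAt_adL (G := G) Y
  have hA₁' : HasMFDerivAt (𝓡 n) 𝓘(ℝ, EuclideanSpace ℝ (Fin n)) (fun b : G => adL n b (adL n a Y))
      (a * 1 * a⁻¹) A₁ := by
    rw [mul_one, mul_inv_cancel]; exact hA₁
  have c₁ := hA₁'.comp (1 : G) (hasMFDerivAt_conj a)
  have c₂ := (adL n a).hasMFDerivAt.comp (1 : G) hA₂
  have e : (fun b : G => adL n b (adL n a Y)) ∘ (fun b : G => a * b * a⁻¹)
      = adL n a ∘ (fun b : G => adL n b Y) := by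
    funext b
    simp only [Function.comp_apply, adL_mul, ContinuousLinearMap.comp_apply]
    congr 2
    exact DFunLike.congr_fun (adL_inv_comp a) Y
  rw [e] at c₁
  have h := DFunLike.congr_fun (hasMFDerivAt_unique c₁ c₂) X
  have h' : A₁ (adL n a X) = adL n a (A₂ X) := h
  exact ((h₁ _).symm.trans (h'.trans (congrArg (adL n a) (h₂ X)))).symm

variable (n) in
/-- The velocity at time `0` of a curve through the identity. -/
def velocity (γ : ℝ → G) : EuclideanSpace ℝ (Fin n) := mfderiv 𝓘(ℝ, ℝ) (𝓡 n) γ 0 (1 : ℝ)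

variable (n G) in
/-- The bracket of the Lie algebra of `G`, on the model space. -/
def modelBracket (v w : EuclideanSpace ℝ (Fin n)) : EuclideanSpace ℝ (Fin n) :=
  @Bracket.bracket (GroupLieAlgebra (𝓡 n) G) (GroupLieAlgebra (𝓡 n) G) _ v w

theorem hasDerivAt_comp_curve {γ : ℝ → G} (hγ : ContMDiff 𝓘(ℝ, ℝ) (𝓡 n) ∞ γ) (h0 : γ 0 = 1)
    {F : Type*} [NormedAddCommGroup F] [NormedSpace ℝ F] {f : G → F}
    {A : EuclideanSpace ℝ (Fin n) →L[ℝ] F} (hA : HasMFDerivAt (𝓡 n) 𝓘(ℝ, F) f 1 A) :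
    HasDerivAt (fun t => f (γ t)) (A (velocity n γ)) 0 := by
  rw [← h0] at hA
  let B : ℝ →L[ℝ] EuclideanSpace ℝ (Fin n) := mfderiv 𝓘(ℝ, ℝ) (𝓡 n) γ 0
  have c := hA.comp (0 : ℝ) ((hγ.mdifferentiableAt (by simp)).hasMFDerivAt)
  have c' : HasFDerivAt (fun t => f (γ t)) (A.comp B) 0 := c.hasFDerivAt
  exact c'.hasDerivAt

theorem hasDerivAt_Ad_curve {γ : ℝ → G} (hγ : ContMDiff 𝓘(ℝ, ℝ) (𝓡 n) ∞ γ) (h0 : γ 0 = 1)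
    (Y : EuclideanSpace ℝ (Fin n)) :
    HasDerivAt (fun t => adL n (γ t) Y) (modelBracket n G (velocity n γ) Y) 0 := by
  obtain ⟨A, hA, h⟩ := hasMFDerivAt_adL (G := G) Y
  have := hasDerivAt_comp_curve hγ h0 hA
  rwa [h] at this

/-- The derivative at the identity of `a ↦ g (Ad a X, Ad a Y)`. -/
theorem hasMFDerivAt_form (g : LinearMap.BilinForm ℝ (EuclideanSpace ℝ (Fin n)))
    (X Y : EuclideanSpace ℝ (Fin n)) :
    ∃ A : EuclideanSpace ℝ (Fin n) →L[ℝ] ℝ,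
      HasMFDerivAt (𝓡 n) 𝓘(ℝ, ℝ) (fun a : G => g (adL n a X) (adL n a Y)) 1 A ∧
      ∀ v, A v = g (modelBracket n G v X) Y + g X (modelBracket n G v Y) := by
  obtain ⟨A, hA, h⟩ := hasMFDerivAt_adL (G := G) X
  obtain ⟨B, hB, h'⟩ := hasMFDerivAt_adL (G := G) Y
  let gL : EuclideanSpace ℝ (Fin n) →L[ℝ] EuclideanSpace ℝ (Fin n) →L[ℝ] ℝ :=
    LinearMap.toContinuousBilinearMap g
  have h1 := (gL.isBoundedBilinearMap.hasFDerivAt (adL n (1 : G) X, adL n (1 : G) Y)).hasMFDerivAt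
  have hAB : HasMFDerivAt (𝓡 n) 𝓘(ℝ, EuclideanSpace ℝ (Fin n) × EuclideanSpace ℝ (Fin n))
      (fun a : G => (adL n a X, adL n a Y)) 1 (A.prod B) :=
    ⟨hA.1.prodMk hB.1, hA.2.prodMk hB.2⟩
  have h2 := HasMFDerivAt.comp (1 : G) h1 hAB
  refine ⟨_, h2, fun v => ?_⟩
  change gL (adL n (1 : G) X) (B v) + gL (A v) (adL n (1 : G) Y) = _
  rw [h, h', adL_one, add_comm]
  rfl

/-- Difference quotients stay in the subspace, which is closed because the dimension is finite. -/
theorem mem_of_hasDerivAt {E : Type*} [NormedAddCommGroup E] [NormedSpace ℝ E]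
    [FiniteDimensional ℝ E] (W : Submodule ℝ E) {f : ℝ → E} {f' : E} {t : ℝ}
    (hf : ∀ s, f s ∈ W) (h : HasDerivAt f f' t) : f' ∈ W := by
  have h1 := hasDerivAt_iff_tendsto_slope_zero.1 h
  have hc : IsClosed (W : Set E) := W.closed_of_finiteDimensional
  exact hc.mem_of_tendsto h1 (Filter.Eventually.of_forall fun s =>
    W.smul_mem _ (W.sub_mem (hf _) (hf _)))

/-- `Ad(K)`-invariant subspaces are invariant under the Lie algebra of `K`. -/
theorem lie_mem_of_Ad_invariant {K : Subgroup G} (W : Submodule ℝ (GroupLieAlgebra (𝓡 n) G))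
    (hW : ∀ a ∈ K, ∀ X ∈ W, Ad a X ∈ W) {Z : GroupLieAlgebra (𝓡 n) G}
    (hZ : Z ∈ isotropyAlgebra n K) {X : GroupLieAlgebra (𝓡 n) G} (hX : X ∈ W) : ⁅Z, X⁆ ∈ W := by
  -- The isotropy algebra is a Lie span, so it is enough that the stabiliser of `W` is a Lie
  -- subalgebra containing the velocities of curves in `K`.
  let S : LieSubalgebra ℝ (GroupLieAlgebra (𝓡 n) G) :=
    { carrier := {Z | ∀ X ∈ W, ⁅Z, X⁆ ∈ W}
      add_mem' := fun {a b} ha hb X hX => by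
        rw [add_lie]; exact W.add_mem (ha X hX) (hb X hX)
      zero_mem' := fun X _ => by rw [zero_lie]; exact W.zero_mem
      smul_mem' := fun c a ha X hX => by rw [smul_lie]; exact W.smul_mem c (ha X hX)
      lie_mem' := fun {a b} ha hb X hX => by
        rw [lie_lie]; exact W.sub_mem (ha _ (hb X hX)) (hb _ (ha X hX)) }
  have hS : isotropyAlgebra n K ≤ S := by
    refine LieSubalgebra.lieSpan_le.2 ?_
    rintro V ⟨γ, hγ, h0, hK, rfl⟩ X hX
    exact mem_of_hasDerivAt (E := EuclideanSpace ℝ (Fin n)) W (fun t => hW _ (hK t) X hX)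
      (hasDerivAt_Ad_curve hγ h0 X)
  exact hS hZ X hX

/-- A bilinear form on an `Ad(K)`-invariant subspace `W` which is `Ad(K)`-invariant is invariant
under the Lie algebra of `K`. -/
theorem form_lie_of_Ad_invariant {K : Subgroup G}
    (W : Submodule ℝ (GroupLieAlgebra (𝓡 n) G))
    (g : LinearMap.BilinForm ℝ (GroupLieAlgebra (𝓡 n) G))
    (hW : ∀ a ∈ K, ∀ X ∈ W, Ad a X ∈ W)
    (hg : ∀ a ∈ K, ∀ X ∈ W, ∀ Y ∈ W, g (Ad a X) (Ad a Y) = g X Y)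
    {Z : GroupLieAlgebra (𝓡 n) G} (hZ : Z ∈ isotropyAlgebra n K)
    {X Y : GroupLieAlgebra (𝓡 n) G} (hX : X ∈ W) (hY : Y ∈ W) :
    g ⁅Z, X⁆ Y + g X ⁅Z, Y⁆ = 0 := by
  -- Stability of `W` is part of the condition: skewness is only known on `W`, and closure under
  -- brackets applies it to `⁅a, X⁆` and `⁅b, X⁆`.
  let S : LieSubalgebra ℝ (GroupLieAlgebra (𝓡 n) G) :=
    { carrier := {Z | (∀ X ∈ W, ⁅Z, X⁆ ∈ W) ∧
        ∀ X ∈ W, ∀ Y ∈ W, g ⁅Z, X⁆ Y + g X ⁅Z, Y⁆ = 0}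
      add_mem' := fun {a b} ha hb => by
        refine ⟨fun X hX => ?_, fun X hX Y hY => ?_⟩
        · rw [add_lie]; exact W.add_mem (ha.1 X hX) (hb.1 X hX)
        · have h1 := ha.2 X hX Y hY
          have h2 := hb.2 X hX Y hY
          simp only [add_lie, map_add, LinearMap.add_apply]
          linarith
      zero_mem' := by simp
      smul_mem' := fun c a ha => by
        refine ⟨fun X hX => ?_, fun X hX Y hY => ?_⟩
        · rw [smul_lie]; exact W.smul_mem c (ha.1 X hX)
        · have h1 := ha.2 X hX Y hY
          simp only [smul_lie, map_smul, LinearMap.smul_apply, smul_eq_mul]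
          rw [← mul_add, h1, mul_zero]
      lie_mem' := fun {a b} ha hb => by
        refine ⟨fun X hX => ?_, fun X hX Y hY => ?_⟩
        · rw [lie_lie]; exact W.sub_mem (ha.1 _ (hb.1 X hX)) (hb.1 _ (ha.1 X hX))
        · have h1 := ha.2 _ (hb.1 X hX) Y hY
          have h2 := hb.2 _ (ha.1 X hX) Y hY
          have h3 := ha.2 X hX _ (hb.1 Y hY)
          have h4 := hb.2 X hX _ (ha.1 Y hY)
          simp only [lie_lie, map_sub, LinearMap.sub_apply]
          linarith }
  have hS : isotropyAlgebra n K ≤ S := by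
    refine LieSubalgebra.lieSpan_le.2 ?_
    rintro V ⟨γ, hγ, h0, hK, rfl⟩
    refine ⟨fun X hX => ?_, fun X hX Y hY => ?_⟩
    · exact mem_of_hasDerivAt (E := EuclideanSpace ℝ (Fin n)) W (fun t => hW _ (hK t) X hX)
        (hasDerivAt_Ad_curve hγ h0 X)
    · obtain ⟨A, hA, h⟩ := hasMFDerivAt_form (G := G) g X Y
      have h1 := hasDerivAt_comp_curve hγ h0 hA
      have h2 : (fun t => g (adL n (γ t) X) (adL n (γ t) Y)) = fun _ => g X Y :=
        funext fun t => hg _ (hK t) X hX Y hY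
      have h3 := h1.unique (h2 ▸ hasDerivAt_const (0 : ℝ) (g X Y))
      rw [h] at h3
      exact h3
  exact (hS hZ).2 X hX Y hY

/-- An `Ad(G)`-invariant bilinear form is `ad`-invariant. -/
theorem form_lie_of_Ad_invariant_univ (g : LinearMap.BilinForm ℝ (GroupLieAlgebra (𝓡 n) G))
    (hg : ∀ (a : G) X Y, g (Ad a X) (Ad a Y) = g X Y) (Z X Y : GroupLieAlgebra (𝓡 n) G) :
    g ⁅Z, X⁆ Y + g X ⁅Z, Y⁆ = 0 := by
  obtain ⟨A, hA, h⟩ := hasMFDerivAt_form (G := G) g X Y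
  have h2 := hA.congr_of_eventuallyEq (f₁ := fun _ => g X Y)
    (Filter.Eventually.of_forall fun a => (hg a X Y).symm)
  have h3 := DFunLike.congr_fun
    (hasMFDerivAt_unique h2 (hasMFDerivAt_const (g X Y : ℝ) (1 : G))) Z
  exact (h Z).symm.trans h3

theorem Ad_mem_tangentVectors {K : Subgroup G} {a : G} (ha : a ∈ K)
    {X : GroupLieAlgebra (𝓡 n) G} (hX : X ∈ tangentVectors n K) : Ad a X ∈ tangentVectors n K := by
  obtain ⟨γ, hγ, h0, hK, rfl⟩ := hX
  refine ⟨fun t => a * γ t * a⁻¹, (contMDiff_conj_right n a).comp hγ, by simp [h0],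
    fun t => K.mul_mem (K.mul_mem ha (hK t)) (K.inv_mem ha), ?_⟩
  have h1 := hasMFDerivAt_conj (n := n) a
  rw [← h0] at h1
  have h2 := (h1.comp (0 : ℝ) ((hγ.mdifferentiableAt (by simp)).hasMFDerivAt)).mfderiv
  exact DFunLike.congr_fun h2 (1 : ℝ)

/-- The Lie algebra of `K` is `Ad(K)`-invariant. -/
theorem Ad_mem_isotropyAlgebra {K : Subgroup G} {a : G} (ha : a ∈ K)
    {X : GroupLieAlgebra (𝓡 n) G} (hX : X ∈ isotropyAlgebra n K) : Ad a X ∈ isotropyAlgebra n K := by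
  let f : GroupLieAlgebra (𝓡 n) G →ₗ⁅ℝ⁆ GroupLieAlgebra (𝓡 n) G :=
    { Ad a with map_lie' := fun {X Y} => Ad_lie a X Y }
  have h : isotropyAlgebra n K ≤ (isotropyAlgebra n K).comap f :=
    LieSubalgebra.lieSpan_le.2 fun X hX =>
      LieSubalgebra.subset_lieSpan (Ad_mem_tangentVectors ha hX)
  exact h hX

/-- On the Lie algebra of a compact Lie group there is an `Ad(G)`-invariant scalar product. -/
theorem exists_Ad_invariant_scalarProduct [CompactSpace G] [T2Space G] :
    ∃ B : LinearMap.BilinForm ℝ (GroupLieAlgebra (𝓡 n) G), IsScalarProduct B ∧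
      ∀ (a : G) X Y, B (Ad a X) (Ad a Y) = B X Y := by
  have := topologicalGroup_of_lieGroup (𝓡 n) ∞ (G := G)
  let _ : MeasurableSpace G := borel G
  have : BorelSpace G := ⟨rfl⟩
  -- The inverse of the left Haar measure is right invariant, as needed for the substitution
  -- $b\mapsto ba$ in $\mathrm{Ad}(b)\mathrm{Ad}(a)=\mathrm{Ad}(ba)$.
  let μ : MeasureTheory.Measure G := (MeasureTheory.Measure.haar : MeasureTheory.Measure G).inv
  have hc : ∀ X : EuclideanSpace ℝ (Fin n), Continuous fun a : G => adL n a X := fun X =>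
    ((contMDiff_adL (G := G) n).continuous).clm_apply continuous_const
  have hci : ∀ X Y : EuclideanSpace ℝ (Fin n),
      Continuous fun a : G => inner ℝ (adL n a X) (adL n a Y) := fun X Y => (hc X).inner (hc Y)
  have hint : ∀ X Y : EuclideanSpace ℝ (Fin n),
      MeasureTheory.Integrable (fun a : G => inner ℝ (adL n a X) (adL n a Y)) μ := fun X Y =>
    (hci X Y).integrable_of_hasCompactSupport (HasCompactSupport.of_compactSpace _)
  let B : LinearMap.BilinForm ℝ (EuclideanSpace ℝ (Fin n)) :=
    LinearMap.mk₂ ℝ (fun X Y => ∫ a : G, inner ℝ (adL n a X) (adL n a Y) ∂μ)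
      (fun X X' Y => by
        simp only [map_add, inner_add_left]
        exact MeasureTheory.integral_add (hint _ _) (hint _ _))
      (fun c X Y => by
        simp only [map_smul, real_inner_smul_left, smul_eq_mul]
        exact MeasureTheory.integral_const_mul _ _)
      (fun X Y Y' => by
        simp only [map_add, inner_add_right]
        exact MeasureTheory.integral_add (hint _ _) (hint _ _))
      (fun c X Y => by
        simp only [map_smul, real_inner_smul_right, smul_eq_mul]
        exact MeasureTheory.integral_const_mul _ _)
  refine ⟨B, ⟨fun X Y => ?_, fun X hX => ?_⟩, fun a X Y => ?_⟩
  · exact MeasureTheory.integral_congr_ae (Filter.Eventually.of_forall fun a => real_inner_comm _ _)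
  · refine (hci X X).integral_pos_of_hasCompactSupport_nonneg_nonzero
      (HasCompactSupport.of_compactSpace _) (fun a => real_inner_self_nonneg) (x := 1) ?_
    rw [adL_one]
    exact inner_self_ne_zero.2 hX
  · have h := MeasureTheory.integral_mul_right_eq_self (μ := μ)
      (fun b : G => (inner ℝ (adL n b X) (adL n b Y) : ℝ)) a
    simp only [adL_mul] at h
    exact h

end AdjointRepresentation

/-! ### Curvature of a reductive space through horizontal lifts -/

section ReductiveCurvature

variable {L : Type*} [LieRing L] [LieAlgebra ℝ L]
variable {k : LieSubalgebra ℝ L} {p : Submodule ℝ L}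

theorem prP_of_mem_p (hkp : IsCompl k.toSubmodule p) (X : p) : prP hkp (X : L) = X :=
  Submodule.projectionOnto_apply_left _ X

theorem prP_of_mem_k (hkp : IsCompl k.toSubmodule p) {Z : L} (hZ : Z ∈ k) : prP hkp Z = 0 :=
  Submodule.projectionOnto_apply_right hkp.symm (⟨Z, hZ⟩ : k.toSubmodule)

theorem prK_of_mem_k (hkp : IsCompl k.toSubmodule p) {Z : L} (hZ : Z ∈ k) :
    (prK hkp Z : L) = Z :=
  congrArg Subtype.val (Submodule.projectionOnto_apply_left hkp (⟨Z, hZ⟩ : k.toSubmodule))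

theorem prK_of_mem_p (hkp : IsCompl k.toSubmodule p) (X : p) : prK hkp (X : L) = 0 :=
  Submodule.projectionOnto_apply_right _ X

theorem prP_add_prK (hkp : IsCompl k.toSubmodule p) (U : L) :
    (prP hkp U : L) + (prK hkp U : L) = U := by
  have := Submodule.projection_add_projection_eq_self hkp.symm U
  exact this

/-- The action `X ↦ [Z, X]_p` on `p`. -/
def adP (hkp : IsCompl k.toSubmodule p) : L →ₗ[ℝ] Module.End ℝ p :=
  LinearMap.mk₂ ℝ (fun Z (X : p) => prP hkp ⁅Z, (X : L)⁆)
    (by intros; simp) (by intros; simp) (by intros; simp) (by intros; simp)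

theorem adP_apply (hkp : IsCompl k.toSubmodule p) (Z : L) (X : p) :
    adP hkp Z X = prP hkp ⁅Z, (X : L)⁆ := rfl

/-- `p` is invariant under `ad k`. -/
def IsReductive (k : LieSubalgebra ℝ L) (p : Submodule ℝ L) : Prop :=
  ∀ Z ∈ k, ∀ X ∈ p, ⁅Z, X⁆ ∈ p

theorem coe_adP (hkp : IsCompl k.toSubmodule p) (hr : IsReductive k p) {Z : L} (hZ : Z ∈ k)
    (X : p) : (adP hkp Z X : L) = ⁅Z, (X : L)⁆ := by
  have := prP_of_mem_p hkp ⟨_, hr Z hZ X X.2⟩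
  rw [adP_apply]
  exact congrArg Subtype.val this

theorem prP_lie (hkp : IsCompl k.toSubmodule p) {Z : L} (hZ : Z ∈ k)
    (U : L) : prP hkp ⁅Z, U⁆ = adP hkp Z (prP hkp U) := by
  conv_lhs => rw [← prP_add_prK hkp U, lie_add, map_add,
    prP_of_mem_k hkp (k.lie_mem hZ (prK hkp U).2), add_zero]
  rfl

theorem prK_lie (hkp : IsCompl k.toSubmodule p) (hr : IsReductive k p) {Z : L} (hZ : Z ∈ k)
    (U : L) : (prK hkp ⁅Z, U⁆ : L) = ⁅Z, (prK hkp U : L)⁆ := by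
  conv_lhs => rw [← prP_add_prK hkp U, lie_add, map_add, ← coe_adP hkp hr hZ,
    prK_of_mem_p, zero_add, prK_of_mem_k hkp (k.lie_mem hZ (prK hkp U).2)]

theorem adP_lie (hkp : IsCompl k.toSubmodule p) (hr : IsReductive k p) {Z : L} (hZ : Z ∈ k)
    {U : L} (hU : U ∈ k) (X : p) :
    adP hkp ⁅Z, U⁆ X = adP hkp Z (adP hkp U X) - adP hkp U (adP hkp Z X) := by
  apply Subtype.ext
  rw [Submodule.coe_sub, coe_adP hkp hr (k.lie_mem hZ hU), coe_adP hkp hr hZ, coe_adP hkp hr hU,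
    coe_adP hkp hr hU, coe_adP hkp hr hZ, lie_lie]

theorem adP_bracketP (hkp : IsCompl k.toSubmodule p) (hr : IsReductive k p) {Z : L} (hZ : Z ∈ k)
    (X Y : p) : adP hkp Z (bracketP hkp X Y)
      = bracketP hkp (adP hkp Z X) Y + bracketP hkp X (adP hkp Z Y) := by
  simp only [bracketP, LinearMap.mk₂_apply]
  rw [← prP_lie hkp hZ, coe_adP hkp hr hZ, coe_adP hkp hr hZ, ← map_add, leibniz_lie]

/-- `g` is invariant under the isotropy algebra. -/
def IsAdInvariant (hkp : IsCompl k.toSubmodule p) (g : LinearMap.BilinForm ℝ p) : Prop :=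
  ∀ Z ∈ k, ∀ X Y : p, g (adP hkp Z X) Y + g X (adP hkp Z Y) = 0

theorem IsScalarProduct.eq_of_forall {V : Type*} [AddCommGroup V] [Module ℝ V]
    {g : LinearMap.BilinForm ℝ V} (hg : IsScalarProduct g) {X Y : V} (h : ∀ Z, g X Z = g Y Z) :
    X = Y := by
  by_contra hne
  have h1 := hg.pos (X - Y) (sub_ne_zero.mpr hne)
  rw [map_sub g, LinearMap.sub_apply, h, sub_self] at h1
  exact lt_irrefl _ h1

theorem isLeviCivita_leviCivita [FiniteDimensional ℝ L] (hkp : IsCompl k.toSubmodule p)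
    {g : LinearMap.BilinForm ℝ p} (hg : IsScalarProduct g) :
    IsLeviCivita hkp g (leviCivita hkp g) := by
  have h := (existsUnique_isLeviCivita hkp g hg).exists
  rw [leviCivita, dif_pos h]
  exact h.choose_spec

/-- A symmetric `D` all of whose `D X` are skew vanishes. -/
theorem eq_zero_of_symm_of_skew {V : Type*} [AddCommGroup V] [Module ℝ V]
    {g : LinearMap.BilinForm ℝ V} (hg : IsScalarProduct g) (D : V → V → V)
    (hs : ∀ X Y, D X Y = D Y X) (hm : ∀ X Y Z, g (D X Y) Z + g Y (D X Z) = 0) (X Y : V) :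
    D X Y = 0 := by
  apply hg.eq_of_forall
  intro Z
  rw [map_zero, LinearMap.zero_apply]
  have m1 := hm X Y Z
  have m2 := hm Y Z X
  have m3 := hm Z X Y
  rw [hg.symm Y, hs X Z] at m1
  rw [hg.symm Z, hs Y X] at m2
  rw [hg.symm X, hs Z Y] at m3
  rw [hs Z X, hs Y Z] at *
  linarith

/-- The defect of equivariance is symmetric in `X`, `Y`, because the connection is torsion free and
$\mathrm{ad}\,Z$ is a derivation of the bracket, and skew with respect to `g`, because the
connection and $\mathrm{ad}\,Z$ are skew. Such a tensor vanishes. -/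
theorem leviCivita_equivariant {hkp : IsCompl k.toSubmodule p} (hr : IsReductive k p)
    {g : LinearMap.BilinForm ℝ p} (hg : IsScalarProduct g) (hgk : IsAdInvariant hkp g)
    {Λ : p →ₗ[ℝ] p →ₗ[ℝ] p} (hΛ : IsLeviCivita hkp g Λ) {Z : L} (hZ : Z ∈ k) (X Y : p) :
    adP hkp Z (Λ X Y) - Λ X (adP hkp Z Y) = Λ (adP hkp Z X) Y := by
  rw [← sub_eq_zero]
  refine eq_zero_of_symm_of_skew hg
    (fun X Y => adP hkp Z (Λ X Y) - Λ X (adP hkp Z Y) - Λ (adP hkp Z X) Y) ?_ ?_ X Y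
  · intro X Y
    have t := hΛ.torsion_free
    have e := adP_bracketP hkp hr hZ X Y
    rw [← t, ← t, ← t, map_sub] at e
    rw [← sub_eq_zero] at e ⊢
    rw [← e]
    abel
  · intro X Y W
    have m := hΛ.metric
    have h1 := hgk Z hZ (Λ X Y) W
    have h2 := hgk Z hZ Y (Λ X W)
    have m1 := m X (adP hkp Z Y) W
    have m2 := m X Y (adP hkp Z W)
    have m3 := m (adP hkp Z X) Y W
    simp only [map_sub, LinearMap.sub_apply]
    linarith

/-- The extension to `L` of the Levi-Civita connection by the isotropy representation. -/
def extConnection (hkp : IsCompl k.toSubmodule p) (Λ : p →ₗ[ℝ] p →ₗ[ℝ] p) :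
    L →ₗ[ℝ] Module.End ℝ p :=
  Λ ∘ₗ prP hkp + adP hkp ∘ₗ k.toSubmodule.subtype ∘ₗ prK hkp

theorem extConnection_of_mem_k (hkp : IsCompl k.toSubmodule p) (Λ : p →ₗ[ℝ] p →ₗ[ℝ] p) {Z : L}
    (hZ : Z ∈ k) : extConnection hkp Λ Z = adP hkp Z := by
  simp [extConnection, prP_of_mem_k hkp hZ, prK_of_mem_k hkp hZ]

theorem extConnection_of_mem_p (hkp : IsCompl k.toSubmodule p) (Λ : p →ₗ[ℝ] p →ₗ[ℝ] p) (X : p) :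
    extConnection hkp Λ (X : L) = Λ X := by
  simp [extConnection, prP_of_mem_p hkp, prK_of_mem_p hkp]

/-- The curvature of `extConnection`. -/
def extCurvature (hkp : IsCompl k.toSubmodule p) (Λ : p →ₗ[ℝ] p →ₗ[ℝ] p) (U V : L) :
    Module.End ℝ p :=
  extConnection hkp Λ U ∘ₗ extConnection hkp Λ V - extConnection hkp Λ V ∘ₗ extConnection hkp Λ U
    - extConnection hkp Λ ⁅U, V⁆

/-- Against the `p`-part of `V` this is the equivariance of the Levi-Civita connection; against the
`k`-part it says that `adP` represents `k`. -/
theorem extCurvature_of_mem_k {hkp : IsCompl k.toSubmodule p} (hr : IsReductive k p)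
    {g : LinearMap.BilinForm ℝ p} (hg : IsScalarProduct g) (hgk : IsAdInvariant hkp g)
    {Λ : p →ₗ[ℝ] p →ₗ[ℝ] p} (hΛ : IsLeviCivita hkp g Λ) {Z : L} (hZ : Z ∈ k) (V : L) :
    extCurvature hkp Λ Z V = 0 := by
  apply LinearMap.ext
  intro Y
  rw [extCurvature, extConnection_of_mem_k hkp Λ hZ]
  simp only [extConnection, LinearMap.sub_apply, LinearMap.comp_apply, LinearMap.add_apply,
    Submodule.subtype_apply, LinearMap.zero_apply, map_add]
  rw [prP_lie hkp hZ, prK_lie hkp hr hZ, adP_lie hkp hr hZ (prK hkp V).2,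
    ← leviCivita_equivariant hr hg hgk hΛ hZ]
  abel

theorem extCurvature_swap (hkp : IsCompl k.toSubmodule p) (Λ : p →ₗ[ℝ] p →ₗ[ℝ] p) (U V : L) :
    extCurvature hkp Λ U V = - extCurvature hkp Λ V U := by
  rw [extCurvature, extCurvature, ← lie_skew V U, map_neg]
  abel

theorem extCurvature_add_left (hkp : IsCompl k.toSubmodule p) (Λ : p →ₗ[ℝ] p →ₗ[ℝ] p)
    (U U' V : L) :
    extCurvature hkp Λ (U + U') V = extCurvature hkp Λ U V + extCurvature hkp Λ U' V := by
  simp only [extCurvature, map_add, add_lie, LinearMap.add_comp, LinearMap.comp_add]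
  abel

/-- The curvature descends to `L / k`, so representatives in `p` may be traded for representatives
orthogonal to `k`. -/
theorem extCurvature_congr {hkp : IsCompl k.toSubmodule p} (hr : IsReductive k p)
    {g : LinearMap.BilinForm ℝ p} (hg : IsScalarProduct g) (hgk : IsAdInvariant hkp g)
    {Λ : p →ₗ[ℝ] p →ₗ[ℝ] p} (hΛ : IsLeviCivita hkp g Λ) {U U' V V' : L} (hU : U' - U ∈ k)
    (hV : V' - V ∈ k) : extCurvature hkp Λ U' V' = extCurvature hkp Λ U V := by
  have h : ∀ {U U' : L} (V : L), U' - U ∈ k → extCurvature hkp Λ U' V = extCurvature hkp Λ U V := by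
    intro U U' V hU
    rw [← add_sub_cancel U U', extCurvature_add_left, extCurvature_of_mem_k hr hg hgk hΛ hU,
      add_zero]
  rw [h _ hU, extCurvature_swap, h _ hV, ← extCurvature_swap]

theorem curvature_eq_extCurvature (hkp : IsCompl k.toSubmodule p) (g : LinearMap.BilinForm ℝ p)
    (X Y : p) : curvature hkp g X Y = extCurvature hkp (leviCivita hkp g) (X : L) (Y : L) := by
  rw [curvature, extCurvature, extConnection_of_mem_p, extConnection_of_mem_p, sub_sub]
  congr 1

/-- `φ` lifts `p ≅ L / k` to the `B`-orthogonal complement of `k`. -/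
structure IsHorizontalLift (k : LieSubalgebra ℝ L) (B : LinearMap.BilinForm ℝ L)
    (φ : p →ₗ[ℝ] L) : Prop where
  sub_mem : ∀ X : p, φ X - X ∈ k
  orthogonal : ∀ X : p, ∀ Z ∈ k, B (φ X) Z = 0

theorem exists_isHorizontalLift [FiniteDimensional ℝ L] (k : LieSubalgebra ℝ L)
    (p : Submodule ℝ L) {B : LinearMap.BilinForm ℝ L} (hB : IsScalarProduct B) :
    ∃ φ : p →ₗ[ℝ] L, IsHorizontalLift k B φ := by
  have hr : B.IsRefl := fun X Y h => by rw [hB.symm]; exact h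
  have hnd : (B.restrict k.toSubmodule).Nondegenerate := by
    have : IsScalarProduct (B.restrict k.toSubmodule) :=
      ⟨fun X Y => hB.symm _ _, fun X hX => hB.pos _ (by simpa using hX)⟩
    exact this.nondegenerate
  have hc := LinearMap.BilinForm.isCompl_orthogonal_of_restrict_nondegenerate hr hnd
  refine ⟨Submodule.projection _ _ hc.symm ∘ₗ p.subtype, fun X => ?_, fun X Z hZ => ?_⟩
  · rw [← neg_sub]
    exact k.neg_mem (Submodule.sub_projection_mem hc.symm (X : L))
  · have h : (Submodule.projection _ _ hc.symm ∘ₗ p.subtype) X ∈ B.orthogonal k.toSubmodule :=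
      Submodule.projection_apply_mem hc.symm (X : L)
    rw [hB.symm]
    exact h Z hZ

variable {B : LinearMap.BilinForm ℝ L} {φ : p →ₗ[ℝ] L}

/-- Uniqueness of the lift: two candidates differ by an element of `k` that is orthogonal to `k`.
All equivariance properties of `φ` come from this. -/
theorem IsHorizontalLift.eq (hφ : IsHorizontalLift k B φ) (hB : IsScalarProduct B) {U : L} {X : p}
    (h1 : U - X ∈ k) (h2 : ∀ Z ∈ k, B U Z = 0) : U = φ X := by
  have h3 : U - φ X ∈ k := by
    have := k.sub_mem h1 (hφ.sub_mem X)
    rwa [sub_sub_sub_cancel_right] at this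
  by_contra hne
  have h4 := hB.pos _ (sub_ne_zero.2 hne)
  rw [map_sub B, LinearMap.sub_apply, h2 _ h3, hφ.orthogonal _ _ h3, sub_self] at h4
  exact lt_irrefl _ h4

theorem IsHorizontalLift.prP (hφ : IsHorizontalLift k B φ) (hkp : IsCompl k.toSubmodule p) (X : p) :
    prP hkp (φ X) = X := by
  rw [← sub_add_cancel (φ X) (X : L), map_add, prP_of_mem_k hkp (hφ.sub_mem X), prP_of_mem_p,
    zero_add]

/-- `B` is invariant under the adjoint representation. -/
def IsLieInvariant (B : LinearMap.BilinForm ℝ L) : Prop :=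
  ∀ U V W : L, B ⁅U, V⁆ W + B V ⁅U, W⁆ = 0

theorem IsHorizontalLift.lie (hφ : IsHorizontalLift k B φ) (hB : IsScalarProduct B)
    (hBi : IsLieInvariant B) (hkp : IsCompl k.toSubmodule p) (hr : IsReductive k p) {Z : L}
    (hZ : Z ∈ k) (X : p) : ⁅Z, φ X⁆ = φ (adP hkp Z X) := by
  refine hφ.eq hB ?_ fun W hW => ?_
  · rw [coe_adP hkp hr hZ, ← lie_sub]
    exact k.lie_mem hZ (hφ.sub_mem X)
  · have := hBi Z (φ X) W
    rw [hφ.orthogonal _ _ (k.lie_mem hZ hW), add_zero] at this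
    exact this

/-- The `p`-part of the bracket of horizontal lifts. -/
def liftBracketP (hkp : IsCompl k.toSubmodule p) (φ : p →ₗ[ℝ] L) : p →ₗ[ℝ] p →ₗ[ℝ] p :=
  LinearMap.mk₂ ℝ (fun X Y => prP hkp ⁅φ X, φ Y⁆)
    (by intros; simp) (by intros; simp) (by intros; simp) (by intros; simp)

/-- The `k`-part of the bracket of horizontal lifts. -/
def liftBracketK (hkp : IsCompl k.toSubmodule p) (φ : p →ₗ[ℝ] L) (X Y : p) : L :=
  ⁅φ X, φ Y⁆ - φ (liftBracketP hkp φ X Y)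

theorem liftBracketK_mem (hφ : IsHorizontalLift k B φ) (hkp : IsCompl k.toSubmodule p) (X Y : p) :
    liftBracketK hkp φ X Y ∈ k := by
  have h1 : liftBracketK hkp φ X Y = prK hkp ⁅φ X, φ Y⁆
      - (φ (liftBracketP hkp φ X Y) - liftBracketP hkp φ X Y) := by
    rw [liftBracketK]
    conv_lhs => rw [← prP_add_prK hkp ⁅φ X, φ Y⁆]
    simp only [liftBracketP, LinearMap.mk₂_apply]
    abel
  rw [h1]
  exact k.sub_mem (prK hkp _).2 (hφ.sub_mem _)

theorem liftBracketK_swap (hkp : IsCompl k.toSubmodule p) (φ : p →ₗ[ℝ] L) (X Y : p) :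
    liftBracketK hkp φ X Y = - liftBracketK hkp φ Y X := by
  simp only [liftBracketK, liftBracketP, LinearMap.mk₂_apply]
  rw [← lie_skew (φ X) (φ Y), map_neg, map_neg]
  abel

/-- The connection `Λ` referred to the horizontal lifts. -/
def liftConnection (hkp : IsCompl k.toSubmodule p) (φ : p →ₗ[ℝ] L) (Λ : p →ₗ[ℝ] p →ₗ[ℝ] p) :
    p →ₗ[ℝ] p →ₗ[ℝ] p :=
  extConnection hkp Λ ∘ₗ φ

theorem liftConnection_apply (hφ : IsHorizontalLift k B φ) (hkp : IsCompl k.toSubmodule p)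
    (Λ : p →ₗ[ℝ] p →ₗ[ℝ] p) (X : p) :
    liftConnection hkp φ Λ X = Λ X + adP hkp (φ X - X) := by
  rw [liftConnection, LinearMap.comp_apply, ← extConnection_of_mem_k hkp Λ (hφ.sub_mem X),
    ← extConnection_of_mem_p hkp Λ X, ← map_add, add_sub_cancel]

theorem liftConnection_torsion_free (hφ : IsHorizontalLift k B φ) {hkp : IsCompl k.toSubmodule p}
    {g : LinearMap.BilinForm ℝ p} {Λ : p →ₗ[ℝ] p →ₗ[ℝ] p} (hΛ : IsLeviCivita hkp g Λ) (X Y : p) :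
    liftConnection hkp φ Λ X Y - liftConnection hkp φ Λ Y X = liftBracketP hkp φ X Y := by
  have h1 : liftBracketP hkp φ X Y = bracketP hkp X Y + prP hkp ⁅φ X - X, (Y : L)⁆
      - prP hkp ⁅φ Y - Y, (X : L)⁆ := by
    -- The bracket of the two vertical corrections lies in `k`; expanding it supplies the relation
    -- among the four mixed brackets.
    have h2 : prP hkp ⁅φ X - X, φ Y - Y⁆ = 0 :=
      prP_of_mem_k hkp (k.lie_mem (hφ.sub_mem X) (hφ.sub_mem Y))
    simp only [liftBracketP, bracketP, LinearMap.mk₂_apply]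
    simp only [sub_lie, lie_sub, map_sub] at h2 ⊢
    rw [← lie_skew (φ Y) (X : L), ← lie_skew (Y : L) (X : L)]
    simp only [map_neg]
    rw [← sub_eq_zero, ← h2]
    abel
  rw [liftConnection_apply hφ, liftConnection_apply hφ, h1, ← hΛ.torsion_free]
  simp only [LinearMap.add_apply, adP_apply]
  abel

theorem liftConnection_metric (hφ : IsHorizontalLift k B φ) {hkp : IsCompl k.toSubmodule p}
    {g : LinearMap.BilinForm ℝ p} (hgk : IsAdInvariant hkp g)
    {Λ : p →ₗ[ℝ] p →ₗ[ℝ] p} (hΛ : IsLeviCivita hkp g Λ) (X Y Z : p) :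
    g (liftConnection hkp φ Λ X Y) Z + g Y (liftConnection hkp φ Λ X Z) = 0 := by
  have h1 := hΛ.metric X Y Z
  have h2 := hgk _ (hφ.sub_mem X) Y Z
  rw [liftConnection_apply hφ]
  simp only [LinearMap.add_apply, map_add]
  linarith

/-- The formula keeps the shape of the definition, but the lifted bracket that now enters has
totally skew structure constants, unlike the bracket of `p` itself. -/
theorem curvature_eq_liftConnection [FiniteDimensional ℝ L] (hφ : IsHorizontalLift k B φ)
    (hkp : IsCompl k.toSubmodule p) (hr : IsReductive k p)
    {g : LinearMap.BilinForm ℝ p} (hg : IsScalarProduct g) (hgk : IsAdInvariant hkp g)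
    (X Y Z : p) :
    curvature hkp g X Y Z
      = liftConnection hkp φ (leviCivita hkp g) X (liftConnection hkp φ (leviCivita hkp g) Y Z)
        - liftConnection hkp φ (leviCivita hkp g) Y (liftConnection hkp φ (leviCivita hkp g) X Z)
        - liftConnection hkp φ (leviCivita hkp g) (liftBracketP hkp φ X Y) Z
        - adP hkp (liftBracketK hkp φ X Y) Z := by
  have h1 : ⁅φ X, φ Y⁆ = φ (liftBracketP hkp φ X Y) + liftBracketK hkp φ X Y := by
    rw [liftBracketK, add_sub_cancel]
  rw [curvature_eq_extCurvature, ← extCurvature_congr hr hg hgk (isLeviCivita_leviCivita hkp hg)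
    (hφ.sub_mem X) (hφ.sub_mem Y), extCurvature, h1, map_add,
    extConnection_of_mem_k hkp _ (liftBracketK_mem hφ hkp X Y), ← sub_sub]
  rfl

/-! ### The Ricci tensor in an orthonormal basis -/

section Basis

variable {V ι : Type*} [AddCommGroup V] [Module ℝ V] [Fintype ι] [DecidableEq ι]

/-- `e` is orthonormal for `Q`. -/
def IsOrthonormalBasis (Q : LinearMap.BilinForm ℝ V) (e : Module.Basis ι ℝ V) : Prop :=
  ∀ i j, Q (e i) (e j) = if i = j then 1 else 0

theorem IsOrthonormalBasis.repr {Q : LinearMap.BilinForm ℝ V} {e : Module.Basis ι ℝ V}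
    (he : IsOrthonormalBasis Q e) (X : V) (i : ι) : e.repr X i = Q X (e i) := by
  conv_rhs => rw [← e.sum_repr X]
  simp only [map_sum, map_smul, LinearMap.sum_apply, LinearMap.smul_apply, smul_eq_mul]
  simp_rw [he _ _]
  simp

theorem IsOrthonormalBasis.sum_smul {Q : LinearMap.BilinForm ℝ V} {e : Module.Basis ι ℝ V}
    (he : IsOrthonormalBasis Q e) (X : V) : ∑ i, Q X (e i) • e i = X := by
  conv_rhs => rw [← e.sum_repr X]
  simp [he.repr]

theorem IsOrthonormalBasis.trace {Q : LinearMap.BilinForm ℝ V} {e : Module.Basis ι ℝ V}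
    (he : IsOrthonormalBasis Q e) (T : Module.End ℝ V) :
    LinearMap.trace ℝ V T = ∑ i, Q (T (e i)) (e i) := by
  rw [LinearMap.trace_eq_matrix_trace ℝ e, Matrix.trace]
  simp [LinearMap.toMatrix_apply, he.repr]

end Basis

/-- The scalar product on `p` induced by `B` through horizontal lifts. -/
def liftForm (B : LinearMap.BilinForm ℝ L) (φ : p →ₗ[ℝ] L) : LinearMap.BilinForm ℝ p :=
  B.compl₁₂ φ φ

theorem liftForm_apply (X Y : p) : liftForm B φ X Y = B (φ X) (φ Y) := rfl

theorem isScalarProduct_liftForm (hφ : IsHorizontalLift k B φ) (hB : IsScalarProduct B)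
    (hkp : IsCompl k.toSubmodule p) : IsScalarProduct (liftForm B φ) := by
  refine ⟨fun X Y => hB.symm _ _, fun X hX => hB.pos _ fun h => hX ?_⟩
  rw [← hφ.prP hkp X, h, map_zero]

theorem liftForm_liftBracketP (hφ : IsHorizontalLift k B φ) (hB : IsScalarProduct B)
    (hkp : IsCompl k.toSubmodule p) (X Y Z : p) :
    liftForm B φ (liftBracketP hkp φ X Y) Z = B ⁅φ X, φ Y⁆ (φ Z) := by
  have h : φ (liftBracketP hkp φ X Y) = ⁅φ X, φ Y⁆ - liftBracketK hkp φ X Y := by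
    rw [liftBracketK, sub_sub_cancel]
  rw [liftForm_apply, h, map_sub B, LinearMap.sub_apply, hB.symm (liftBracketK hkp φ X Y),
    hφ.orthogonal _ _ (liftBracketK_mem hφ hkp X Y), sub_zero]

/-- Invariance of `B` moves the isotropy element off `Z`, and only the `k`-part of `⁅φ Z, φ W⁆`
pairs with it. In the Ricci tensor this term becomes a sum of squares. -/
theorem liftForm_adP_liftBracketK (hφ : IsHorizontalLift k B φ) (hB : IsScalarProduct B)
    (hBi : IsLieInvariant B) (hkp : IsCompl k.toSubmodule p) (hr : IsReductive k p)
    (X Y Z W : p) : liftForm B φ (adP hkp (liftBracketK hkp φ X Y) Z) W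
      = B (liftBracketK hkp φ X Y) (liftBracketK hkp φ Z W) := by
  have hK := liftBracketK_mem hφ hkp X Y
  have h1 := hBi (φ Z) (liftBracketK hkp φ X Y) (φ W)
  have h2 : B (liftBracketK hkp φ X Y) ⁅φ Z, φ W⁆
      = B (liftBracketK hkp φ X Y) (liftBracketK hkp φ Z W) := by
    have h3 : liftBracketK hkp φ Z W = ⁅φ Z, φ W⁆ - φ (liftBracketP hkp φ Z W) := rfl
    rw [h3, map_sub, hB.symm _ (φ _), hφ.orthogonal _ _ hK, sub_zero]
  rw [liftForm_apply, ← hφ.lie hB hBi hkp hr hK, ← h2, ← lie_skew, map_neg, LinearMap.neg_apply]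
  linarith

section Ricci

variable {ι : Type*}

/-- The structure constants of the horizontal bracket. -/
def structureConst (hkp : IsCompl k.toSubmodule p) (B : LinearMap.BilinForm ℝ L) (φ : p →ₗ[ℝ] L)
    (e : Module.Basis ι ℝ p) (i j l : ι) : ℝ :=
  liftForm B φ (liftBracketP hkp φ (e i) (e j)) (e l)

theorem structureConst_swap (hkp : IsCompl k.toSubmodule p) (e : Module.Basis ι ℝ p) (i j l : ι) :
    structureConst hkp B φ e j i l = - structureConst hkp B φ e i j l := by
  simp only [structureConst, liftBracketP, LinearMap.mk₂_apply]
  rw [← lie_skew, map_neg, map_neg, LinearMap.neg_apply]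

/-- This is invariance of `B` under `ad`; together with the antisymmetry of the bracket it makes the
constants totally skew. -/
theorem structureConst_rotate (hφ : IsHorizontalLift k B φ) (hB : IsScalarProduct B)
    (hBi : IsLieInvariant B) (hkp : IsCompl k.toSubmodule p) (e : Module.Basis ι ℝ p)
    (i j l : ι) : structureConst hkp B φ e j l i = structureConst hkp B φ e i j l := by
  have h := hBi (φ (e j)) (φ (e i)) (φ (e l))
  simp only [structureConst, liftForm_liftBracketP hφ hB hkp]
  rw [← lie_skew, map_neg, LinearMap.neg_apply, hB.symm (φ (e i))] at h
  linarith

/-- The coefficients of the Levi-Civita connection of a diagonal metric. -/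
def lcCoeff (x : ι → ℝ) (i j l : ι) : ℝ := (x l - x i + x j) / (2 * x l)

/-- Koszul's formula: three cyclic torsion identities and three metric identities determine the
coefficient. Cyclic symmetry reduces all brackets in it to a single structure constant. -/
theorem liftConnection_basis [FiniteDimensional ℝ L] (hφ : IsHorizontalLift k B φ)
    (hB : IsScalarProduct B) (hBi : IsLieInvariant B) (hkp : IsCompl k.toSubmodule p)
    {g : LinearMap.BilinForm ℝ p} (hg : IsScalarProduct g)
    (hgk : IsAdInvariant hkp g) {e : Module.Basis ι ℝ p} {x : ι → ℝ} (hx : ∀ i, 0 < x i)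
    (hge : ∀ X i, g X (e i) = x i * liftForm B φ X (e i)) (i j l : ι) :
    liftForm B φ (liftConnection hkp φ (leviCivita hkp g) (e i) (e j)) (e l)
      = lcCoeff x i j l * structureConst hkp B φ e i j l := by
  set Λ := liftConnection hkp φ (leviCivita hkp g) with hΛdef
  have hΛ := isLeviCivita_leviCivita hkp hg
  have t : ∀ i j l, g (Λ (e i) (e j)) (e l) - g (Λ (e j) (e i)) (e l)
      = x l * structureConst hkp B φ e i j l := by
    intro i j l
    rw [← LinearMap.sub_apply, ← map_sub, liftConnection_torsion_free hφ hΛ, hge]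
    rfl
  have m : ∀ i j l, g (Λ (e i) (e j)) (e l) + g (Λ (e i) (e l)) (e j) = 0 := by
    intro i j l
    rw [hg.symm (Λ (e i) (e l))]
    exact liftConnection_metric hφ hgk hΛ _ _ _
  have r := structureConst_rotate hφ hB hBi hkp e
  have t1 := t i j l
  have t2 := t j l i
  have t3 := t l i j
  rw [r i j l] at t2
  rw [← r l i j] at t3
  have h1 : g (Λ (e i) (e j)) (e l)
      = (x l - x i + x j) / 2 * structureConst hkp B φ e i j l := by
    linarith [m i j l, m j l i, m l i j]
  rw [hge] at h1
  have := (hx l).ne'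
  rw [lcCoeff]
  field_simp
  linarith

variable [Fintype ι] [DecidableEq ι]

/-- The Ricci tensor of a diagonal metric in an orthonormal basis. -/
theorem ricci_basis [FiniteDimensional ℝ L] (hφ : IsHorizontalLift k B φ)
    (hB : IsScalarProduct B) (hBi : IsLieInvariant B) (hkp : IsCompl k.toSubmodule p)
    (hr : IsReductive k p) {g : LinearMap.BilinForm ℝ p} (hg : IsScalarProduct g)
    (hgk : IsAdInvariant hkp g) {e : Module.Basis ι ℝ p}
    (he : IsOrthonormalBasis (liftForm B φ) e) {x : ι → ℝ} (hx : ∀ i, 0 < x i)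
    (hge : ∀ X i, g X (e i) = x i * liftForm B φ X (e i)) (a b : ι) :
    ricci hkp g (e a) (e b)
      = ∑ i, ((∑ l, (lcCoeff x l b i - lcCoeff x i b l * lcCoeff x a l i)
            * (structureConst hkp B φ e i a l * structureConst hkp B φ e i b l))
          + B (liftBracketK hkp φ (e i) (e a)) (liftBracketK hkp φ (e i) (e b))) := by
  set Λ := liftConnection hkp φ (leviCivita hkp g) with hΛdef
  set τ := structureConst hkp B φ e with hτ
  have hΛ : ∀ i j l, liftForm B φ (Λ (e i) (e j)) (e l) = lcCoeff x i j l * τ i j l :=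
    liftConnection_basis hφ hB hBi hkp hg hgk hx hge
  have r : ∀ i j l, τ j l i = τ i j l := structureConst_rotate hφ hB hBi hkp e
  have s : ∀ i j l, τ j i l = - τ i j l := structureConst_swap hkp e
  have hs0 : ∀ i j, τ i j i = 0 := by
    intro i j
    have h1 := r i i j
    have h2 := s i j i
    have h3 := s i i j
    have h4 := r i j i
    linarith
  have hexp : ∀ (i j : ι), Λ (e i) (e j) = ∑ l, (lcCoeff x i j l * τ i j l) • e l := by
    intro i j
    rw [← he.sum_smul (Λ (e i) (e j))]
    simp_rw [hΛ]
  have hβ : ∀ i j, liftBracketP hkp φ (e i) (e j) = ∑ l, τ i j l • e l := fun i j =>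
    (he.sum_smul _).symm
  simp only [ricci, LinearMap.mk₂_apply]
  rw [he.trace]
  refine Finset.sum_congr rfl fun i _ => ?_
  have h1 : curvatureMap hkp g (e a) (e b) (e i) = curvature hkp g (e i) (e a) (e b) := rfl
  rw [h1, curvature_eq_liftConnection hφ hkp hr hg hgk]
  simp only [map_sub, LinearMap.sub_apply]
  rw [liftForm_adP_liftBracketK hφ hB hBi hkp hr, liftBracketK_swap hkp φ (e b) (e i), map_neg,
    sub_neg_eq_add]
  congr 1
  rw [← hΛdef, hβ, hexp a b, hexp i b]
  simp only [map_sum, map_smul, LinearMap.sum_apply, LinearMap.smul_apply, hΛ, smul_eq_mul, hs0,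
    mul_zero, Finset.sum_const_zero, zero_sub]
  rw [← Finset.sum_neg_distrib, ← Finset.sum_sub_distrib]
  refine Finset.sum_congr rfl fun l _ => ?_
  have e1 : τ a l i = τ i a l := r i a l
  have e2 : τ l b i = - τ i b l := by rw [← r l b i, s, r]
  rw [e1, e2]
  ring

end Ricci

end ReductiveCurvature

/-! ### Sums of squared structure constants for two summands -/

section TwoSummands

variable {ι₁ ι₂ : Type*} [Fintype ι₁] [Fintype ι₂]

/-- The sum of the squares `τ i a l ^ 2` over all indices. -/
def sqSum {α β γ : Type*} [Fintype α] [Fintype β] [Fintype γ] (f : α → β → γ → ℝ) : ℝ :=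
  ∑ a, ∑ b, ∑ c, f a b c ^ 2

theorem sqSum_nonneg {α β γ : Type*} [Fintype α] [Fintype β] [Fintype γ] (f : α → β → γ → ℝ) :
    0 ≤ sqSum f :=
  Finset.sum_nonneg fun _ _ => Finset.sum_nonneg fun _ _ => Finset.sum_nonneg fun _ _ => sq_nonneg _

theorem eq_zero_of_sqSum_eq_zero {α β γ : Type*} [Fintype α] [Fintype β] [Fintype γ]
    {f : α → β → γ → ℝ} (h : sqSum f = 0) (a : α) (b : β) (c : γ) : f a b c = 0 := by
  have h1 := (Finset.sum_eq_zero_iff_of_nonneg fun _ _ => Finset.sum_nonneg fun _ _ =>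
    Finset.sum_nonneg fun _ _ => sq_nonneg _).1 h a (Finset.mem_univ _)
  have h2 := (Finset.sum_eq_zero_iff_of_nonneg fun _ _ =>
    Finset.sum_nonneg fun _ _ => sq_nonneg _).1 h1 b (Finset.mem_univ _)
  have h3 := (Finset.sum_eq_zero_iff_of_nonneg fun _ _ => sq_nonneg _).1 h2 c (Finset.mem_univ _)
  exact pow_eq_zero_iff (two_ne_zero) |>.1 h3

/-- The trace over the first summand of the curvature terms of a diagonal metric. -/
theorem sum_lcCoeff {τ : ι₁ ⊕ ι₂ → ι₁ ⊕ ι₂ → ι₁ ⊕ ι₂ → ℝ} (r : ∀ i j l, τ j l i = τ i j l)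
    (s : ∀ i j l, τ j i l = - τ i j l) {x : ι₁ ⊕ ι₂ → ℝ} {x₁ x₂ : ℝ} (h₁ : 0 < x₁) (h₂ : 0 < x₂)
    (hx₁ : ∀ i, x (Sum.inl i) = x₁) (hx₂ : ∀ i, x (Sum.inr i) = x₂) :
    ∑ a : ι₁, ∑ i, ∑ l, (lcCoeff x l (Sum.inl a) i - lcCoeff x i (Sum.inl a) l * lcCoeff x (Sum.inl a) l i)
        * (τ i (Sum.inl a) l * τ i (Sum.inl a) l)
      = sqSum (fun i a l : ι₁ => τ (Sum.inl i) (Sum.inl a) (Sum.inl l)) / 4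
        + (1 - x₂ / (2 * x₁)) *
          sqSum (fun (i a : ι₁) (l : ι₂) => τ (Sum.inl i) (Sum.inl a) (Sum.inr l))
        + x₁ ^ 2 / (4 * x₂ ^ 2) *
          sqSum (fun (i a : ι₂) (l : ι₁) => τ (Sum.inr i) (Sum.inr a) (Sum.inl l)) := by
  -- By total skewness the sum of squares depends only on how many indices lie in each summand, so
  -- the index patterns occurring in the trace reduce to three constants.
  have e1 : sqSum (fun (i a : ι₁) (l : ι₂) => τ (Sum.inl i) (Sum.inl a) (Sum.inr l))
      = ∑ a : ι₁, ∑ i : ι₁, ∑ l : ι₂, τ (Sum.inl i) (Sum.inl a) (Sum.inr l) ^ 2 := by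
    rw [sqSum, Finset.sum_comm]
  have e2 : sqSum (fun (i a : ι₁) (l : ι₂) => τ (Sum.inl i) (Sum.inl a) (Sum.inr l))
      = ∑ a : ι₁, ∑ i : ι₂, ∑ l : ι₁, τ (Sum.inr i) (Sum.inl a) (Sum.inl l) ^ 2 := by
    rw [sqSum]
    refine Finset.sum_congr rfl fun a _ => ?_
    rw [Finset.sum_comm]
    refine Finset.sum_congr rfl fun i _ => Finset.sum_congr rfl fun l _ => ?_
    rw [r (Sum.inr i)]
  have e3 : sqSum (fun (i a : ι₂) (l : ι₁) => τ (Sum.inr i) (Sum.inr a) (Sum.inl l))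
      = ∑ a : ι₁, ∑ i : ι₂, ∑ l : ι₂, τ (Sum.inr i) (Sum.inl a) (Sum.inr l) ^ 2 := by
    have : sqSum (fun (i a : ι₂) (l : ι₁) => τ (Sum.inr i) (Sum.inr a) (Sum.inl l))
        = ∑ a : ι₂, ∑ i : ι₁, ∑ l : ι₂, τ (Sum.inr a) (Sum.inl i) (Sum.inr l) ^ 2 := by
      rw [sqSum]
      refine Finset.sum_congr rfl fun a _ => ?_
      rw [Finset.sum_comm]
      refine Finset.sum_congr rfl fun i _ => Finset.sum_congr rfl fun l _ => ?_
      rw [r (Sum.inl i), s (Sum.inr a) (Sum.inl i), r, neg_sq]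
    rw [this, Finset.sum_comm]
  have e0 : sqSum (fun i a l : ι₁ => τ (Sum.inl i) (Sum.inl a) (Sum.inl l))
      = ∑ a : ι₁, ∑ i : ι₁, ∑ l : ι₁, τ (Sum.inl i) (Sum.inl a) (Sum.inl l) ^ 2 := by
    rw [sqSum, Finset.sum_comm]
  have c : ∀ (a : ι₁) (i l : ι₁ ⊕ ι₂) (q : ℝ), x i = q → 0 < q →
      (lcCoeff x l (Sum.inl a) i - lcCoeff x i (Sum.inl a) l * lcCoeff x (Sum.inl a) l i)
        * (τ i (Sum.inl a) l * τ i (Sum.inl a) l)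
      = ((q - x l + x₁) / (2 * q) - (x l - q + x₁) / (2 * x l) * ((q - x₁ + x l) / (2 * q)))
        * τ i (Sum.inl a) l ^ 2 := by
    intro a i l q hq _
    rw [lcCoeff, lcCoeff, lcCoeff, hq, hx₁, sq]
  simp only [Fintype.sum_sum_type, Finset.sum_add_distrib, c _ (Sum.inl _) _ x₁ (hx₁ _) h₁,
    c _ (Sum.inr _) _ x₂ (hx₂ _) h₂, hx₁, hx₂, ← Finset.mul_sum]
  rw [← e1, ← e2, ← e3, ← e0]
  field_simp
  ring

/-- The trace over the second summand of the curvature terms of a diagonal metric. -/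
theorem sum_lcCoeff' {τ : ι₁ ⊕ ι₂ → ι₁ ⊕ ι₂ → ι₁ ⊕ ι₂ → ℝ} (r : ∀ i j l, τ j l i = τ i j l)
    (s : ∀ i j l, τ j i l = - τ i j l) {x : ι₁ ⊕ ι₂ → ℝ} {x₁ x₂ : ℝ} (h₁ : 0 < x₁) (h₂ : 0 < x₂)
    (hx₁ : ∀ i, x (Sum.inl i) = x₁) (hx₂ : ∀ i, x (Sum.inr i) = x₂) :
    ∑ a : ι₂, ∑ i, ∑ l, (lcCoeff x l (Sum.inr a) i - lcCoeff x i (Sum.inr a) l * lcCoeff x (Sum.inr a) l i)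
        * (τ i (Sum.inr a) l * τ i (Sum.inr a) l)
      = sqSum (fun i a l : ι₂ => τ (Sum.inr i) (Sum.inr a) (Sum.inr l)) / 4
        + (1 - x₁ / (2 * x₂)) *
          sqSum (fun (i a : ι₂) (l : ι₁) => τ (Sum.inr i) (Sum.inr a) (Sum.inl l))
        + x₂ ^ 2 / (4 * x₁ ^ 2) *
          sqSum (fun (i a : ι₁) (l : ι₂) => τ (Sum.inl i) (Sum.inl a) (Sum.inr l)) := by
  -- The mirror case is the previous one after exchanging the two index types.
  have h := sum_lcCoeff (τ := fun i j l => τ i.swap j.swap l.swap) (fun i j l => r _ _ _)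
    (fun i j l => s _ _ _) (x := fun i => x i.swap) h₂ h₁ hx₂ hx₁
  simp only [Sum.swap_inl, Sum.swap_inr] at h
  rw [← h]
  refine Finset.sum_congr rfl fun a _ => ?_
  rw [← (Equiv.sumComm ι₂ ι₁).sum_comp]
  refine Finset.sum_congr rfl fun i _ => ?_
  rw [← (Equiv.sumComm ι₂ ι₁).sum_comp]
  rfl

end TwoSummands

/-! ### Diagonal forms and adapted orthonormal bases -/

section DiagForm

variable {V : Type*} [AddCommGroup V] [Module ℝ V] {p₁ p₂ : Submodule ℝ V}

theorem diagForm_apply (h : IsCompl p₁ p₂) (Q : LinearMap.BilinForm ℝ V) (x₁ x₂ : ℝ) (X Y : V) :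
    diagForm h Q x₁ x₂ X Y = x₁ * Q (p₁.projection p₂ h X) (p₁.projection p₂ h Y)
      + x₂ * Q (p₂.projection p₁ h.symm X) (p₂.projection p₁ h.symm Y) := rfl

theorem projection_of_mem (h : IsCompl p₁ p₂) {X : V} (hX : X ∈ p₁) : p₁.projection p₂ h X = X :=
  Submodule.projection_apply_of_mem_left h hX

theorem projection_of_mem_right (h : IsCompl p₁ p₂) {X : V} (hX : X ∈ p₂) :
    p₁.projection p₂ h X = 0 :=
  Submodule.projection_apply_right h ⟨X, hX⟩

theorem projection_add_projection (h : IsCompl p₁ p₂) (X : V) :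
    p₁.projection p₂ h X + p₂.projection p₁ h.symm X = X :=
  Submodule.projection_add_projection_eq_self h X

theorem isScalarProduct_diagForm (h : IsCompl p₁ p₂) {Q : LinearMap.BilinForm ℝ V}
    (hQ : IsScalarProduct Q) {x₁ x₂ : ℝ} (h₁ : 0 < x₁) (h₂ : 0 < x₂) :
    IsScalarProduct (diagForm h Q x₁ x₂) := by
  have hn : ∀ X, 0 ≤ Q X X := fun X => by
    by_cases hX : X = 0
    · simp [hX]
    · exact (hQ.pos X hX).le
  refine ⟨fun X Y => ?_, fun X hX => ?_⟩
  · rw [diagForm_apply, diagForm_apply, hQ.symm, hQ.symm (p₂.projection p₁ h.symm X)]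
  · rw [diagForm_apply]
    by_cases h0 : p₁.projection p₂ h X = 0
    · have h3 : p₂.projection p₁ h.symm X ≠ 0 := fun h4 => hX <| by
        rw [← projection_add_projection h X, h0, h4, add_zero]
      have := mul_pos h₂ (hQ.pos _ h3)
      have := mul_nonneg h₁.le (hn (p₁.projection p₂ h X))
      linarith
    · have := mul_pos h₁ (hQ.pos _ h0)
      have := mul_nonneg h₂.le (hn (p₂.projection p₁ h.symm X))
      linarith

/-- A scalar product has an orthonormal basis. -/
theorem exists_isOrthonormalBasis [FiniteDimensional ℝ V] {Q : LinearMap.BilinForm ℝ V}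
    (hQ : IsScalarProduct Q) :
    ∃ e : Module.Basis (Fin (Module.finrank ℝ V)) ℝ V, IsOrthonormalBasis Q e := by
  let c : InnerProductSpace.Core ℝ V :=
    { inner := fun X Y => Q X Y
      conj_inner_symm := fun X Y => hQ.symm _ _
      re_inner_nonneg := fun X => by
        by_cases hX : X = 0
        · simp [hX]
        · exact (hQ.pos X hX).le
      add_left := fun X Y Z => by simp
      smul_left := fun X Y r => by simp
      definite := fun X hX => by
        by_contra h
        exact (hQ.pos X h).ne' hX }
  let _ : NormedAddCommGroup V := c.toNormedAddCommGroup
  let _ : InnerProductSpace ℝ V := InnerProductSpace.ofCore c.toCore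
  refine ⟨(stdOrthonormalBasis ℝ V).toBasis, fun i j => ?_⟩
  have := orthonormal_iff_ite.1 (stdOrthonormalBasis ℝ V).orthonormal i j
  rw [OrthonormalBasis.coe_toBasis]
  exact this

/-- An orthonormal basis adapted to an orthogonal splitting. -/
theorem exists_adapted_isOrthonormalBasis [FiniteDimensional ℝ V] (h : IsCompl p₁ p₂)
    {Q : LinearMap.BilinForm ℝ V} (hQ : IsScalarProduct Q)
    (ho : ∀ X ∈ p₁, ∀ Y ∈ p₂, Q X Y = 0) :
    ∃ e : Module.Basis (Fin (Module.finrank ℝ p₁) ⊕ Fin (Module.finrank ℝ p₂)) ℝ V,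
      IsOrthonormalBasis Q e ∧ (∀ i, e (Sum.inl i) ∈ p₁) ∧ ∀ i, e (Sum.inr i) ∈ p₂ := by
  have hr : ∀ W : Submodule ℝ V, IsScalarProduct (Q.restrict W) := fun W =>
    ⟨fun X Y => hQ.symm _ _, fun X hX => hQ.pos _ (by simpa using hX)⟩
  obtain ⟨e₁, he₁⟩ := exists_isOrthonormalBasis (hr p₁)
  obtain ⟨e₂, he₂⟩ := exists_isOrthonormalBasis (hr p₂)
  let e := (e₁.prod e₂).map (Submodule.prodEquivOfIsCompl p₁ p₂ h)
  have h1 : ∀ i, e (Sum.inl i) = e₁ i := fun i => by simp [e]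
  have h2 : ∀ i, e (Sum.inr i) = e₂ i := fun i => by simp [e]
  refine ⟨e, ?_, fun i => by rw [h1]; exact (e₁ i).2, fun i => by rw [h2]; exact (e₂ i).2⟩
  rintro (i | i) (j | j)
  · rw [h1, h1]; simpa using he₁ i j
  · rw [h1, h2]; simpa using ho _ (e₁ i).2 _ (e₂ j).2
  · rw [h1, h2, hQ.symm]; simpa using ho _ (e₁ j).2 _ (e₂ i).2
  · rw [h2, h2]; simpa using he₂ i j

theorem diagForm_basis {ι₁ ι₂ : Type*} (h : IsCompl p₁ p₂)
    {Q : LinearMap.BilinForm ℝ V} (hQ : IsScalarProduct Q)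
    (ho : ∀ X ∈ p₁, ∀ Y ∈ p₂, Q X Y = 0) {e : Module.Basis (ι₁ ⊕ ι₂) ℝ V}
    (he₁ : ∀ i, e (Sum.inl i) ∈ p₁) (he₂ : ∀ i, e (Sum.inr i) ∈ p₂) (x₁ x₂ : ℝ) (X : V)
    (i : ι₁ ⊕ ι₂) : diagForm h Q x₁ x₂ X (e i)
      = Sum.elim (fun _ => x₁) (fun _ => x₂) i * Q X (e i) := by
  rw [diagForm_apply]
  conv_rhs => rw [← projection_add_projection h X, map_add, LinearMap.add_apply]
  rcases i with i | i
  · rw [projection_of_mem h (he₁ i), projection_of_mem_right h.symm (he₁ i),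
      hQ.symm (p₂.projection p₁ h.symm X) (e _),
      ho _ (he₁ i) _ (Submodule.projection_apply_mem h.symm X)]
    simp
  · rw [projection_of_mem h.symm (he₂ i), projection_of_mem_right h (he₂ i),
      ho _ (Submodule.projection_apply_mem h X) _ (he₂ i)]
    simp

end DiagForm

/-! ### Schur's lemma for invariant bilinear forms -/

section Schur

variable {M V : Type*} [Group M] [AddCommGroup V] [Module ℝ V]

/-- `W` is a non-zero invariant subspace without proper invariant subspaces. -/
structure IsIrreducibleSubrep (ρ : Representation ℝ M V) (W : Submodule ℝ V) : Prop where
  ne_bot : W ≠ ⊥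
  invariant : ∀ a, ∀ X ∈ W, ρ a X ∈ W
  irreducible : ∀ U ≤ W, (∀ a, ∀ X ∈ U, ρ a X ∈ U) → U = ⊥ ∨ U = W

/-- `S` is invariant under `ρ`. -/
def IsRepInvariant (ρ : Representation ℝ M V) (S : LinearMap.BilinForm ℝ V) : Prop :=
  ∀ a X Y, S (ρ a X) (ρ a Y) = S X Y

variable {ρ : Representation ℝ M V}

theorem IsRepInvariant.apply_left {S : LinearMap.BilinForm ℝ V} (hS : IsRepInvariant ρ S) (a : M)
    (X Y : V) : S (ρ a X) Y = S X (ρ a⁻¹ Y) := by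
  rw [← hS a X, Representation.self_inv_apply]

/-- A symmetric form has an eigenvector with respect to a scalar product. -/
theorem exists_eigenvector [FiniteDimensional ℝ V] [Nontrivial V] {Q S : LinearMap.BilinForm ℝ V}
    (hQ : IsScalarProduct Q) (hS : ∀ X Y, S X Y = S Y X) :
    ∃ (c : ℝ) (X : V), X ≠ 0 ∧ ∀ Y, S X Y = c * Q X Y := by
  let T : Module.End ℝ V := (Q.toDual hQ.nondegenerate).symm.toLinearMap ∘ₗ S
  have hT : ∀ X Y, Q (T X) Y = S X Y := fun X Y =>
    LinearMap.BilinForm.apply_toDual_symm_apply (hB := hQ.nondegenerate) (S X) Y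
  let c : InnerProductSpace.Core ℝ V :=
    { inner := fun X Y => Q X Y
      conj_inner_symm := fun X Y => hQ.symm _ _
      re_inner_nonneg := fun X => by
        by_cases hX : X = 0
        · simp [hX]
        · exact (hQ.pos X hX).le
      add_left := fun X Y Z => by simp
      smul_left := fun X Y r => by simp
      definite := fun X hX => by
        by_contra h
        exact (hQ.pos X h).ne' hX }
  let _ : NormedAddCommGroup V := c.toNormedAddCommGroup
  let _ : InnerProductSpace ℝ V := InnerProductSpace.ofCore c.toCore
  have hs : T.IsSymmetric := fun X Y => by
    change Q (T X) Y = Q X (T Y)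
    rw [hT, hQ.symm, hT, hS]
  obtain ⟨μ, hμ⟩ : ∃ μ : ℝ, Module.End.HasEigenvalue T μ :=
    ⟨_, hs.hasEigenvalue_iSup_of_finiteDimensional⟩
  obtain ⟨X, hX⟩ := hμ.exists_hasEigenvector
  refine ⟨μ, X, hX.2, fun Y => ?_⟩
  rw [← hT, hX.apply_eq_smul, map_smul, LinearMap.smul_apply, smul_eq_mul]

/-- Symmetry on `W` provides a real eigenvalue relative to `Q`, replacing algebraic closedness; its
eigenspace is invariant and non-zero, hence all of `W`. -/
theorem exists_eq_mul_of_irreducible [FiniteDimensional ℝ V] {W : Submodule ℝ V}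
    (hW : IsIrreducibleSubrep ρ W) {Q S : LinearMap.BilinForm ℝ V} (hQ : IsScalarProduct Q)
    (hQi : IsRepInvariant ρ Q) (hSi : IsRepInvariant ρ S)
    (hS : ∀ X ∈ W, ∀ Y ∈ W, S X Y = S Y X) :
    ∃ c : ℝ, ∀ X ∈ W, ∀ Y ∈ W, S X Y = c * Q X Y := by
  have : Nontrivial W := Submodule.nontrivial_iff_ne_bot.2 hW.ne_bot
  have hr : IsScalarProduct (Q.restrict W) :=
    ⟨fun X Y => hQ.symm _ _, fun X hX => hQ.pos _ (by simpa using hX)⟩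
  obtain ⟨c, X, hX, h⟩ := exists_eigenvector (S := S.restrict W) hr
    (fun X Y => hS _ X.2 _ Y.2)
  let U : Submodule ℝ V :=
    { carrier := {X | X ∈ W ∧ ∀ Y ∈ W, S X Y = c * Q X Y}
      add_mem' := fun {X X'} hX hX' => ⟨W.add_mem hX.1 hX'.1, fun Y hY => by
        simp only [map_add, LinearMap.add_apply, hX.2 Y hY, hX'.2 Y hY, mul_add]⟩
      zero_mem' := ⟨W.zero_mem, fun Y _ => by simp⟩
      smul_mem' := fun r X hX => ⟨W.smul_mem r hX.1, fun Y hY => by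
        simp only [map_smul, LinearMap.smul_apply, hX.2 Y hY, smul_eq_mul]; ring⟩ }
  have hU : U = ⊥ ∨ U = W := by
    refine hW.irreducible U (fun X hX => hX.1) fun a X hX => ⟨hW.invariant a X hX.1, fun Y hY => ?_⟩
    rw [hSi.apply_left, hQi.apply_left]
    exact hX.2 _ (hW.invariant _ _ hY)
  rcases hU with hU | hU
  · have hXU : (X : V) ∈ U := ⟨X.2, fun Y hY => h ⟨Y, hY⟩⟩
    rw [hU, Submodule.mem_bot] at hXU
    exact absurd (Subtype.ext hXU) hX
  · refine ⟨c, fun X hX => ?_⟩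
    rw [← hU] at hX
    exact hX.2

/-- Through `Q` the form `S` becomes an equivariant map $W_1\to W_2$, whose kernel and image are
invariant: it is zero or an isomorphism. Symmetry of `S` plays no role, so the Ricci tensor is
admissible. -/
theorem eq_zero_of_not_equivalent [FiniteDimensional ℝ V] {W₁ W₂ : Submodule ℝ V}
    (hW₁ : IsIrreducibleSubrep ρ W₁) (hW₂ : IsIrreducibleSubrep ρ W₂)
    (hne : ¬ ∃ φ : W₁ ≃ₗ[ℝ] W₂, ∀ a, ∀ X Y : W₁, (Y : V) = ρ a X → (φ Y : V) = ρ a (φ X))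
    {Q S : LinearMap.BilinForm ℝ V} (hQ : IsScalarProduct Q)
    (hQi : IsRepInvariant ρ Q) (hSi : IsRepInvariant ρ S) :
    ∀ X ∈ W₁, ∀ Y ∈ W₂, S X Y = 0 := by
  have hr : IsScalarProduct (Q.restrict W₂) :=
    ⟨fun X Y => hQ.symm _ _, fun X hX => hQ.pos _ (by simpa using hX)⟩
  let D : W₁ →ₗ[ℝ] W₂ := ((Q.restrict W₂).toDual hr.nondegenerate).symm.toLinearMap ∘ₗ
    (S.compl₁₂ W₁.subtype W₂.subtype)
  have hD : ∀ (X : W₁) (Y : W₂), Q (D X) Y = S X Y := fun X Y =>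
    LinearMap.BilinForm.apply_toDual_symm_apply (B := Q.restrict W₂) (hB := hr.nondegenerate)
      ((S.compl₁₂ W₁.subtype W₂.subtype) X) Y
  have hDe : ∀ a, ∀ X Y : W₁, (Y : V) = ρ a X → (D Y : V) = ρ a (D X) := by
    intro a X Y hY
    have : D Y = ⟨ρ a (D X), hW₂.invariant a _ (D X).2⟩ := by
      refine hr.eq_of_forall fun Z => ?_
      change Q (D Y) Z = Q (ρ a (D X)) Z
      rw [hD, hQi.apply_left, hY, hSi.apply_left]
      exact (hD X ⟨_, hW₂.invariant a⁻¹ _ Z.2⟩).symm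
    rw [this]
  have hker := hW₁.irreducible ((LinearMap.ker D).map W₁.subtype)
    (Submodule.map_subtype_le _ _) (by
      rintro a _ ⟨X, hX, rfl⟩
      refine ⟨⟨ρ a X, hW₁.invariant a _ X.2⟩, ?_, rfl⟩
      have h1 := hDe a X ⟨ρ a X, hW₁.invariant a _ X.2⟩ rfl
      rw [LinearMap.mem_ker.1 hX, Submodule.coe_zero, map_zero] at h1
      exact LinearMap.mem_ker.2 (Subtype.ext h1))
  have hran := hW₂.irreducible ((LinearMap.range D).map W₂.subtype)
    (Submodule.map_subtype_le _ _) (by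
      rintro a _ ⟨_, ⟨X, rfl⟩, rfl⟩
      exact ⟨_, ⟨⟨ρ a X, hW₁.invariant a _ X.2⟩, rfl⟩, hDe a X _ rfl⟩)
  have hzero : D = 0 → ∀ X ∈ W₁, ∀ Y ∈ W₂, S X Y = 0 := by
    intro h0 X hX Y hY
    rw [← hD ⟨X, hX⟩ ⟨Y, hY⟩, h0]
    simp
  rcases hker with hker | hker
  · rcases hran with hran | hran
    · refine hzero (LinearMap.range_eq_bot.1 ?_)
      exact Submodule.map_injective_of_injective W₂.injective_subtype (hran.trans (Submodule.map_bot _).symm)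
    · refine absurd ⟨LinearEquiv.ofBijective D ⟨?_, ?_⟩, hDe⟩ hne
      · exact LinearMap.ker_eq_bot.1
          (Submodule.map_injective_of_injective W₁.injective_subtype
            (hker.trans (Submodule.map_bot _).symm))
      · intro Y
        have : (Y : V) ∈ (LinearMap.range D).map W₂.subtype := by rw [hran]; exact Y.2
        obtain ⟨_, ⟨X, rfl⟩, hX⟩ := this
        exact ⟨X, Subtype.ext hX⟩
  · refine hzero (LinearMap.ext fun X => ?_)
    have : (X : V) ∈ (LinearMap.ker D).map W₁.subtype := by rw [hker]; exact X.2
    obtain ⟨X', hX', h⟩ := this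
    rw [← Subtype.ext h]
    exact hX'

end Schur

/-! ### Naturality of the Ricci tensor -/

section Naturality

variable {L : Type*} [LieRing L] [LieAlgebra ℝ L] [FiniteDimensional ℝ L]
variable {k : LieSubalgebra ℝ L} {p : Submodule ℝ L}

/-- The Ricci tensor is invariant under automorphisms of `(L, k, p)` that preserve `g`. -/
theorem ricci_map (hkp : IsCompl k.toSubmodule p) {g : LinearMap.BilinForm ℝ p}
    (hg : IsScalarProduct g) (F : L →ₗ⁅ℝ⁆ L) (hF : ∀ Z ∈ k, F Z ∈ k) (ψ : p ≃ₗ[ℝ] p)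
    (hψ : ∀ X : p, (ψ X : L) = F X) (hgψ : ∀ X Y, g (ψ X) (ψ Y) = g X Y) (Y Z : p) :
    ricci hkp g (ψ Y) (ψ Z) = ricci hkp g Y Z := by
  have hP : ∀ U, prP hkp (F U) = ψ (prP hkp U) := by
    intro U
    conv_lhs => rw [← prP_add_prK hkp U, map_add, map_add, prP_of_mem_k hkp (hF _ (prK hkp U).2),
      add_zero, ← hψ, prP_of_mem_p]
  have hK : ∀ U, (prK hkp (F U) : L) = F (prK hkp U) := by
    intro U
    conv_lhs => rw [← prP_add_prK hkp U, map_add, map_add, ← hψ, prK_of_mem_p, zero_add,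
      prK_of_mem_k hkp (hF _ (prK hkp U).2)]
  have hβ : ∀ X Y, bracketP hkp (ψ X) (ψ Y) = ψ (bracketP hkp X Y) := by
    intro X Y
    simp only [bracketP, LinearMap.mk₂_apply, hψ]
    rw [← LieHom.map_lie, hP]
  have hLC := isLeviCivita_leviCivita hkp hg
  have hsymm : ∀ X Y, g (ψ.symm X) Y = g X (ψ Y) := fun X Y => by
    rw [← hgψ, LinearEquiv.apply_symm_apply]
  -- The connection transported by `ψ` is again torsion free and metric, so uniqueness identifies it
  -- with the original one.
  have hΛ : ∀ X Y, leviCivita hkp g (ψ X) (ψ Y) = ψ (leviCivita hkp g X Y) := by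
    have h : IsLeviCivita hkp g
        ((leviCivita hkp g).compl₁₂ ψ.toLinearMap ψ.toLinearMap |>.compr₂ ψ.symm.toLinearMap) := by
      refine ⟨fun X Y => ?_, fun X Y Z => ?_⟩
      · simp only [LinearMap.compr₂_apply, LinearMap.compl₁₂_apply, LinearEquiv.coe_coe]
        rw [← map_sub, hLC.torsion_free, hβ, LinearEquiv.symm_apply_apply]
      · simp only [LinearMap.compr₂_apply, LinearMap.compl₁₂_apply, LinearEquiv.coe_coe]
        rw [hg.symm Y, hsymm, hsymm, hg.symm _ (ψ Y), hLC.metric]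
    have h2 := (existsUnique_isLeviCivita hkp g hg).unique h hLC
    intro X Y
    conv_rhs => rw [← h2]
    simp
  have hcurv : ∀ X Y Z, curvature hkp g (ψ X) (ψ Y) (ψ Z) = ψ (curvature hkp g X Y Z) := by
    intro X Y Z
    simp only [curvature, isotropyPart, LinearMap.sub_apply, LinearMap.comp_apply, map_sub, hΛ, hβ,
      Submodule.subtype_apply, LieAlgebra.ad_apply, hψ, ← LieHom.map_lie, hK, hP]
  simp only [ricci, LinearMap.mk₂_apply]
  have h : curvatureMap hkp g (ψ Y) (ψ Z) = ψ.conj (curvatureMap hkp g Y Z) := by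
    refine LinearMap.ext fun X => ?_
    rw [LinearEquiv.conj_apply_apply]
    change curvature hkp g X (ψ Y) (ψ Z) = ψ (curvature hkp g (ψ.symm X) Y Z)
    rw [← hcurv, LinearEquiv.apply_symm_apply]
  rw [h, LinearMap.trace_conj']

end Naturality

open Filter Topology

/-! ### Continuation of solutions of an autonomous equation -/

section Extension

/-- A solution of an autonomous equation that converges at the right end of its interval extends
beyond that end. -/
theorem exists_extension {E : Type*} [NormedAddCommGroup E] [NormedSpace ℝ E] [CompleteSpace E]
    {v : E → E} {X : ℝ → E} {b : ℝ} {l : E} (hb : 0 < b) (hv : ContDiffAt ℝ 1 v l)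
    (hX : ∀ t ∈ Ico 0 b, HasDerivWithinAt X (v (X t)) (Ico 0 b) t)
    (hl : Tendsto X (𝓝[<] b) (𝓝 l)) {U : Set E} (hU : U ∈ 𝓝 l) :
    ∃ c > b, ∃ Z : ℝ → E, (∀ t ∈ Ico 0 b, Z t = X t) ∧
      (∀ t ∈ Ico 0 c, HasDerivWithinAt Z (v (Z t)) (Ico 0 c) t) ∧ ∀ t ∈ Ico b c, Z t ∈ U := by
  obtain ⟨α, hα0, ε, hε, hα⟩ :=
    hv.exists_forall_mem_closedBall_exists_eq_forall_mem_Ioo_hasDerivAt₀ b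
  have hαU : ∀ᶠ t in 𝓝 b, α t ∈ U := by
    have := (hα b ⟨by linarith, by linarith⟩).continuousAt
    exact this (by rwa [hα0])
  obtain ⟨δ, hδ, hαδ⟩ := Metric.eventually_nhds_iff.1 hαU
  -- `ε` bounds the lifetime of the local solution started at the limit `l`, and `δ` keeps it inside
  -- `U`.
  refine ⟨b + min ε δ, by have := lt_min hε hδ; linarith, fun t => if t < b then X t else α t,
    fun t ht => if_pos ht.2, fun t ht => ?_, fun t ht => ?_⟩
  · have hcε : t < b + ε := ht.2.trans_le (by linarith [min_le_left ε δ])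
    rcases lt_trichotomy t b with h | rfl | h
    · beta_reduce
      rw [if_pos h]
      have h1 : HasDerivWithinAt X (v (X t)) (Ico 0 (b + min ε δ)) t := by
        refine (hX t ⟨ht.1, h⟩).mono_of_mem_nhdsWithin ?_
        have : Ico 0 (b + min ε δ) ∩ Iio b ∈ 𝓝[Ico 0 (b + min ε δ)] t :=
          inter_mem self_mem_nhdsWithin (mem_nhdsWithin_of_mem_nhds (Iio_mem_nhds h))
        exact mem_of_superset this fun s hs => ⟨hs.1.1, hs.2⟩
      refine h1.congr_of_eventuallyEq ?_ (if_pos h)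
      filter_upwards [mem_nhdsWithin_of_mem_nhds (Iio_mem_nhds h)] with s hs
      exact if_pos hs
    · beta_reduce
      rw [if_neg (lt_irrefl _), hα0]
      set Z : ℝ → E := fun s => if s < t then X s else α s with hZ
      have hZt : Z t = l := by simp [hZ, hα0]
      have hZX : ∀ s ∈ Ioo 0 t, Z =ᶠ[𝓝 s] X := fun s hs => by
        filter_upwards [Iio_mem_nhds hs.2] with u hu
        exact if_pos hu
      have hd : ∀ s ∈ Ioo 0 t, HasDerivAt Z (v (X s)) s := fun s hs =>
        ((hX s ⟨hs.1.le, hs.2⟩).hasDerivAt (Ico_mem_nhds hs.1 hs.2)).congr_of_eventuallyEq (hZX s hs)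
      have hZl : Tendsto Z (𝓝[<] t) (𝓝 l) := hl.congr' (by
        filter_upwards [self_mem_nhdsWithin] with s hs
        exact (if_pos hs).symm)
      -- At the gluing point the left derivative is the limit of the derivatives $v(X(s))$, which
      -- exists because `v` is continuous at `l`.
      have hleft : HasDerivWithinAt Z (v l) (Iic t) t := by
        refine hasDerivWithinAt_Iic_of_tendsto_deriv (s := Ioo 0 t)
          (fun s hs => (hd s hs).differentiableAt.differentiableWithinAt) ?_
          (Ioo_mem_nhdsLT hb) ?_
        · rw [ContinuousWithinAt, hZt]
          exact hZl.mono_left (nhdsWithin_mono _ fun s hs => hs.2)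
        · refine (hv.continuousAt.tendsto.comp hl).congr' ?_
          filter_upwards [Ioo_mem_nhdsLT hb] with s hs
          exact (hd s hs).deriv.symm
      have hright : HasDerivWithinAt Z (v l) (Ici t) t := by
        have h1 := (hα t ⟨by linarith, by linarith⟩).hasDerivWithinAt (s := Ici t)
        rw [hα0] at h1
        exact h1.congr (fun s hs => if_neg (not_lt.2 hs)) (if_neg (lt_irrefl _))
      have := hleft.union hright
      rw [Iic_union_Ici] at this
      exact this.mono (subset_univ _)
    · beta_reduce
      rw [if_neg h.not_gt]
      refine HasDerivAt.hasDerivWithinAt ((hα t ⟨by linarith, hcε⟩).congr_of_eventuallyEq ?_)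
      filter_upwards [Ioi_mem_nhds h] with s hs
      exact if_neg (not_lt.2 (le_of_lt hs))
  · beta_reduce
    rw [if_neg (not_lt.2 ht.1)]
    refine hαδ ?_
    have := min_le_right ε δ
    have := ht.2
    rw [Real.dist_eq, abs_of_nonneg (by linarith [ht.1])]
    linarith

end Extension

/-! ### The planar flow: monotone scalar curvature and extension while it is non-positive -/

section PlanarFlow

/-- The coefficients of the Ricci tensor of the metrics `x Q|p₁ ⊕ y Q|p₂`. -/
structure FlowData where
  d₁ : ℝ
  d₂ : ℝ
  E₁ : ℝ
  E₂ : ℝ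
  A : ℝ
  C : ℝ
  d₁_pos : 0 < d₁
  d₂_pos : 0 < d₂
  A_pos : 0 < A
  C_pos : 0 < C
  A_le : A ≤ E₁
  C_le : C ≤ E₂

namespace FlowData

/-- Exchange of the two summands. -/
def swap (P : FlowData) : FlowData :=
  ⟨P.d₂, P.d₁, P.E₂, P.E₁, P.C, P.A, P.d₂_pos, P.d₁_pos, P.C_pos, P.A_pos, P.C_le, P.A_le⟩

/-- The Ricci tensor on the first summand. -/
def r₁ (P : FlowData) (x y : ℝ) : ℝ :=
  (P.E₁ - P.A / 2 * (y / x) + P.C / 4 * (x ^ 2 / y ^ 2)) / P.d₁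

/-- The Ricci tensor on the second summand. -/
def r₂ (P : FlowData) (x y : ℝ) : ℝ :=
  (P.E₂ - P.C / 2 * (x / y) + P.A / 4 * (y ^ 2 / x ^ 2)) / P.d₂

/-- The scalar curvature. -/
def scal (P : FlowData) (x y : ℝ) : ℝ := P.d₁ * P.r₁ x y / x + P.d₂ * P.r₂ x y / y

/-- The Ricci flow in the coordinates `x, y`. -/
structure IsSol (P : FlowData) (x y : ℝ → ℝ) (J : Set ℝ) : Prop where
  pos₁ : ∀ t ∈ J, 0 < x t
  pos₂ : ∀ t ∈ J, 0 < y t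
  deriv₁ : ∀ t ∈ J, HasDerivWithinAt x (-2 * P.r₁ (x t) (y t)) J t
  deriv₂ : ∀ t ∈ J, HasDerivWithinAt y (-2 * P.r₂ (x t) (y t)) J t

variable {P : FlowData} {x y : ℝ → ℝ} {J : Set ℝ}

theorem IsSol.swap (h : P.IsSol x y J) : P.swap.IsSol y x J :=
  ⟨h.pos₂, h.pos₁, h.deriv₂, h.deriv₁⟩

theorem scal_swap (P : FlowData) (x y : ℝ) : P.swap.scal y x = P.scal x y := add_comm _ _

theorem scal_eq (P : FlowData) {x y : ℝ} (hx : 0 < x) (hy : 0 < y) :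
    P.scal x y = P.E₁ / x + P.E₂ / y - P.A / 4 * (y / x ^ 2) - P.C / 4 * (x / y ^ 2) := by
  have := P.d₁_pos
  have := P.d₂_pos
  rw [scal, r₁, r₂]
  field_simp
  ring

/-- Along the flow the scalar curvature does not decrease. -/
theorem IsSol.hasDerivWithinAt_scal (h : P.IsSol x y J) {t : ℝ} (ht : t ∈ J) :
    HasDerivWithinAt (fun s => P.scal (x s) (y s))
      (2 * (P.d₁ * (P.r₁ (x t) (y t) / x t) ^ 2 + P.d₂ * (P.r₂ (x t) (y t) / y t) ^ 2)) J t := by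
  have hx := h.pos₁ t ht
  have hy := h.pos₂ t ht
  have hx' := h.deriv₁ t ht
  have hy' := h.deriv₂ t ht
  have h1 := ((((hasDerivWithinAt_const t J P.E₁).div hx' hx.ne').add
    ((hasDerivWithinAt_const t J P.E₂).div hy' hy.ne')).sub
    ((hy'.div (hx'.pow 2) (pow_pos hx 2).ne').const_mul (P.A / 4))).sub
    ((hx'.div (hy'.pow 2) (pow_pos hy 2).ne').const_mul (P.C / 4))
  refine (h1.congr_deriv ?_).congr (fun s hs => ?_) ?_
  · have := P.d₁_pos
    have := P.d₂_pos
    simp only [r₁, r₂, Pi.pow_apply]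
    field_simp
    ring
  · exact P.scal_eq (h.pos₁ s hs) (h.pos₂ s hs)
  · exact P.scal_eq hx hy

theorem IsSol.monotoneOn_scal (h : P.IsSol x y J) (hJ : Convex ℝ J) :
    MonotoneOn (fun s => P.scal (x s) (y s)) J := by
  refine monotoneOn_of_hasDerivWithinAt_nonneg hJ
    (fun t ht => (h.hasDerivWithinAt_scal ht).continuousWithinAt)
    (fun t ht => (h.hasDerivWithinAt_scal (interior_subset ht)).mono interior_subset)
    fun t _ => ?_
  have := P.d₁_pos
  have := P.d₂_pos
  positivity

/-- With $u=x/y<1$ one has $d_1r_1=2xR-E_1-(2E_2-\frac34Cu)u$: adding $2xR$ trades the $A$-term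
away. Now $E_1>0$, and the bracket is non-negative since $C\le E_2$. -/
theorem r₁_neg_of_scal_nonpos (P : FlowData) {x y : ℝ} (hx : 0 < x) (hxy : x < y)
    (hs : P.scal x y ≤ 0) : P.r₁ x y < 0 := by
  have hy := hx.trans hxy
  have hA := P.A_pos
  have hC := P.C_pos
  have hE₁ := hA.trans_le P.A_le
  have hE₂ := P.C_le
  refine div_neg_of_neg_of_pos ?_ P.d₁_pos
  have h1 : P.E₁ - P.A / 2 * (y / x) + P.C / 4 * (x ^ 2 / y ^ 2)
      = 2 * x * P.scal x y - P.E₁ - (2 * P.E₂ - 3 / 4 * P.C * (x / y)) * (x / y) := by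
    rw [P.scal_eq hx hy]
    field_simp
    ring
  have h2 : x / y < 1 := (div_lt_one hy).2 hxy
  have h3 : 0 < x / y := div_pos hx hy
  have h4 : 0 ≤ (2 * P.E₂ - 3 / 4 * P.C * (x / y)) * (x / y) :=
    mul_nonneg (by nlinarith) h3.le
  have h5 : 2 * x * P.scal x y ≤ 0 := mul_nonpos_of_nonneg_of_nonpos (by linarith) hs
  rw [h1]
  linarith

/-- Since $x/y<1$ and $C\le E_2$, the negative term consumes at most half of $E_2$. This bounds the
decay rate of `y` from below. -/
theorem le_r₂ (P : FlowData) {x y : ℝ} (hx : 0 < x) (hxy : x < y) :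
    P.E₂ / 2 / P.d₂ ≤ P.r₂ x y := by
  have hy := hx.trans hxy
  have hA := P.A_pos
  have hC := P.C_pos
  have hE₂ := P.C_le
  refine div_le_div_of_nonneg_right ?_ P.d₂_pos.le
  have h2 : x / y < 1 := (div_lt_one hy).2 hxy
  have h3 : 0 ≤ P.A / 4 * (y ^ 2 / x ^ 2) := by positivity
  nlinarith

/-- The diagonal is a barrier: a trajectory with non-positive scalar curvature never meets it. -/
theorem scal_self_pos (P : FlowData) {x : ℝ} (hx : 0 < x) : 0 < P.scal x x := by
  have hA := P.A_pos
  have hC := P.C_pos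
  have h1 : P.scal x x = (P.E₁ + P.E₂ - P.A / 4 - P.C / 4) / x := by
    rw [P.scal_eq hx hx]
    field_simp
  rw [h1]
  exact div_pos (by linarith [P.A_le, P.C_le]) hx

end FlowData

theorem convex_timeInterval (T : EReal) : Convex ℝ (timeInterval T) :=
  Set.OrdConnected.convex ⟨fun _ hs _ ht _ hu =>
    ⟨hs.1.trans hu.1, lt_of_le_of_lt (EReal.coe_le_coe_iff.2 hu.2) ht.2⟩⟩

theorem timeInterval_coe (b : ℝ) : timeInterval (b : EReal) = Ico 0 b := by
  ext t
  simp [timeInterval]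

theorem zero_mem_timeInterval {T : EReal} (hT : 0 < T) : (0 : ℝ) ∈ timeInterval T :=
  ⟨le_rfl, by simpa using hT⟩

namespace FlowData

variable {P : FlowData} {x y : ℝ → ℝ} {T : EReal}

/-- A solution with non-positive scalar curvature and `x < y` extends. -/
theorem IsSol.exists_extension_of_lt (hT : 0 < T) (h : P.IsSol x y (timeInterval T))
    (hs : ∀ t ∈ timeInterval T, P.scal (x t) (y t) ≤ 0) (hxy : ∀ t ∈ timeInterval T, x t < y t) :
    ∃ T', T < T' ∧ ∃ x' y' : ℝ → ℝ, P.IsSol x' y' (timeInterval T') ∧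
      EqOn x x' (timeInterval T) ∧ EqOn y y' (timeInterval T) := by
  have h0 := zero_mem_timeInterval hT
  have hconv := convex_timeInterval T
  have hc : 0 < P.E₂ / P.d₂ := div_pos (P.C_pos.trans_le P.C_le) P.d₂_pos
  have hxmono : MonotoneOn x (timeInterval T) :=
    monotoneOn_of_hasDerivWithinAt_nonneg hconv (fun t ht => (h.deriv₁ t ht).continuousWithinAt)
      (fun t ht => (h.deriv₁ t (interior_subset ht)).mono interior_subset) fun t ht => by
        have ht := interior_subset ht
        have := P.r₁_neg_of_scal_nonpos (h.pos₁ t ht) (hxy t ht) (hs t ht)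
        linarith
  -- The linear term encodes decay at a definite rate; as `y` stays positive, this bounds the
  -- lifetime.
  have hyanti : AntitoneOn (fun t => y t + P.E₂ / P.d₂ * t) (timeInterval T) := by
    have hd : ∀ t ∈ timeInterval T, HasDerivWithinAt (fun t => y t + P.E₂ / P.d₂ * t)
        (-2 * P.r₂ (x t) (y t) + P.E₂ / P.d₂ * 1) (timeInterval T) t := fun t ht =>
      (h.deriv₂ t ht).add ((hasDerivWithinAt_id t _).const_mul _)
    refine antitoneOn_of_hasDerivWithinAt_nonpos hconv (fun t ht => (hd t ht).continuousWithinAt)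
      (fun t ht => (hd t (interior_subset ht)).mono interior_subset) fun t ht => ?_
    have ht := interior_subset ht
    have h1 := P.le_r₂ (h.pos₁ t ht) (hxy t ht)
    have h2 : P.E₂ / P.d₂ = 2 * (P.E₂ / 2 / P.d₂) := by ring
    linarith
  have hyle : ∀ t ∈ timeInterval T, y t + P.E₂ / P.d₂ * t ≤ y 0 := fun t ht => by
    simpa using hyanti h0 ht ht.1
  have hlt : ∀ t ∈ timeInterval T, t < y 0 / (P.E₂ / P.d₂) := fun t ht => by
    rw [lt_div_iff₀ hc]
    have := hyle t ht
    have := h.pos₂ t ht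
    linarith
  induction T using EReal.rec with
  | bot => simp at hT
  | top =>
    have := hlt (y 0 / (P.E₂ / P.d₂))
      ⟨div_nonneg (h.pos₂ 0 h0).le hc.le, EReal.coe_lt_top _⟩
    exact absurd this (lt_irrefl _)
  | coe b =>
    have hb : 0 < b := by simpa using hT
    rw [timeInterval_coe] at *
    have hyanti' : AntitoneOn y (Ico 0 b) := fun s hs t ht hst => by
      have h1 := hyanti hs ht hst
      have h2 := mul_le_mul_of_nonneg_left hst hc.le
      simp only at h1
      linarith
    have hne : (Ioo 0 b).Nonempty := nonempty_Ioo.2 hb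
    have hsub : Ioo 0 b ⊆ Ico 0 b := Ioo_subset_Ico_self
    have hx0 := h.pos₁ 0 h0
    have hyle' : ∀ t ∈ Ico 0 b, y t ≤ y 0 := fun t ht => hyanti' h0 ht ht.1
    have hxge : ∀ t ∈ Ico 0 b, x 0 ≤ x t := fun t ht => hxmono h0 ht ht.1
    -- `x` increases and is bounded above by `y 0`; `y` decreases and, by positivity, is bounded
    -- below. So both converge at `b`.
    have hxlim := (hxmono.mono hsub).tendsto_nhdsWithin_Ioo_left hne
      ⟨y 0, by rintro _ ⟨t, ht, rfl⟩; exact (hxy t (hsub ht)).le.trans (hyle' t (hsub ht))⟩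
    have hylim := ((hyanti'.mono hsub).neg).tendsto_nhdsWithin_Ioo_left hne
      ⟨0, by rintro _ ⟨t, ht, rfl⟩; exact neg_nonpos.2 (h.pos₂ t (hsub ht)).le⟩
    have hylim' := hylim.neg
    simp only [neg_neg] at hylim'
    generalize sSup (x '' Ioo 0 b) = l₁ at hxlim
    generalize -sSup ((fun t => -y t) '' Ioo 0 b) = l₂ at hylim'
    have hev : ∀ᶠ t in 𝓝[<] b, t ∈ Ico 0 b :=
      mem_of_superset (Ioo_mem_nhdsLT hb) hsub
    have hl₁ : 0 < l₁ := hx0.trans_le (ge_of_tendsto hxlim (hev.mono hxge))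
    have hl₂ : 0 < l₂ := hx0.trans_le (ge_of_tendsto hylim'
      (hev.mono fun t ht => (hxge t ht).trans (hxy t ht).le))
    let v : ℝ × ℝ → ℝ × ℝ := fun q => (-2 * P.r₁ q.1 q.2, -2 * P.r₂ q.1 q.2)
    -- Both limits are at least `x 0 > 0`, so no denominator of the vector field vanishes there.
    have hv : ContDiffAt ℝ 1 v (l₁, l₂) := by
      have c1 : ContDiffAt ℝ 1 (fun q : ℝ × ℝ => q.1) (l₁, l₂) := contDiffAt_fst
      have c2 : ContDiffAt ℝ 1 (fun q : ℝ × ℝ => q.2) (l₁, l₂) := contDiffAt_snd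
      have n1 : (l₁, l₂).1 ≠ 0 := hl₁.ne'
      have n2 : (l₁, l₂).2 ≠ 0 := hl₂.ne'
      refine ContDiffAt.prodMk (contDiffAt_const.mul (ContDiffAt.div_const ?_ _))
        (contDiffAt_const.mul (ContDiffAt.div_const ?_ _))
      · exact (contDiffAt_const.sub (contDiffAt_const.mul (c2.div c1 n1))).add
          (contDiffAt_const.mul ((c1.pow 2).div (c2.pow 2) (pow_ne_zero 2 n2)))
      · exact (contDiffAt_const.sub (contDiffAt_const.mul (c1.div c2 n2))).add
          (contDiffAt_const.mul ((c2.pow 2).div (c1.pow 2) (pow_ne_zero 2 n1)))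
    obtain ⟨c, hbc, Z, hZX, hZ, hZU⟩ := exists_extension (X := fun t => (x t, y t)) hb hv
      (fun t ht => (h.deriv₁ t ht).prodMk (h.deriv₂ t ht)) (hxlim.prodMk_nhds hylim')
      (prod_mem_nhds (Ioi_mem_nhds hl₁) (Ioi_mem_nhds hl₂))
    refine ⟨c, EReal.coe_lt_coe_iff.2 hbc, fun t => (Z t).1, fun t => (Z t).2, ?_,
      fun t ht => by simp [hZX t ht], fun t ht => by simp [hZX t ht]⟩
    rw [timeInterval_coe]
    have hpos : ∀ t ∈ Ico 0 c, 0 < (Z t).1 ∧ 0 < (Z t).2 := fun t ht => by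
      rcases lt_or_ge t b with htb | htb
      · rw [hZX t ⟨ht.1, htb⟩]
        exact ⟨h.pos₁ t ⟨ht.1, htb⟩, h.pos₂ t ⟨ht.1, htb⟩⟩
      · exact hZU t ⟨htb, ht.2⟩
    exact ⟨fun t ht => (hpos t ht).1, fun t ht => (hpos t ht).2,
      fun t ht => (hasFDerivAt_fst (p := Z t)).comp_hasDerivWithinAt t (hZ t ht),
      fun t ht => (hasFDerivAt_snd (p := Z t)).comp_hasDerivWithinAt t (hZ t ht)⟩

/-- A solution with non-positive scalar curvature extends. -/
theorem IsSol.exists_extension (hT : 0 < T) (h : P.IsSol x y (timeInterval T))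
    (hs : ∀ t ∈ timeInterval T, P.scal (x t) (y t) ≤ 0) :
    ∃ T', T < T' ∧ ∃ x' y' : ℝ → ℝ, P.IsSol x' y' (timeInterval T') ∧
      EqOn x x' (timeInterval T) ∧ EqOn y y' (timeInterval T) := by
  have h0 := zero_mem_timeInterval hT
  -- As the diagonal is never met, the sign of `x - y` is constant by the intermediate value
  -- theorem; exchanging the summands reduces to `x < y`.
  have hne : ∀ t ∈ timeInterval T, x t ≠ y t := fun t ht he => by
    have h1 := P.scal_self_pos (h.pos₁ t ht)
    have h2 := hs t ht
    rw [← he] at h2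
    linarith
  have hcx : ContinuousOn x (timeInterval T) := fun t ht => (h.deriv₁ t ht).continuousWithinAt
  have hcy : ContinuousOn y (timeInterval T) := fun t ht => (h.deriv₂ t ht).continuousWithinAt
  have hpc := (convex_timeInterval T).isPreconnected
  rcases lt_or_gt_of_ne (hne 0 h0) with h1 | h1
  · refine h.exists_extension_of_lt hT hs fun t ht => ?_
    by_contra hlt
    obtain ⟨u, hu, he⟩ := hpc.intermediate_value₂ h0 ht hcx hcy h1.le (not_lt.1 hlt)
    exact hne u hu he
  · obtain ⟨T', hT', y', x', hsol, h2, h3⟩ := h.swap.exists_extension_of_lt hT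
      (fun t ht => by rw [scal_swap]; exact hs t ht) fun t ht => by
        by_contra hlt
        obtain ⟨u, hu, he⟩ := hpc.intermediate_value₂ h0 ht hcy hcx h1.le (not_lt.1 hlt)
        exact hne u hu he.symm
    exact ⟨T', hT', x', y', hsol.swap, h3, h2⟩

end FlowData

end PlanarFlow

/-! ### The Ricci tensor of the diagonal metrics -/

section DiagonalRicci

variable {L : Type*} [LieRing L] [LieAlgebra ℝ L] [FiniteDimensional ℝ L]
variable {k : LieSubalgebra ℝ L} {p : Submodule ℝ L} {p₁ p₂ : Submodule ℝ p}
variable {B : LinearMap.BilinForm ℝ L} {φ : p →ₗ[ℝ] L}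

/-- The scalar curvature when metric and Ricci tensor are both diagonal. -/
theorem scalarCurvature_diagForm (hkp : IsCompl k.toSubmodule p) (h : IsCompl p₁ p₂)
    {Q : LinearMap.BilinForm ℝ p} (hQ : IsScalarProduct Q)
    (ho : ∀ X ∈ p₁, ∀ Y ∈ p₂, Q X Y = 0) {x y r s : ℝ} (hx : 0 < x) (hy : 0 < y)
    (hric : ricci hkp (diagForm h Q x y) = diagForm h Q r s) :
    scalarCurvature hkp (diagForm h Q x y)
      = Module.finrank ℝ p₁ * r / x + Module.finrank ℝ p₂ * s / y := by
  obtain ⟨e, he, he₁, he₂⟩ := exists_adapted_isOrthonormalBasis h hQ ho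
  have hnd := (isScalarProduct_diagForm h hQ hx hy).nondegenerate
  rw [scalarCurvature, dif_pos hnd, he.trace]
  set T : Module.End ℝ p := (LinearMap.BilinForm.toDual _ hnd).symm.toLinearMap ∘ₗ
    ricci hkp (diagForm h Q x y) with hTdef
  have hT : ∀ i, diagForm h Q x y (T (e i)) (e i) = diagForm h Q r s (e i) (e i) := fun i => by
    rw [← hric]
    exact LinearMap.BilinForm.apply_toDual_symm_apply (hB := hnd) _ _
  have hi : ∀ i, Q (T (e i)) (e i)
      = Sum.elim (fun _ => r) (fun _ => s) i / Sum.elim (fun _ => x) (fun _ => y) i := fun i => by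
    have h1 := hT i
    rw [diagForm_basis h hQ ho he₁ he₂, diagForm_basis h hQ ho he₁ he₂, he, if_pos rfl] at h1
    have : Sum.elim (fun _ => x) (fun _ => y) i ≠ 0 := by rcases i with i | i <;> simp [hx.ne', hy.ne']
    rw [eq_div_iff this, mul_comm, h1, mul_one]
  simp only [hi, Fintype.sum_sum_type, Sum.elim_inl, Sum.elim_inr, Finset.sum_const,
    Finset.card_univ, Fintype.card_fin, nsmul_eq_mul]
  ring

/-- Schur's lemma on a summand needs a symmetric form. For equal metric coefficients the basis
formula is visibly symmetric in `a` and `b`. -/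
theorem ricci_basis_symm {ι₁ ι₂ : Type*} [Fintype ι₁] [Fintype ι₂] [DecidableEq ι₁]
    [DecidableEq ι₂] (hφ : IsHorizontalLift k B φ)
    (hB : IsScalarProduct B) (hBi : IsLieInvariant B) (hkp : IsCompl k.toSubmodule p)
    (hr : IsReductive k p) {g : LinearMap.BilinForm ℝ p} (hg : IsScalarProduct g)
    (hgk : IsAdInvariant hkp g) {e : Module.Basis (ι₁ ⊕ ι₂) ℝ p}
    (he : IsOrthonormalBasis (liftForm B φ) e) {x : ι₁ ⊕ ι₂ → ℝ} (hx : ∀ i, 0 < x i)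
    (hge : ∀ X i, g X (e i) = x i * liftForm B φ X (e i)) {a b : ι₁ ⊕ ι₂} (hab : x a = x b) :
    ricci hkp g (e a) (e b) = ricci hkp g (e b) (e a) := by
  rw [ricci_basis hφ hB hBi hkp hr hg hgk he hx hge, ricci_basis hφ hB hBi hkp hr hg hgk he hx hge]
  refine Finset.sum_congr rfl fun i _ => ?_
  rw [hB.symm]
  congr 1
  refine Finset.sum_congr rfl fun l _ => ?_
  simp only [lcCoeff, hab]
  ring

theorem ricci_symm_of_mem (hφ : IsHorizontalLift k B φ)
    (hB : IsScalarProduct B) (hBi : IsLieInvariant B) (hkp : IsCompl k.toSubmodule p)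
    (hr : IsReductive k p) (h : IsCompl p₁ p₂)
    (ho : ∀ X ∈ p₁, ∀ Y ∈ p₂, liftForm B φ X Y = 0) {x y : ℝ} (hx : 0 < x) (hy : 0 < y)
    (hgk : IsAdInvariant hkp (diagForm h (liftForm B φ) x y)) :
    (∀ X ∈ p₁, ∀ Y ∈ p₁, ricci hkp (diagForm h (liftForm B φ) x y) X Y
      = ricci hkp (diagForm h (liftForm B φ) x y) Y X) ∧
    (∀ X ∈ p₂, ∀ Y ∈ p₂, ricci hkp (diagForm h (liftForm B φ) x y) X Y
      = ricci hkp (diagForm h (liftForm B φ) x y) Y X) := by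
  have hQ := isScalarProduct_liftForm hφ hB hkp
  obtain ⟨e, he, he₁, he₂⟩ := exists_adapted_isOrthonormalBasis h hQ ho
  have hs := fun a b hab => ricci_basis_symm hφ hB hBi hkp hr (isScalarProduct_diagForm h hQ hx hy)
    hgk he (x := Sum.elim (fun _ => x) (fun _ => y)) (by rintro (i | i) <;> simpa)
    (diagForm_basis h hQ ho he₁ he₂ x y) (a := a) (b := b) hab
  set S := ricci hkp (diagForm h (liftForm B φ) x y) with hS
  have hexp : ∀ X Y : p, S X Y = ∑ i, ∑ j, liftForm B φ X (e i) * liftForm B φ Y (e j) *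
      S (e i) (e j) := fun X Y => by
    conv_lhs => rw [← he.sum_smul X, ← he.sum_smul Y]
    simp only [map_sum, map_smul, LinearMap.sum_apply, LinearMap.smul_apply, smul_eq_mul,
      Finset.mul_sum]
    refine Finset.sum_comm.trans (Finset.sum_congr rfl fun i _ => Finset.sum_congr rfl fun j _ => ?_)
    ring
  refine ⟨fun X hX Y hY => ?_, fun X hX Y hY => ?_⟩
  · have hz : ∀ Z ∈ p₁, ∀ i, liftForm B φ Z (e (Sum.inr i)) = 0 := fun Z hZ i => ho _ hZ _ (he₂ i)
    rw [hexp X, hexp Y, Finset.sum_comm]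
    refine Finset.sum_congr rfl fun j _ => Finset.sum_congr rfl fun i _ => ?_
    rcases i with i | i <;> rcases j with j | j <;>
    first
    | rw [hs (Sum.inl i) (Sum.inl j) rfl]; ring
    | simp [hz _ hX, hz _ hY]
  · have hz : ∀ Z ∈ p₂, ∀ i, liftForm B φ Z (e (Sum.inl i)) = 0 := fun Z hZ i => by
      rw [hQ.symm, ho _ (he₁ i) _ hZ]
    rw [hexp X, hexp Y, Finset.sum_comm]
    refine Finset.sum_congr rfl fun j _ => Finset.sum_congr rfl fun i _ => ?_
    rcases i with i | i <;> rcases j with j | j <;>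
    first
    | rw [hs (Sum.inr i) (Sum.inr j) rfl]; ring
    | simp [hz _ hX, hz _ hY]

theorem finrank_pos_of_ne_bot {V : Type*} [AddCommGroup V] [Module ℝ V] [FiniteDimensional ℝ V]
    {W : Submodule ℝ V} (hW : W ≠ ⊥) : (0 : ℝ) < Module.finrank ℝ W := by
  have : Nontrivial W := Submodule.nontrivial_iff_ne_bot.2 hW
  exact_mod_cast Module.finrank_pos

/-- The Ricci tensors of the diagonal metrics, when the Schur lemma applies to them. -/
theorem exists_flowData (hφ : IsHorizontalLift k B φ)
    (hB : IsScalarProduct B) (hBi : IsLieInvariant B) (hkp : IsCompl k.toSubmodule p)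
    (hr : IsReductive k p) (h : IsCompl p₁ p₂)
    (ho : ∀ X ∈ p₁, ∀ Y ∈ p₂, liftForm B φ X Y = 0)
    (hgk : ∀ x y, IsAdInvariant hkp (diagForm h (liftForm B φ) x y))
    (hoff : ∀ x y, 0 < x → 0 < y → ∀ X ∈ p₁, ∀ Y ∈ p₂,
      ricci hkp (diagForm h (liftForm B φ) x y) X Y = 0 ∧
      ricci hkp (diagForm h (liftForm B φ) x y) Y X = 0)
    (hsch₁ : ∀ x y, 0 < x → 0 < y → (∀ X ∈ p₁, ∀ Y ∈ p₁,
      ricci hkp (diagForm h (liftForm B φ) x y) X Y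
        = ricci hkp (diagForm h (liftForm B φ) x y) Y X) →
      ∃ c, ∀ X ∈ p₁, ∀ Y ∈ p₁,
        ricci hkp (diagForm h (liftForm B φ) x y) X Y = c * liftForm B φ X Y)
    (hsch₂ : ∀ x y, 0 < x → 0 < y → (∀ X ∈ p₂, ∀ Y ∈ p₂,
      ricci hkp (diagForm h (liftForm B φ) x y) X Y
        = ricci hkp (diagForm h (liftForm B φ) x y) Y X) →
      ∃ c, ∀ X ∈ p₂, ∀ Y ∈ p₂,
        ricci hkp (diagForm h (liftForm B φ) x y) X Y = c * liftForm B φ X Y)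
    (hp₁ : p₁ ≠ ⊥) (hp₂ : p₂ ≠ ⊥)
    (hA : ¬ ∀ X ∈ p₁, ∀ Y ∈ p₁, liftBracketP hkp φ X Y ∈ p₁)
    (hC : ¬ ∀ X ∈ p₂, ∀ Y ∈ p₂, liftBracketP hkp φ X Y ∈ p₂) :
    ∃ P : FlowData, P.d₁ = Module.finrank ℝ p₁ ∧ P.d₂ = Module.finrank ℝ p₂ ∧
      ∀ x y, 0 < x → 0 < y → ricci hkp (diagForm h (liftForm B φ) x y)
        = diagForm h (liftForm B φ) (P.r₁ x y) (P.r₂ x y) := by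
  have hQ := isScalarProduct_liftForm hφ hB hkp
  obtain ⟨e, he, he₁, he₂⟩ := exists_adapted_isOrthonormalBasis h hQ ho
  have r := structureConst_rotate hφ hB hBi hkp e
  have s := structureConst_swap (B := B) (φ := φ) hkp e
  set τ := structureConst hkp B φ e with hτ
  have hd₁ := finrank_pos_of_ne_bot hp₁
  have hd₂ := finrank_pos_of_ne_bot hp₂
  have hexp₁ : ∀ X ∈ p₁, X = ∑ i, liftForm B φ X (e (Sum.inl i)) • e (Sum.inl i) := fun X hX => by
    conv_lhs => rw [← he.sum_smul X, Fintype.sum_sum_type]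
    simp [ho _ hX _ (he₂ _)]
  have hexp₂ : ∀ X ∈ p₂, X = ∑ i, liftForm B φ X (e (Sum.inr i)) • e (Sum.inr i) := fun X hX => by
    conv_lhs => rw [← he.sum_smul X, Fintype.sum_sum_type]
    simp [hQ.symm X, ho _ (he₁ _) _ hX]
  -- If this sum vanished, the lifted bracket would map `p₁ × p₁` into `p₁`, contrary to `hA`.
  have hApos : 0 < sqSum fun (i a : Fin (Module.finrank ℝ p₁)) (l : Fin (Module.finrank ℝ p₂)) =>
      τ (Sum.inl i) (Sum.inl a) (Sum.inr l) := by
    refine (sqSum_nonneg _).lt_of_ne fun h0 => hA fun X hX Y hY => ?_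
    have hz := eq_zero_of_sqSum_eq_zero h0.symm
    rw [hexp₁ X hX, hexp₁ Y hY]
    simp only [map_sum, map_smul, LinearMap.sum_apply, LinearMap.smul_apply]
    refine Submodule.sum_mem _ fun i _ => Submodule.smul_mem _ _ <| Submodule.sum_mem _ fun j _ =>
      Submodule.smul_mem _ _ ?_
    rw [← he.sum_smul (liftBracketP _ _ _ _), Fintype.sum_sum_type]
    refine Submodule.add_mem _ (Submodule.sum_mem _ fun l _ => Submodule.smul_mem _ _ (he₁ _)) ?_
    refine Submodule.sum_mem _ fun l _ => ?_
    have := hz j i l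
    simp only [hτ, structureConst] at this
    simp [this]
  have hCpos : 0 < sqSum fun (i a : Fin (Module.finrank ℝ p₂)) (l : Fin (Module.finrank ℝ p₁)) =>
      τ (Sum.inr i) (Sum.inr a) (Sum.inl l) := by
    refine (sqSum_nonneg _).lt_of_ne fun h0 => hC fun X hX Y hY => ?_
    have hz := eq_zero_of_sqSum_eq_zero h0.symm
    rw [hexp₂ X hX, hexp₂ Y hY]
    simp only [map_sum, map_smul, LinearMap.sum_apply, LinearMap.smul_apply]
    refine Submodule.sum_mem _ fun i _ => Submodule.smul_mem _ _ <| Submodule.sum_mem _ fun j _ =>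
      Submodule.smul_mem _ _ ?_
    rw [← he.sum_smul (liftBracketP _ _ _ _), Fintype.sum_sum_type]
    refine Submodule.add_mem _ ?_ (Submodule.sum_mem _ fun l _ => Submodule.smul_mem _ _ (he₂ _))
    refine Submodule.sum_mem _ fun l _ => ?_
    have := hz j i l
    simp only [hτ, structureConst] at this
    simp [this]
  have hBn : ∀ U, 0 ≤ B U U := fun U => by
    by_cases hU : U = 0
    · simp [hU]
    · exact (hB.pos U hU).le
  let N (a : Fin (Module.finrank ℝ p₁) ⊕ Fin (Module.finrank ℝ p₂)) : ℝ :=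
    ∑ i, B (liftBracketK hkp φ (e i) (e a)) (liftBracketK hkp φ (e i) (e a))
  have hN : ∀ a, 0 ≤ N a := fun a => Finset.sum_nonneg fun i _ => hBn _
  -- `E₁` and `E₂` collect the terms independent of the ratio of the metric coefficients. They
  -- contain `A` and `C` together with non-negative summands, hence `A_le` and `C_le`.
  let P : FlowData :=
    { d₁ := Module.finrank ℝ p₁
      d₂ := Module.finrank ℝ p₂
      E₁ := sqSum (fun i a l => τ (Sum.inl i) (Sum.inl a) (Sum.inl l)) / 4
        + sqSum (fun i a l => τ (Sum.inl i) (Sum.inl a) (Sum.inr l)) + ∑ a, N (Sum.inl a)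
      E₂ := sqSum (fun i a l => τ (Sum.inr i) (Sum.inr a) (Sum.inr l)) / 4
        + sqSum (fun i a l => τ (Sum.inr i) (Sum.inr a) (Sum.inl l)) + ∑ a, N (Sum.inr a)
      A := sqSum (fun i a l => τ (Sum.inl i) (Sum.inl a) (Sum.inr l))
      C := sqSum (fun i a l => τ (Sum.inr i) (Sum.inr a) (Sum.inl l))
      d₁_pos := hd₁
      d₂_pos := hd₂
      A_pos := hApos
      C_pos := hCpos
      A_le := by
        have := sqSum_nonneg fun i a l => τ (Sum.inl i) (Sum.inl a) (Sum.inl l)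
        have : 0 ≤ ∑ a, N (Sum.inl a) := Finset.sum_nonneg fun a _ => hN _
        linarith
      C_le := by
        have := sqSum_nonneg fun i a l => τ (Sum.inr i) (Sum.inr a) (Sum.inr l)
        have : 0 ≤ ∑ a, N (Sum.inr a) := Finset.sum_nonneg fun a _ => hN _
        linarith }
  refine ⟨P, rfl, rfl, fun x y hx hy => ?_⟩
  have hg := isScalarProduct_diagForm h hQ hx hy
  have hsymm := ricci_symm_of_mem hφ hB hBi hkp hr h ho hx hy (hgk x y)
  obtain ⟨c₁, hc₁⟩ := hsch₁ x y hx hy hsymm.1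
  obtain ⟨c₂, hc₂⟩ := hsch₂ x y hx hy hsymm.2
  have hb := fun a => ricci_basis hφ hB hBi hkp hr hg (hgk x y) he
    (x := Sum.elim (fun _ => x) (fun _ => y)) (by rintro (i | i) <;> simpa)
    (diagForm_basis h hQ ho he₁ he₂ x y) a a
  -- The Schur constant is identified by taking the trace over the summand.
  have t₁ : c₁ = P.r₁ x y := by
    have h1 : ∑ a, ricci hkp (diagForm h (liftForm B φ) x y) (e (Sum.inl a)) (e (Sum.inl a))
        = Module.finrank ℝ p₁ * c₁ := by
      simp [hc₁ _ (he₁ _) _ (he₁ _), he _ _]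
    simp only [hb, Finset.sum_add_distrib] at h1
    rw [sum_lcCoeff r s hx hy (fun _ => rfl) (fun _ => rfl)] at h1
    have h2 : P.r₁ x y = (P.E₁ - P.A / 2 * (y / x) + P.C / 4 * (x ^ 2 / y ^ 2)) / P.d₁ := rfl
    rw [h2, eq_div_iff hd₁.ne', mul_comm, ← h1]
    simp only [P, N]
    field_simp
    ring
  have t₂ : c₂ = P.r₂ x y := by
    have h1 : ∑ a, ricci hkp (diagForm h (liftForm B φ) x y) (e (Sum.inr a)) (e (Sum.inr a))
        = Module.finrank ℝ p₂ * c₂ := by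
      simp [hc₂ _ (he₂ _) _ (he₂ _), he _ _]
    simp only [hb, Finset.sum_add_distrib] at h1
    rw [sum_lcCoeff' r s hx hy (fun _ => rfl) (fun _ => rfl)] at h1
    have h2 : P.r₂ x y = (P.E₂ - P.C / 2 * (x / y) + P.A / 4 * (y ^ 2 / x ^ 2)) / P.d₂ := rfl
    rw [h2, eq_div_iff hd₂.ne', mul_comm, ← h1]
    simp only [P, N]
    field_simp
    ring
  rw [← t₁, ← t₂]
  refine LinearMap.ext fun X => LinearMap.ext fun Y => ?_
  rw [diagForm_apply]
  have m₁ := fun X => Submodule.projection_apply_mem h X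
  have m₂ := fun X => Submodule.projection_apply_mem h.symm X
  conv_lhs => rw [← projection_add_projection h X, ← projection_add_projection h Y]
  simp only [map_add, LinearMap.add_apply]
  rw [(hoff x y hx hy _ (m₁ X) _ (m₂ Y)).1, (hoff x y hx hy _ (m₁ Y) _ (m₂ X)).2,
    hc₁ _ (m₁ X) _ (m₁ Y), hc₂ _ (m₂ X) _ (m₂ Y)]
  ring

end DiagonalRicci

/-! ### Translation between the homogeneous and the planar flow -/

section DiagonalFlow

variable {L : Type*} [LieRing L] [LieAlgebra ℝ L]
variable {k : LieSubalgebra ℝ L} {p : Submodule ℝ L} {p₁ p₂ : Submodule ℝ p}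

/-- The flow of the metrics `x₁ Q|p₁ ⊕ x₂ Q|p₂` in terms of a second scalar product `Q₀`. -/
theorem isHRF_iff (hkp : IsCompl k.toSubmodule p) (h : IsCompl p₁ p₂)
    {Q Q₀ : LinearMap.BilinForm ℝ p} (hQ₀ : IsScalarProduct Q₀) {q₁ q₂ : ℝ} (hq₁ : 0 < q₁)
    (hq₂ : 0 < q₂) (hQ : ∀ x y, diagForm h Q x y = diagForm h Q₀ (q₁ * x) (q₂ * y))
    (hp₁ : p₁ ≠ ⊥) (hp₂ : p₂ ≠ ⊥) {P : FlowData}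
    (hP : ∀ x y, 0 < x → 0 < y → ricci hkp (diagForm h Q₀ x y)
        = diagForm h Q₀ (P.r₁ x y) (P.r₂ x y)) {x₁ x₂ : ℝ → ℝ} {J : Set ℝ} :
    IsHRF hkp h Q x₁ x₂ J ↔ P.IsSol (fun t => q₁ * x₁ t) (fun t => q₂ * x₂ t) J := by
  constructor
  · intro hf
    have p₁' := fun t ht => mul_pos hq₁ (hf.pos₁ t ht)
    have p₂' := fun t ht => mul_pos hq₂ (hf.pos₂ t ht)
    refine ⟨p₁', p₂', fun t ht => ?_, fun t ht => ?_⟩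
    -- Testing the flow on one non-zero vector of the summand and dividing by `Q₀ X X` isolates the
    -- scalar equation.
    · obtain ⟨X, hX, hX0⟩ := Submodule.exists_mem_ne_zero_of_ne_bot hp₁
      have hne := (hQ₀.pos X hX0).ne'
      have h1 := (hf.flow.flow t ht X X).div_const (Q₀ X X)
      simp only [hQ, hP _ _ (p₁' t ht) (p₂' t ht), diagForm_apply, projection_of_mem h hX,
        projection_of_mem_right h.symm hX, map_zero, mul_zero, add_zero] at h1
      refine (h1.congr_deriv ?_).congr (fun s _ => ?_) ?_ <;> field_simp
    · obtain ⟨X, hX, hX0⟩ := Submodule.exists_mem_ne_zero_of_ne_bot hp₂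
      have hne := (hQ₀.pos X hX0).ne'
      have h1 := (hf.flow.flow t ht X X).div_const (Q₀ X X)
      simp only [hQ, hP _ _ (p₁' t ht) (p₂' t ht), diagForm_apply, projection_of_mem h.symm hX,
        projection_of_mem_right h hX, map_zero, mul_zero, zero_add] at h1
      refine (h1.congr_deriv ?_).congr (fun s _ => ?_) ?_ <;> field_simp
  · intro hf
    refine ⟨fun t ht => pos_of_mul_pos_right (hf.pos₁ t ht) hq₁.le,
      fun t ht => pos_of_mul_pos_right (hf.pos₂ t ht) hq₂.le, fun t ht => ?_, fun t ht X Y => ?_⟩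
    · rw [hQ]
      exact isScalarProduct_diagForm h hQ₀ (hf.pos₁ t ht) (hf.pos₂ t ht)
    · simp only [hQ, hP _ _ (hf.pos₁ t ht) (hf.pos₂ t ht), diagForm_apply]
      refine (((hf.deriv₁ t ht).mul_const _).add ((hf.deriv₂ t ht).mul_const _)).congr_deriv ?_
      ring

end DiagonalFlow

/-! ### Invariance of diagonal forms -/

section RepDiagForm

variable {M V : Type*} [Group M] [AddCommGroup V] [Module ℝ V] {ρ : Representation ℝ M V}
variable {p₁ p₂ : Submodule ℝ V}

theorem projection_rep (h : IsCompl p₁ p₂) (h₁ : ∀ a, ∀ X ∈ p₁, ρ a X ∈ p₁)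
    (h₂ : ∀ a, ∀ X ∈ p₂, ρ a X ∈ p₂) (a : M) (X : V) :
    p₁.projection p₂ h (ρ a X) = ρ a (p₁.projection p₂ h X) := by
  conv_lhs => rw [← projection_add_projection h X, map_add, map_add,
    projection_of_mem h (h₁ a _ (Submodule.projection_apply_mem h X)),
    projection_of_mem_right h (h₂ a _ (Submodule.projection_apply_mem h.symm X)), add_zero]

theorem IsRepInvariant.diagForm (h : IsCompl p₁ p₂) (h₁ : ∀ a, ∀ X ∈ p₁, ρ a X ∈ p₁)
    (h₂ : ∀ a, ∀ X ∈ p₂, ρ a X ∈ p₂) {Q : LinearMap.BilinForm ℝ V} (hQ : IsRepInvariant ρ Q)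
    (x y : ℝ) : IsRepInvariant ρ (diagForm h Q x y) := fun a X Y => by
  rw [diagForm_apply, diagForm_apply, projection_rep h h₁ h₂, projection_rep h h₁ h₂,
    projection_rep h.symm h₂ h₁, projection_rep h.symm h₂ h₁, hQ, hQ]

theorem diagForm_congr (h : IsCompl p₁ p₂) {Q Q₀ : LinearMap.BilinForm ℝ V} {q₁ q₂ : ℝ}
    (h₁ : ∀ X ∈ p₁, ∀ Y ∈ p₁, Q X Y = q₁ * Q₀ X Y) (h₂ : ∀ X ∈ p₂, ∀ Y ∈ p₂, Q X Y = q₂ * Q₀ X Y)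
    (x y : ℝ) : diagForm h Q x y = diagForm h Q₀ (q₁ * x) (q₂ * y) := by
  refine LinearMap.ext fun X => LinearMap.ext fun Y => ?_
  have m₁ := fun X => Submodule.projection_apply_mem h X
  have m₂ := fun X => Submodule.projection_apply_mem h.symm X
  rw [diagForm_apply, diagForm_apply, h₁ _ (m₁ X) _ (m₁ Y), h₂ _ (m₂ X) _ (m₂ Y)]
  ring

/-- Two invariant scalar products are proportional on an irreducible subspace. -/
theorem exists_pos_eq_mul_of_irreducible [FiniteDimensional ℝ V] {W : Submodule ℝ V}
    (hW : IsIrreducibleSubrep ρ W) {Q S : LinearMap.BilinForm ℝ V} (hQ : IsScalarProduct Q)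
    (hQi : IsRepInvariant ρ Q) (hS : IsScalarProduct S) (hSi : IsRepInvariant ρ S) :
    ∃ c : ℝ, 0 < c ∧ ∀ X ∈ W, ∀ Y ∈ W, S X Y = c * Q X Y := by
  obtain ⟨c, hc⟩ := exists_eq_mul_of_irreducible hW hQ hQi hSi fun X _ Y _ => hS.symm X Y
  obtain ⟨X, hX, hX0⟩ := Submodule.exists_mem_ne_zero_of_ne_bot hW.ne_bot
  have h1 := hS.pos X hX0
  rw [hc X hX X hX] at h1
  exact ⟨c, pos_of_mul_pos_left h1 (hQ.pos X hX0).le, hc⟩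

end RepDiagForm

/-! ### Application to the isotropy representation -/

section Isotropy

variable {n : ℕ} {G : Type*} [TopologicalSpace G] [ChartedSpace (EuclideanSpace ℝ (Fin n)) G]
  [Group G] [LieGroup (𝓡 n) ∞ G] {K : Subgroup G} {p : Submodule ℝ (GroupLieAlgebra (𝓡 n) G)}

theorem coe_isotropyRep (hkp : IsCompl (isotropyAlgebra n K).toSubmodule p)
    (hp : ∀ a ∈ K, ∀ X ∈ p, Ad a X ∈ p) {a : G} (ha : a ∈ K) (X : p) :
    (isotropyRep hkp a X : GroupLieAlgebra (𝓡 n) G) = Ad a (X : GroupLieAlgebra (𝓡 n) G) :=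
  congrArg Subtype.val (prP_of_mem_p hkp ⟨_, hp a ha X X.2⟩)

/-- The isotropy representation as a representation of `K`. -/
def isotropyRepresentation (hkp : IsCompl (isotropyAlgebra n K).toSubmodule p)
    (hp : ∀ a ∈ K, ∀ X ∈ p, Ad a X ∈ p) : Representation ℝ K p where
  toFun a := isotropyRep hkp (a : G)
  map_one' := LinearMap.ext fun X => Subtype.ext <| by
    rw [coe_isotropyRep hkp hp (SetLike.coe_mem _)]
    exact Ad_one _
  map_mul' a b := LinearMap.ext fun X => Subtype.ext <| by
    rw [Module.End.mul_apply, coe_isotropyRep hkp hp (SetLike.coe_mem _),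
      coe_isotropyRep hkp hp (SetLike.coe_mem _), coe_isotropyRep hkp hp (SetLike.coe_mem _)]
    exact Ad_mul _ _ _

variable {hkp : IsCompl (isotropyAlgebra n K).toSubmodule p}
  {hp : ∀ a ∈ K, ∀ X ∈ p, Ad a X ∈ p}

theorem coe_isotropyRepresentation (a : K) (X : p) :
    (isotropyRepresentation hkp hp a X : GroupLieAlgebra (𝓡 n) G)
      = Ad (a : G) (X : GroupLieAlgebra (𝓡 n) G) :=
  coe_isotropyRep hkp hp a.2 X

theorem IsIrreducibleSummand.isIrreducibleSubrep {W : Submodule ℝ p}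
    (hW : IsIrreducibleSummand hkp W) :
    IsIrreducibleSubrep (isotropyRepresentation hkp hp) W :=
  ⟨hW.ne_bot, fun a => hW.invariant a a.2, fun U hU hUi => hW.irreducible U hU
    fun a ha => hUi ⟨a, ha⟩⟩

theorem isReductive_isotropyAlgebra (hp : ∀ a ∈ K, ∀ X ∈ p, Ad a X ∈ p) :
    IsReductive (isotropyAlgebra n K) p :=
  fun _ hZ _ hX => lie_mem_of_Ad_invariant p hp hZ hX

theorem prP_Ad (a : K) (U : GroupLieAlgebra (𝓡 n) G) :
    prP hkp (Ad (a : G) U) = isotropyRepresentation hkp hp a (prP hkp U) := by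
  conv_lhs => rw [← prP_add_prK hkp U, map_add, map_add,
    prP_of_mem_k hkp (Ad_mem_isotropyAlgebra a.2 (prK hkp U).2), add_zero,
    ← coe_isotropyRepresentation (hkp := hkp) (hp := hp), prP_of_mem_p]

theorem IsRepInvariant.isAdInvariant {g : LinearMap.BilinForm ℝ p}
    (hg : IsRepInvariant (isotropyRepresentation hkp hp) g) : IsAdInvariant hkp g := by
  intro Z hZ X Y
  -- The infinitesimal statement concerns forms on the whole Lie algebra, so `g` is first extended
  -- by the projection to `p`.
  have h := form_lie_of_Ad_invariant p (g.compl₁₂ (prP hkp) (prP hkp)) hp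
    (fun a ha X _ Y _ => by
      simp only [LinearMap.compl₁₂_apply]
      rw [prP_Ad (hp := hp) ⟨a, ha⟩, prP_Ad (hp := hp) ⟨a, ha⟩, hg]) hZ X.2 Y.2
  simp only [LinearMap.compl₁₂_apply, prP_of_mem_p] at h
  exact h

theorem IsRepInvariant.ricci {g : LinearMap.BilinForm ℝ p} (hg : IsScalarProduct g)
    (hgi : IsRepInvariant (isotropyRepresentation hkp hp) g) :
    IsRepInvariant (isotropyRepresentation hkp hp) (ricci hkp g) := by
  intro a X Y
  let F : GroupLieAlgebra (𝓡 n) G →ₗ⁅ℝ⁆ GroupLieAlgebra (𝓡 n) G :=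
    { Ad (a : G) with map_lie' := fun {X Y} => Ad_lie (a : G) X Y }
  let ψ : p ≃ₗ[ℝ] p := LinearEquiv.ofLinearMap (isotropyRepresentation hkp hp a)
    (isotropyRepresentation hkp hp a⁻¹)
    (LinearMap.ext fun X => Representation.self_inv_apply (isotropyRepresentation hkp hp) a X)
    (LinearMap.ext fun X => Representation.inv_self_apply (isotropyRepresentation hkp hp) a X)
  exact ricci_map hkp hg F (fun Z hZ => Ad_mem_isotropyAlgebra a.2 hZ) ψ
    (fun X => coe_isotropyRepresentation a X) (hgi a) X Y

/-- The lift is equivariant, because `Ad a` preserves both `k` and its `B`-orthogonality and lifts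
are unique. -/
theorem isRepInvariant_liftForm {B : LinearMap.BilinForm ℝ (GroupLieAlgebra (𝓡 n) G)}
    (hB : IsScalarProduct B) (hBi : ∀ (a : G) X Y, B (Ad a X) (Ad a Y) = B X Y)
    {φ : p →ₗ[ℝ] GroupLieAlgebra (𝓡 n) G} (hφ : IsHorizontalLift (isotropyAlgebra n K) B φ) :
    IsRepInvariant (isotropyRepresentation hkp hp) (liftForm B φ) := by
  have h : ∀ (a : K) X, φ (isotropyRepresentation hkp hp a X) = Ad (a : G) (φ X) := by
    intro a X
    refine (hφ.eq hB ?_ fun Z hZ => ?_).symm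
    · rw [coe_isotropyRepresentation, ← map_sub]
      exact Ad_mem_isotropyAlgebra a.2 (hφ.sub_mem X)
    · rw [← hBi (a : G)⁻¹, Ad_inv_Ad]
      exact hφ.orthogonal _ _ (Ad_mem_isotropyAlgebra (K.inv_mem a.2) hZ)
  intro a X Y
  rw [liftForm_apply, liftForm_apply, h, h, hBi]

/-- By maximality, a proper invariant subspace of `p` does not give rise to a subalgebra. -/
theorem not_liftBracketP_mem (hmax : IsMaximalIsotropy n K)
    {B : LinearMap.BilinForm ℝ (GroupLieAlgebra (𝓡 n) G)} {φ : p →ₗ[ℝ] GroupLieAlgebra (𝓡 n) G}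
    (hφ : IsHorizontalLift (isotropyAlgebra n K) B φ) {W : Submodule ℝ p}
    (hW : ∀ a, ∀ X ∈ W, isotropyRepresentation hkp hp a X ∈ W) (hb : W ≠ ⊥) (ht : W ≠ ⊤) :
    ¬ ∀ X ∈ W, ∀ Y ∈ W, liftBracketP hkp φ X Y ∈ W := by
  intro hbr
  have hr := isReductive_isotropyAlgebra hp
  have had : ∀ Z ∈ isotropyAlgebra n K, ∀ X ∈ W, adP hkp Z X ∈ W := by
    intro Z hZ X hX
    have h := lie_mem_of_Ad_invariant (W.map p.subtype) (K := K) (by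
      rintro a ha _ ⟨X, hX, rfl⟩
      exact ⟨_, hW ⟨a, ha⟩ X hX, coe_isotropyRepresentation (hkp := hkp) (hp := hp) ⟨a, ha⟩ X⟩)
      hZ ⟨X, hX, rfl⟩
    obtain ⟨Y, hY, h⟩ := h
    rwa [← Subtype.ext (h.trans (coe_adP hkp hr hZ X).symm)]
  -- The candidate is $\mathfrak k\oplus W$, written as the preimage of `W` under the projection to
  -- `p`.
  let H : LieSubalgebra ℝ (GroupLieAlgebra (𝓡 n) G) :=
    { W.comap (prP hkp) with
      lie_mem' := by
        intro U V hU hV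
        change prP hkp U ∈ W at hU
        change prP hkp V ∈ W at hV
        change prP hkp ⁅U, V⁆ ∈ W
        have hk : ∀ U : GroupLieAlgebra (𝓡 n) G, U - φ (prP hkp U) ∈ isotropyAlgebra n K := by
          intro U
          have h1 := (isotropyAlgebra n K).sub_mem (prK hkp U).2 (hφ.sub_mem (prP hkp U))
          have h2 : U - φ (prP hkp U) = (prK hkp U : GroupLieAlgebra (𝓡 n) G)
              - (φ (prP hkp U) - (prP hkp U : GroupLieAlgebra (𝓡 n) G)) := by
            conv_lhs => rw [← prP_add_prK hkp U, map_add, prP_of_mem_p,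
              prP_of_mem_k hkp (prK hkp U).2, add_zero]
            abel
          rwa [h2]
        -- Splitting into horizontal and vertical parts: the horizontal bracket lands in `W` by
        -- `hbr`, the mixed ones by `had`, and the vertical one has no `p`-component.
        have e : ⁅U, V⁆ = ⁅φ (prP hkp U), φ (prP hkp V)⁆ + ⁅U - φ (prP hkp U), φ (prP hkp V)⁆
            - ⁅V - φ (prP hkp V), φ (prP hkp U)⁆ + ⁅U - φ (prP hkp U), V - φ (prP hkp V)⁆ := by
          rw [← lie_skew (V - φ (prP hkp V)) (φ (prP hkp U))]
          simp only [sub_lie, lie_sub]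
          abel
        rw [e, map_add, map_sub, map_add, prP_lie hkp (hk U), prP_lie hkp (hk V), hφ.prP, hφ.prP,
          prP_of_mem_k hkp ((isotropyAlgebra n K).lie_mem (hk U) (hk V)), add_zero]
        exact W.sub_mem (W.add_mem (hbr _ hU _ hV) (had _ (hk U) _ hV)) (had _ (hk V) _ hU) }
  have hH : ∀ U, U ∈ H ↔ prP hkp U ∈ W := fun U => Iff.rfl
  have h := hmax H (fun U hU => by rw [hH, prP_of_mem_k hkp hU]; exact W.zero_mem)
    (fun a ha U hU => by
      rw [hH, prP_Ad (hp := hp) ⟨a, ha⟩]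
      exact hW _ _ ((hH U).1 hU))
  rcases h with h | h
  · obtain ⟨X, hX, hX0⟩ := Submodule.exists_mem_ne_zero_of_ne_bot hb
    have h1 : (X : GroupLieAlgebra (𝓡 n) G) ∈ H := by rwa [hH, prP_of_mem_p]
    rw [h] at h1
    exact hX0 (by rw [← prP_of_mem_p hkp X, prP_of_mem_k hkp h1])
  · refine ht (eq_top_iff.2 fun X _ => ?_)
    have h1 : (X : GroupLieAlgebra (𝓡 n) G) ∈ H := by rw [h]; trivial
    rwa [hH, prP_of_mem_p] at h1

/-- The Ricci flow of the metrics `x₁ Q|p₁ ⊕ x₂ Q|p₂` on `G/K` is a planar flow. -/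
theorem IsTwoSummandSplitting.exists_flowData [CompactSpace G] [T2Space G]
    {p₁ p₂ : Submodule ℝ p} (hsplit : IsTwoSummandSplitting hkp p₁ p₂)
    (hmax : IsMaximalIsotropy n K) {Q : LinearMap.BilinForm ℝ p}
    (hQ : IsInvariantScalarProduct hkp Q) :
    ∃ (P : FlowData) (q₁ q₂ : ℝ), 0 < q₁ ∧ 0 < q₂ ∧
      (∀ (x₁ x₂ : ℝ → ℝ) (J : Set ℝ), IsHRF hkp hsplit.isCompl Q x₁ x₂ J ↔
        P.IsSol (fun t => q₁ * x₁ t) (fun t => q₂ * x₂ t) J) ∧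
      ∀ x y, 0 < x → 0 < y → scalarCurvature hkp (diagForm hsplit.isCompl Q x y)
        = P.scal (q₁ * x) (q₂ * y) := by
  have hp := hsplit.reductive
  have hr := isReductive_isotropyAlgebra hp
  have h := hsplit.isCompl
  have hW₁ : IsIrreducibleSubrep (isotropyRepresentation hkp hp) p₁ :=
    hsplit.irreducible₁.isIrreducibleSubrep
  have hW₂ : IsIrreducibleSubrep (isotropyRepresentation hkp hp) p₂ :=
    hsplit.irreducible₂.isIrreducibleSubrep
  have hne : ¬ ∃ φ : p₁ ≃ₗ[ℝ] p₂, ∀ a, ∀ X Y : p₁,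
      (Y : p) = isotropyRepresentation hkp hp a X →
        (φ Y : p) = isotropyRepresentation hkp hp a (φ X) :=
    fun ⟨φ, hφ⟩ => hsplit.inequivalent ⟨φ, fun a ha => hφ ⟨a, ha⟩⟩
  have hQi : IsRepInvariant (isotropyRepresentation hkp hp) Q := fun a => hQ.invariant a a.2
  obtain ⟨B, hB, hBG⟩ := exists_Ad_invariant_scalarProduct (n := n) (G := G)
  have hBi : IsLieInvariant B := fun U V W => form_lie_of_Ad_invariant_univ B hBG U V W
  obtain ⟨φ, hφ⟩ := exists_isHorizontalLift (isotropyAlgebra n K) p hB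
  have hQ₀ := isScalarProduct_liftForm hφ hB hkp
  have hQ₀i : IsRepInvariant (isotropyRepresentation hkp hp) (liftForm B φ) :=
    isRepInvariant_liftForm hB hBG hφ
  -- Inequivalence makes the summands orthogonal; the invariant form is here the scalar product
  -- itself.
  have ho := eq_zero_of_not_equivalent hW₁ hW₂ hne hQ₀ hQ₀i hQ₀i
  have hgi := fun x y => hQ₀i.diagForm h hW₁.invariant hW₂.invariant x y
  have hric := fun x y (hx : 0 < x) (hy : 0 < y) =>
    (hgi x y).ricci (isScalarProduct_diagForm h hQ₀ hx hy)
  have ht₁ : p₁ ≠ ⊤ := fun e => hW₂.ne_bot (by simpa [e] using h.inf_eq_bot)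
  have ht₂ : p₂ ≠ ⊤ := fun e => hW₁.ne_bot (by simpa [e] using h.inf_eq_bot)
  obtain ⟨P, hP₁, hP₂, hP⟩ := HomRicci.exists_flowData hφ hB hBi hkp hr h ho
    (fun x y => (hgi x y).isAdInvariant)
    (fun x y hx hy X hX Y hY =>
      ⟨eq_zero_of_not_equivalent hW₁ hW₂ hne hQ₀ hQ₀i (hric x y hx hy) X hX Y hY,
        -- Symmetry of the Ricci tensor was only derived within each summand, so the other order of
        -- arguments is treated through the flipped form.
        eq_zero_of_not_equivalent (S := (ricci hkp (diagForm h (liftForm B φ) x y)).flip) hW₁ hW₂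
          hne hQ₀ hQ₀i (fun a X Y => hric x y hx hy a Y X) X hX Y hY⟩)
    (fun x y hx hy hs => exists_eq_mul_of_irreducible hW₁ hQ₀ hQ₀i (hric x y hx hy) hs)
    (fun x y hx hy hs => exists_eq_mul_of_irreducible hW₂ hQ₀ hQ₀i (hric x y hx hy) hs)
    hW₁.ne_bot hW₂.ne_bot
    (not_liftBracketP_mem hmax hφ hW₁.invariant hW₁.ne_bot ht₁)
    (not_liftBracketP_mem hmax hφ hW₂.invariant hW₂.ne_bot ht₂)
  -- The given `Q` need not come from `B`, but on each summand it is a positive multiple of the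
  -- induced product; the factors are absorbed into the metric coefficients.
  obtain ⟨q₁, hq₁, h₁⟩ :=
    exists_pos_eq_mul_of_irreducible hW₁ hQ₀ hQ₀i hQ.scalarProduct hQi
  obtain ⟨q₂, hq₂, h₂⟩ :=
    exists_pos_eq_mul_of_irreducible hW₂ hQ₀ hQ₀i hQ.scalarProduct hQi
  have hQQ := diagForm_congr h h₁ h₂
  refine ⟨P, q₁, q₂, hq₁, hq₂, fun x₁ x₂ J =>
    isHRF_iff hkp h hQ₀ hq₁ hq₂ hQQ hW₁.ne_bot hW₂.ne_bot hP, fun x y hx hy => ?_⟩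
  rw [hQQ, scalarCurvature_diagForm hkp h hQ₀ ho (mul_pos hq₁ hx) (mul_pos hq₂ hy)
    (hP _ _ (mul_pos hq₁ hx) (mul_pos hq₂ hy)), FlowData.scal, hP₁, hP₂]

end Isotropy

end HomRicci

end

/-! ### Both claims from the planar flow -/

theorem mainTheorem12 {n : ℕ} {G : Type*} [TopologicalSpace G]
    [ChartedSpace (EuclideanSpace ℝ (Fin n)) G] [Group G] [LieGroup (𝓡 n) ∞ G]
    [CompactSpace G] [T2Space G] (K : Subgroup G) (hK : IsClosed (K : Set G))
    (p : Submodule ℝ (GroupLieAlgebra (𝓡 n) G))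
    (hkp : IsCompl (HomRicci.isotropyAlgebra n K).toSubmodule p)
    (p₁ p₂ : Submodule ℝ p) (hsplit : HomRicci.IsTwoSummandSplitting hkp p₁ p₂)
    (hmax : HomRicci.IsMaximalIsotropy n K)
    (Q : LinearMap.BilinForm ℝ p) (hQ : HomRicci.IsInvariantScalarProduct hkp Q) :
    (∀ (J : Set ℝ) (x₁ x₂ : ℝ → ℝ), J.OrdConnected → J.Nontrivial →
      HomRicci.IsHRF hkp hsplit.isCompl Q x₁ x₂ J →
      ∀ t ∈ J, derivWithin x₁ J t < 0 → derivWithin x₂ J t < 0 →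
        0 < HomRicci.scalarCurvature hkp
          (HomRicci.diagForm hsplit.isCompl Q (x₁ t) (x₂ t))) ∧
    (∀ (T : EReal) (x₁ x₂ : ℝ → ℝ),
      HomRicci.IsMaximalHRF hkp hsplit.isCompl Q x₁ x₂ T →
      HomRicci.scalarCurvature hkp
          (HomRicci.diagForm hsplit.isCompl Q (x₁ 0) (x₂ 0)) < 0 →
      ∃ t₁ : ℝ, 0 < t₁ ∧ (t₁ : EReal) < T ∧ ∀ t : ℝ, t₁ ≤ t → (t : EReal) < T →
        0 < HomRicci.scalarCurvature hkp
          (HomRicci.diagForm hsplit.isCompl Q (x₁ t) (x₂ t))) := by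
  obtain ⟨P, q₁, q₂, hq₁, hq₂, hsol, hscal⟩ := hsplit.exists_flowData hmax hQ
  refine ⟨fun J x₁ x₂ hJ hJn hf t ht hd₁ hd₂ => ?_, fun T x₁ x₂ hf h0 => ?_⟩
  · have hu : UniqueDiffWithinAt ℝ J t := by
      -- An interval with two points has interior, so `derivWithin` agrees with the derivative
      -- prescribed by the flow, also at endpoints.
      refine uniqueDiffWithinAt_convex hJ.convex ?_ (subset_closure ht)
      obtain ⟨a, ha, b, hb, hab⟩ := hJn.exists_lt
      exact (nonempty_Ioo.2 hab).mono
        (interior_maximal (Ioo_subset_Icc_self.trans (hJ.out ha hb)) isOpen_Ioo)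
    have hs := (hsol _ _ _).1 hf
    have hx := hs.pos₁ t ht
    have hy := hs.pos₂ t ht
    have e₁ := (hs.deriv₁ t ht).derivWithin hu
    have e₂ := (hs.deriv₂ t ht).derivWithin hu
    rw [derivWithin_const_mul_field] at e₁ e₂
    have g₁ := mul_neg_of_pos_of_neg hq₁ hd₁
    have g₂ := mul_neg_of_pos_of_neg hq₂ hd₂
    rw [e₁] at g₁
    rw [e₂] at g₂
    have r₁ : 0 < P.r₁ (q₁ * x₁ t) (q₂ * x₂ t) := by linarith
    have r₂ : 0 < P.r₂ (q₁ * x₁ t) (q₂ * x₂ t) := by linarith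
    have := P.d₁_pos
    have := P.d₂_pos
    rw [hscal _ _ (hf.pos₁ t ht) (hf.pos₂ t ht), HomRicci.FlowData.scal]
    positivity
  · have hs := (hsol _ _ _).1 hf.isHRF
    have hsc : ∀ t ∈ HomRicci.timeInterval T, HomRicci.scalarCurvature hkp
        (HomRicci.diagForm hsplit.isCompl Q (x₁ t) (x₂ t)) = P.scal (q₁ * x₁ t) (q₂ * x₂ t) :=
      fun t ht => hscal _ _ (hf.isHRF.pos₁ t ht) (hf.isHRF.pos₂ t ht)
    have hz := HomRicci.zero_mem_timeInterval hf.pos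
    obtain ⟨t₁, ht₁, hpos⟩ : ∃ t ∈ HomRicci.timeInterval T,
        0 < P.scal (q₁ * x₁ t) (q₂ * x₂ t) := by
      -- Without a time of positive scalar curvature the planar solution extends; dividing by `q₁`
      -- and `q₂` gives an extension of the given flow, against maximality.
      by_contra! hle
      obtain ⟨T', hT, y₁, y₂, hy, hy₁, hy₂⟩ := hs.exists_extension hf.pos hle
      refine hf.maximal T' hT (fun t => y₁ t / q₁) (fun t => y₂ t / q₂) ((hsol _ _ _).2 ?_)
        ⟨fun t ht => ?_, fun t ht => ?_⟩
      · simpa only [mul_div_cancel₀ _ hq₁.ne', mul_div_cancel₀ _ hq₂.ne'] using hy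
      · simp only [← hy₁ ht]
        field_simp
      · simp only [← hy₂ ht]
        field_simp
    have hm := hs.monotoneOn_scal (HomRicci.convex_timeInterval T)
    -- The initial time is excluded by the negative initial scalar curvature; from `t₁` on,
    -- monotonicity keeps it positive.
    have hne : t₁ ≠ 0 := by
      rintro rfl
      rw [hsc _ hz] at h0
      exact absurd h0 hpos.not_gt
    refine ⟨t₁, ht₁.1.lt_of_ne' hne, ht₁.2, fun t ht htT => ?_⟩
    have htm : t ∈ HomRicci.timeInterval T := ⟨ht₁.1.trans ht, htT⟩
    rw [hsc t htm]
    exact hpos.trans_le (hm ht₁ htm ht)
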